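/- Let $v(x)=\widetilde v(|x|)$, $x\in\mathbb R^3$, where $\widetilde v\in L^\infty(0,\infty)$ is complex-valued and $\widetilde v(r)=\alpha/r$ for $r\ge R_a$, with constants $\alpha\in\mathbb R$, $R_a>0$. For $\operatorname{Im}\kappa>0$ let $G_v(x,x';\kappa)$ be the distributional kernel of the $L^2(\mathbb R^3)$-resolvent $(-\Delta+v-\kappa^2)^{-1}$, continued meromorphically in $\kappa$ across the positive real axis, and let $\Sigma^P_v\subset(0,\infty)$ be the set of all positive poles of $G_v(x,x';\cdot)$ and $G_{\overline v}(x,x';\cdot)$. Fix $k\in(0,\infty)\setminus\Sigma^P_v$ and an integer $\ell\ge0$, and put $\eta=\alpha/(2k)$. Let $H^+_\ell(\eta,kr)$ be the outgoing Coulomb wave function, i.e. the solution $H$ of $-H''+\bigl(\tfrac{\ell(\ell+1)}{r^2}+\tfrac{\alpha}{r}-k^2\bigr)H=0$ on $(0,\infty)$ with $H(r)=\exp\bigl(i(kr-\eta\ln(2kr)-\tfrac{\ell\pi}{2}+\arg\Gamma(\ell+1+i\eta))\bigr)+O(1/r)$ as $r\to\infty$. An outgoing (radiation) Green's function $G_{v,\ell}(r,r')$,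 $r,r'>0$, is a function that, for each $r'>0$, is continuous in $r$, satisfies $$\Bigl(-\tfrac{d^2}{dr^2}+\tfrac{\ell(\ell+1)}{r^2}+\widetilde v(r)-k^2\Bigr)G_{v,\ell}(r,r')=\delta_{r'}(r)$$ in the sense of distributions on $(0,\infty)$, is $O(r^{\ell+1})$ as $r\to+0$, and equals $c\,H^+_\ell(\eta,kr)$ for all large $r$, with a constant $c=c(r')$. Then $G_{v,\ell}$ exists and is unique, and the following holds for every $\Pi>0$. For $R\ge R_a$ consider a random source $f=f^m_\ell$: a generalized random function on $(0,\infty)$, i.e. a linear map from test functions in $C_c^\infty(0,\infty)$ to $L^2$ random variables on some probability space, such that, in the sense of distributions, $$\mathbb E\bigl(\overline{f(r)}\,f(r+\xi)\bigr)=\Pi\,\delta_0(\xi)\bigl(-\operatorname{Im}\widetilde v(r)+k\,\delta_R(r)\bigr).$$ Then for every $r>0$ the radiated field $$\varphi^m_{v,\ell}(r)=\int_0^\infty G_{v,\ell}(r,r')f(r')\,dr'$$ is a well-defined element of $L^2$ (the $L^2$-limit of the pairings of $f$ with any uniformly bounded sequence of test functions converging to $G_{v,\ell}(r,\cdot)$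 locally uniformly on $(0,\infty)$), and for all fixed $r_1,r_2>0$ $$\Pi\,\operatorname{Im}G_{v,\ell}(r_1,r_2)=\mathbb E\bigl(\overline{\varphi^m_{v,\ell}(r_1)}\,\varphi^m_{v,\ell}(r_2)\bigr)+O(\tfrac1R),\qquad R\to+\infty,$$ where the constant in $O(\tfrac1R)$ does not depend on $R$ or on the choice of the probability spaces and of the sources. -/

import Mathlib

open MeasureTheory Filter Topology Asymptotics ComplexConjugate Laplacian
open scoped ENNReal

universe u

noncomputable section

namespace PassiveSources

/-- Physical space `ℝ³` with its Euclidean norm. -/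
abbrev Space := EuclideanSpace ℝ (Fin 3)

/-- The open half-line `(0, ∞)`. -/
def halfLine : TopologicalSpace.Opens ℝ := ⟨Set.Ioi 0, isOpen_Ioi⟩

/-- Complex test functions `C_c^∞((0, ∞))`. -/
abbrev RadialTest := TestFunction halfLine ℂ ⊤

/-- Complex test functions `C_c^∞(ℝ³)`. -/
abbrev SpaceTest := TestFunction (⊤ : TopologicalSpace.Opens Space) ℂ ⊤

/-- The Hilbert space `L²(ℝ³)`. -/
abbrev L2Space := Lp ℂ 2 (volume : Measure Space)

theorem SpaceTest.memLp (f : SpaceTest) : MemLp (fun x => f x) 2 (volume : Measure Space) :=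
  f.contDiff.continuous.memLp_of_hasCompactSupport f.hasCompactSupport

/-- A test function as an element of `L²(ℝ³)`. -/
def SpaceTest.toL2 (f : SpaceTest) : L2Space := (SpaceTest.memLp f).toLp (fun x => f x)

/-- The radial profile `vt` of a potential `v(x) = vt(|x|)`: it is in `L^∞(0, ∞)` and has the
Coulomb tail `α / r` for `r ≥ Ra`. -/
structure IsPotential (vt : ℝ → ℂ) (α Ra : ℝ) : Prop where
  radius_pos : 0 < Ra
  memLp_top : MemLp vt ⊤ (volume.restrict (Set.Ioi (0 : ℝ)))
  tail : ∀ r, Ra ≤ r → vt r = ((α / r : ℝ) : ℂ)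

/-! ### The resolvent in three dimensions and its singular set on the positive axis -/

/-- `(-Δ + v - κ²) w = f` in the sense of distributions on `ℝ³`, where `v(x) = vt(|x|)`.
For bounded `v` and `w, f ∈ L²(ℝ³)` this says that `w` lies in the domain `H²(ℝ³)` of
`L_v = -Δ + v` and `(L_v - κ²) w = f`. -/
def SolvesHelmholtz (vt : ℝ → ℂ) (κ : ℂ) (w f : L2Space) : Prop :=
  ∀ η : SpaceTest,
    ∫ x : Space, w x * (-(Δ (η : Space → ℂ)) x + (vt ‖x‖ - κ ^ 2) * η x)
      = ∫ x : Space, f x * η x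

/-- The bounded operator `T` on `L²(ℝ³)` is the resolvent `(L_v - κ²)⁻¹`. -/
def IsResolvent (vt : ℝ → ℂ) (κ : ℂ) (T : L2Space →L[ℂ] L2Space) : Prop :=
  ∀ w f : L2Space, SolvesHelmholtz vt κ w f ↔ w = T f

/-- The distributional kernel of the operator `T`, tested against `g ⊗ f`: formally
`∬ g(x) T(x, x') f(x') dx dx'`. -/
def kernelPairing (T : L2Space →L[ℂ] L2Space) (g f : SpaceTest) : ℂ :=
  ∫ x : Space, g x * T (SpaceTest.toL2 f) x

/-- The distributional kernel `G_v(x, x'; κ)` of the resolvent `(L_v - κ²)⁻¹`, `Im κ > 0`,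
continues analytically to a neighbourhood of the real point `k`, i.e. its continuation across
the real axis has no pole at `k`. As usual, analyticity of a family of distributional kernels
means analyticity of its pairings with test functions. -/
def KernelRegularAt (vt : ℝ → ℂ) (k : ℝ) : Prop :=
  ∀ g f : SpaceTest, ∃ Φ : ℂ → ℂ, AnalyticAt ℂ Φ (k : ℂ) ∧
    ∀ᶠ κ in 𝓝[{z : ℂ | 0 < z.im}] (k : ℂ),
      ∃ T : L2Space →L[ℂ] L2Space, IsResolvent vt κ T ∧ kernelPairing T g f = Φ κ

/-- The singular set: all positive poles `k` of the kernels `G_v(x, x'; k)` and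
`G_{conj v}(x, x'; k)`. -/
def singularSet (vt : ℝ → ℂ) : Set ℝ :=
  {k | 0 < k ∧ ¬ (KernelRegularAt vt k ∧ KernelRegularAt (fun r => conj (vt r)) k)}

/-! ### The radial equation and its outgoing Green's function -/

/-- The phase `θ_ℓ(η, kr) = kr - η ln(2kr) - ℓπ/2 + σ_ℓ(η)`, where `η = α / (2k)` and
`σ_ℓ(η) = arg Γ(ℓ + 1 + iη)`. -/
def coulombPhase (α k : ℝ) (ℓ : ℕ) (r : ℝ) : ℝ :=
  k * r - α / (2 * k) * Real.log (2 * k * r) - ℓ * Real.pi / 2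
    + (Complex.Gamma (ℓ + 1 + Complex.I * ((α / (2 * k) : ℝ) : ℂ))).arg

/-- `H(r) = H⁺_ℓ(η, kr)`, `η = α / (2k)`, is the outgoing Coulomb wave function: the solution of
`-H'' + (ℓ(ℓ+1)/r² + α/r - k²) H = 0` on `(0, ∞)` with `H = exp(iθ_ℓ) + O(1/r)` at infinity. -/
structure IsOutgoingCoulomb (α k : ℝ) (ℓ : ℕ) (H : ℝ → ℂ) : Prop where
  hasDerivAt : ∀ r, 0 < r → HasDerivAt H (deriv H r) r
  equation : ∀ r, 0 < r →
    HasDerivAt (deriv H) (((ℓ * (ℓ + 1) / r ^ 2 + α / r - k ^ 2 : ℝ) : ℂ) * H r) r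
  asymptotics : (fun r => H r - Complex.exp (Complex.I * (coulombPhase α k ℓ r : ℂ)))
    =O[atTop] (fun r : ℝ => 1 / r)

/-- `G` is the outgoing (radiation) Green's function `G_{v,ℓ}` of
`L_{v,ℓ} - k² = -d²/dr² + ℓ(ℓ+1)/r² + vt - k²` on `(0, ∞)`: for each source point `r' > 0` the
continuous function `G(·, r')` satisfies `(L_{v,ℓ} - k²) G(·, r') = δ_{r'}` in the sense of
distributions, is `O(r^{ℓ+1})` at the origin, and is a multiple of `H⁺_ℓ(η, kr)` for large `r`. -/
structure IsOutgoingGreen (vt : ℝ → ℂ) (α k : ℝ) (ℓ : ℕ) (G : ℝ → ℝ → ℂ) : Prop where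
  continuousOn : ∀ r', 0 < r' → ContinuousOn (fun r => G r r') (Set.Ioi 0)
  equation : ∀ r', 0 < r' → ∀ η : RadialTest,
    ∫ r in Set.Ioi (0 : ℝ), G r r' *
        (-deriv (deriv (η : ℝ → ℂ)) r
          + (((ℓ * (ℓ + 1) / r ^ 2 : ℝ) : ℂ) + vt r - (k : ℂ) ^ 2) * η r)
      = η r'
  origin : ∀ r', 0 < r' →
    (fun r => G r r') =O[𝓝[>] (0 : ℝ)] (fun r : ℝ => r ^ (ℓ + 1))
  infinity : ∀ r', 0 < r' →
    ∃ H : ℝ → ℂ, IsOutgoingCoulomb α k ℓ H ∧ ∃ c : ℂ, ∀ᶠ r in atTop, G r r' = c * H r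

/-! ### Random sources and the radiated field -/

section Random

variable {Ω : Type u} [MeasurableSpace Ω]

/-- `E(conj X · Y)`. -/
def correlation (P : Measure Ω) (X Y : Lp ℂ 2 P) : ℂ := ∫ ω, conj (X ω) * Y ω ∂P

/-- The generalized random function `F` on `(0, ∞)`, given by its pairings
`F g = ∫ f(r) g(r) dr ∈ L²(P)` with test functions, satisfies
`E(conj f(r) f(r + ξ)) = Π δ₀(ξ) (-Im vt(r) + k δ_R(r))` in the sense of distributions. -/
def IsUncorrelatedSource (P : Measure Ω) (vt : ℝ → ℂ) (k Pi R : ℝ)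
    (F : RadialTest →ₗ[ℂ] Lp ℂ 2 P) : Prop :=
  ∀ g h : RadialTest,
    correlation P (F g) (F h) = (Pi : ℂ) *
      ((∫ r in Set.Ioi (0 : ℝ), ((-(vt r).im : ℝ) : ℂ) * (conj (g r) * h r))
        + (k : ℂ) * (conj (g R) * h R))

/-- The random variable `X` is the pairing `∫₀^∞ w(r') f(r') dr'` of the generalized random
function `F` with the function `w` on `(0, ∞)`, which need not be a test function: it is the
limit in `L²(P)` of `F (g n)` for all uniformly bounded sequences of test functions `g n` that
converge to `w` locally uniformly on `(0, ∞)`. -/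
def IsPairing (P : Measure Ω) (F : RadialTest →ₗ[ℂ] Lp ℂ 2 P) (w : ℝ → ℂ) (X : Lp ℂ 2 P) :
    Prop :=
  ∀ g : ℕ → RadialTest,
    (∃ B : ℝ, ∀ n r, ‖g n r‖ ≤ B) →
    TendstoLocallyUniformlyOn (fun n r => g n r) w atTop (Set.Ioi 0) →
    Tendsto (fun n => F (g n)) atTop (𝓝 X)

end Random

end PassiveSources

end

/-!
The radial equation `u'' = q u`, `q(r) = ℓ(ℓ+1)/r² + vt(r) - k²`, has a regular solution `φ`, of
order `r^(ℓ+1)` at the origin, and an outgoing solution `ψ`, equal to a multiple of the Coulomb wave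
`H⁺_ℓ` where the potential is `α/r`. Both are solutions in the sense of Carathéodory
(`IsSolution`), because `vt` is only bounded and measurable. The Green's function is
`G(r, r') = φ(min r r') ψ(max r r') / W` (`greenOf`), where `W = φ' ψ - φ ψ'` is the Wronskian. The
solution `φ` is built by Picard iteration from the origin (`exists_isRegularFamily`), and `ψ` by
continuing inwards the Coulomb wave, whose Laplace representation
`r^(ℓ+1) e^{iκr} ∫₀^∞ e^{-rt} t^(ℓ+iη) (t - 2iκ)^(ℓ-iη) dt` gives the asymptotics at real `κ`, the
exponential decay for `Im κ > 0`, and continuity in `κ` up to the real axis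
(`coulombWave_asymptotics`, `exists_norm_coulombWave_le`, `continuous_coulombWave`).

That `W ≠ 0` is where the hypothesis on the poles enters. For `Im κ > 0`, take a source
`(x₀ + i x₁)^ℓ f(|x|)` supported in the Coulomb region. Variation of parameters gives a radial
function `w_κ` such that the corresponding function on `ℝ³`, being square integrable and a weak
solution of the Helmholtz equation (`integral_solid_mul_laplacian`), is `W(κ)` times the resolvent
applied to the source (`wronskian_mul_kernelPairing`). The pairings of the resolvent kernel stay
bounded as `κ → k`; hence, if `W(k) = 0`, all pairings of `w_k` vanish, and so does `w_k` itself for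
every `f`. Near the origin `w_k = φ ∫ ψ f r^(ℓ+1)`, so `ψ` would have to vanish, which is impossible
(`exists_isRegularSolution_wronskian_ne_zero`).

For uniqueness, the difference of two Green's functions is a weak solution of the homogeneous
equation, hence a solution (`exists_isSolution_of_weak`). Its Wronskians with `φ` and with `ψ`
vanish, by the behaviour at the origin and at infinity respectively, and `W ≠ 0` makes it zero
(`IsOutgoingGreen.eq_greenOf`).

The covariance of the source makes `F` continuous from bounded pointwise convergence of test
functions to `L²` (`tendsto_sourceForm`), so that the radiated field is well defined
(`existsUnique_isPairing`), and its correlations are given by the covariance form evaluated at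
`G(r₁, ·)` and `G(r₂, ·)` (`correlation_eq_of_isPairing`). It remains to compute this form. Lagrange's
identity for `conj G(r₁, ·)` and `G(r₂, ·)` on `(0, R)` expresses `Im G(r₁, r₂)` exactly as the volume
integral with weight `-Im vt` plus a boundary term at `R` (`green_energy_balance`), and Sommerfeld's
radiation condition `ψ' = ikψ + O(1/r)` identifies the boundary term with
`k · conj G(r₁, R) · G(r₂, R)` up to `O(1/R)` (`coulombWave_flux`).
-/


noncomputable section

namespace PassiveSources

/-! ### Primitives on the half-line -/

/-- `F` is a primitive of the locally integrable function `f` on `(0, ∞)`, i.e. `F` is locally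
absolutely continuous there with `F' = f` almost everywhere. -/
structure IsPrimitive (f F : ℝ → ℂ) : Prop where
  integrable : ∀ a b, 0 < a → 0 < b → IntervalIntegrable f volume a b
  sub_eq : ∀ a b, 0 < a → 0 < b → F b - F a = ∫ t in a..b, f t

theorem uIcc_subset_Ioi {a b : ℝ} (ha : 0 < a) (hb : 0 < b) : Set.uIcc a b ⊆ Set.Ioi 0 := by
  intro x hx
  have := hx.1
  exact lt_of_lt_of_le (lt_min ha hb) this

/-- It suffices to know the integral formula from one base point `c`, which may lie outside `(0, ∞)`;
the choice `c = 0` serves for solutions constructed from the origin. -/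
theorem IsPrimitive.of_base {f F : ℝ → ℂ} {c : ℝ}
    (h : ∀ r, 0 < r → IntervalIntegrable f volume c r ∧ F r - F c = ∫ t in c..r, f t) :
    IsPrimitive f F where
  integrable a b ha hb := (h a ha).1.symm.trans (h b hb).1
  sub_eq a b ha hb := by
    rw [← intervalIntegral.integral_interval_sub_left (h b hb).1 (h a ha).1, ← (h a ha).2,
      ← (h b hb).2]
    ring

theorem IsPrimitive.congr {f F f' F' : ℝ → ℂ} (h : IsPrimitive f F)
    (hf : ∀ r, 0 < r → f r = f' r) (hF : ∀ r, 0 < r → F r = F' r) : IsPrimitive f' F' where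
  integrable a b ha hb := (h.integrable a b ha hb).congr fun x hx =>
    hf x (uIcc_subset_Ioi ha hb (Set.uIoc_subset_uIcc hx))
  sub_eq a b ha hb := by
    rw [← hF a ha, ← hF b hb, h.sub_eq a b ha hb]
    exact intervalIntegral.integral_congr fun x hx => hf x (uIcc_subset_Ioi ha hb hx)

theorem IsPrimitive.continuousOn {f F : ℝ → ℂ} (h : IsPrimitive f F) :
    ContinuousOn F (Set.Ioi 0) := by
  intro r (hr : 0 < r)
  have h1 := intervalIntegral.continuousOn_primitive_interval' (a := r)
    (h.integrable (r / 2) (r + 1) (by linarith) (by linarith))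
    (by rw [Set.uIcc_of_le (by linarith)]; constructor <;> linarith)
  rw [Set.uIcc_of_le (by linarith)] at h1
  have h2 : ContinuousAt (fun b => F r + ∫ x in r..b, f x) r :=
    continuousAt_const.add (h1.continuousAt (Icc_mem_nhds (by linarith) (by linarith)))
  refine (h2.congr ?_).continuousWithinAt
  filter_upwards [lt_mem_nhds hr] with b hb
  rw [← h.sub_eq r b hr hb]
  ring

theorem IsPrimitive.hasDerivAt {f F : ℝ → ℂ} (h : IsPrimitive f F)
    (hf : ContinuousOn f (Set.Ioi 0)) {r : ℝ} (hr : 0 < r) : HasDerivAt F (f r) r := by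
  have h1 : HasDerivAt (fun b => ∫ x in r..b, f x) (f r) r :=
    intervalIntegral.integral_hasDerivAt_right (h.integrable r r hr hr)
      (hf.stronglyMeasurableAtFilter isOpen_Ioi r hr) (hf.continuousAt (Ioi_mem_nhds hr))
  refine (h1.const_add (F r)).congr_of_eventuallyEq ?_
  filter_upwards [lt_mem_nhds hr] with b hb
  rw [← h.sub_eq r b hr hb]
  ring

theorem isPrimitive_of_hasDerivAt {f F : ℝ → ℂ} (h : ∀ r, 0 < r → HasDerivAt F (f r) r)
    (hf : ContinuousOn f (Set.Ioi 0)) : IsPrimitive f F where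
  integrable _ _ ha hb := (hf.mono (uIcc_subset_Ioi ha hb)).intervalIntegrable
  sub_eq _ _ ha hb := (intervalIntegral.integral_eq_sub_of_hasDerivAt
    (fun x hx => h x (uIcc_subset_Ioi ha hb hx))
    (hf.mono (uIcc_subset_Ioi ha hb)).intervalIntegrable).symm

theorem IsPrimitive.const_mul {f F : ℝ → ℂ} (h : IsPrimitive f F) (c : ℂ) :
    IsPrimitive (fun r => c * f r) (fun r => c * F r) where
  integrable a b ha hb := (h.integrable a b ha hb).const_mul c
  sub_eq a b ha hb := by
    rw [intervalIntegral.integral_const_mul, ← h.sub_eq a b ha hb]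
    ring

theorem IsPrimitive.add {f F g G : ℝ → ℂ} (h : IsPrimitive f F) (h' : IsPrimitive g G) :
    IsPrimitive (fun r => f r + g r) (fun r => F r + G r) where
  integrable a b ha hb := (h.integrable a b ha hb).add (h'.integrable a b ha hb)
  sub_eq a b ha hb := by
    rw [intervalIntegral.integral_add (h.integrable a b ha hb) (h'.integrable a b ha hb),
      ← h.sub_eq a b ha hb, ← h'.sub_eq a b ha hb]
    ring

theorem IsPrimitive.sub {f F g G : ℝ → ℂ} (h : IsPrimitive f F) (h' : IsPrimitive g G) :
    IsPrimitive (fun r => f r - g r) (fun r => F r - G r) :=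
  (h.add (h'.const_mul (-1))).congr (fun r _ => by ring) (fun r _ => by ring)

theorem IsPrimitive.conj {f F : ℝ → ℂ} (h : IsPrimitive f F) :
    IsPrimitive (fun r => conj (f r)) (fun r => conj (F r)) where
  integrable a b ha hb := by
    have := h.integrable a b ha hb
    exact ⟨Complex.conjCLE.toContinuousLinearMap.integrable_comp this.1,
      Complex.conjCLE.toContinuousLinearMap.integrable_comp this.2⟩
  sub_eq a b ha hb := by
    rw [← map_sub, h.sub_eq a b ha hb]
    exact (Complex.conjCLE.toContinuousLinearMap.intervalIntegral_comp_comm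
      (h.integrable a b ha hb)).symm

/-- Fubini on the triangle `a < s < t < b`. -/
theorem integral_mul_integral_triangle {f g : ℝ → ℂ} {a b : ℝ} (hab : a ≤ b)
    (hf : IntervalIntegrable f volume a b) (hg : IntervalIntegrable g volume a b) :
    ∫ t in a..b, f t * ∫ s in t..b, g s = ∫ s in a..b, (∫ t in a..s, f t) * g s := by
  rw [intervalIntegrable_iff_integrableOn_Ioc_of_le hab] at hf hg
  set I : ℝ → ℝ → ℂ := fun t s => Set.indicator {z : ℝ × ℝ | z.1 < z.2}
    (fun z => f z.1 * g z.2) (t, s) with hI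
  have hm : MeasurableSet {z : ℝ × ℝ | z.1 < z.2} := measurableSet_lt measurable_fst measurable_snd
  have hint : Integrable (Function.uncurry I)
      ((volume.restrict (Set.Ioc a b)).prod (volume.restrict (Set.Ioc a b))) := by
    have := (Integrable.mul_prod hf hg).indicator hm
    exact this
  have key := integral_integral_swap hint
  rw [intervalIntegral.integral_of_le hab, intervalIntegral.integral_of_le hab]
  have e1 : ∀ t ∈ Set.Ioc a b, ∫ s in Set.Ioc a b, I t s = f t * ∫ s in t..b, g s := by
    intro t ht
    rw [intervalIntegral.integral_of_le ht.2, ← integral_const_mul]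
    have : ∀ s, I t s = Set.indicator (Set.Ioi t) (fun s => f t * g s) s := fun s => by
      simp only [hI, Set.indicator, Set.mem_ofPred_eq, Set.mem_Ioi]
    simp_rw [this]
    rw [setIntegral_indicator measurableSet_Ioi]
    congr 2
    ext s
    simp only [Set.mem_inter_iff, Set.mem_Ioc, Set.mem_Ioi]
    constructor
    · rintro ⟨⟨_, h2⟩, h3⟩; exact ⟨h3, h2⟩
    · rintro ⟨h1, h2⟩; exact ⟨⟨ht.1.trans h1, h2⟩, h1⟩
  have e2 : ∀ s ∈ Set.Ioc a b, ∫ t in Set.Ioc a b, I t s = (∫ t in a..s, f t) * g s := by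
    intro s hs
    rw [intervalIntegral.integral_of_le hs.1.le,
      integral_Ioc_eq_integral_Ioo (x := a) (y := s), ← integral_mul_const]
    have : ∀ t, I t s = Set.indicator (Set.Iio s) (fun t => f t * g s) t := fun t => by
      simp only [hI, Set.indicator, Set.mem_ofPred_eq, Set.mem_Iio]
    simp_rw [this]
    rw [setIntegral_indicator measurableSet_Iio]
    congr 2
    ext t
    simp only [Set.mem_inter_iff, Set.mem_Ioc, Set.mem_Iio, Set.mem_Ioo]
    constructor
    · rintro ⟨⟨h1, _⟩, h3⟩; exact ⟨h1, h3⟩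
    · rintro ⟨h1, h2⟩; exact ⟨⟨h1, h2.le.trans hs.2⟩, h2⟩
  rw [setIntegral_congr_fun measurableSet_Ioc e1, setIntegral_congr_fun measurableSet_Ioc e2] at key
  exact key

theorem IsPrimitive.integrable_mul {f F g G : ℝ → ℂ} (h : IsPrimitive f F) (h' : IsPrimitive g G)
    {a b : ℝ} (ha : 0 < a) (hb : 0 < b) :
    IntervalIntegrable (fun r => f r * G r + F r * g r) volume a b :=
  ((h.integrable a b ha hb).mul_continuousOn
      (h'.continuousOn.mono (uIcc_subset_Ioi ha hb))).add
    ((h'.integrable a b ha hb).continuousOn_mul (h.continuousOn.mono (uIcc_subset_Ioi ha hb)))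

/-- The Leibniz rule for locally absolutely continuous functions. -/
theorem IsPrimitive.mul {f F g G : ℝ → ℂ} (h : IsPrimitive f F) (h' : IsPrimitive g G) :
    IsPrimitive (fun r => f r * G r + F r * g r) (fun r => F r * G r) := by
  have main : ∀ a b, 0 < a → 0 < b → a ≤ b →
      F b * G b - F a * G a = ∫ t in a..b, f t * G t + F t * g t := by
    intro a b ha hb hab
    have hf := h.integrable a b ha hb
    have hg := h'.integrable a b ha hb
    have i1 := hf.mul_continuousOn (h'.continuousOn.mono (uIcc_subset_Ioi ha hb))
    have i2 := hg.continuousOn_mul (h.continuousOn.mono (uIcc_subset_Ioi ha hb))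
    rw [intervalIntegral.integral_add i1 i2]
    have i3 : IntervalIntegrable (fun t => f t * (G b - G t)) volume a b :=
      hf.mul_continuousOn
        (continuousOn_const.sub (h'.continuousOn.mono (uIcc_subset_Ioi ha hb)))
    have i4 : IntervalIntegrable (fun t => (F t - F a) * g t) volume a b :=
      hg.continuousOn_mul
        ((h.continuousOn.mono (uIcc_subset_Ioi ha hb)).sub continuousOn_const)
    have e1 : ∫ t in a..b, f t * G t
        = (∫ t in a..b, f t * G b) - ∫ t in a..b, f t * (G b - G t) := by
      rw [← intervalIntegral.integral_sub (hf.mul_const _) i3]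
      congr 1; ext t; ring
    have e2 : ∫ t in a..b, F t * g t
        = (∫ t in a..b, F a * g t) + ∫ t in a..b, (F t - F a) * g t := by
      rw [← intervalIntegral.integral_add (hg.const_mul _) i4]
      congr 1; ext t; ring
    have e3 : ∫ t in a..b, f t * (G b - G t) = ∫ t in a..b, (F t - F a) * g t := by
      rw [intervalIntegral.integral_congr (g := fun t => f t * ∫ s in t..b, g s),
        integral_mul_integral_triangle hab hf hg]
      · refine intervalIntegral.integral_congr fun s hs => ?_
        rw [h.sub_eq a s ha (uIcc_subset_Ioi ha hb hs)]
      · intro t ht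
        simp only
        rw [h'.sub_eq t b (uIcc_subset_Ioi ha hb ht) hb]
    rw [e1, e2, e3, intervalIntegral.integral_mul_const, intervalIntegral.integral_const_mul,
      ← h.sub_eq a b ha hb, ← h'.sub_eq a b ha hb]
    ring
  refine ⟨fun a b ha hb => h.integrable_mul h' ha hb, fun a b ha hb => ?_⟩
  rcases le_total a b with hab | hab
  · exact main a b ha hb hab
  · rw [intervalIntegral.integral_symm, ← main b a hb ha hab]
    ring

/-! ### Solutions of the radial equation -/

/-- `u` with derivative `u'` solves `u'' = q u` on `(0, ∞)` in the sense of Carathéodory. -/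
structure IsSolution (q u u' : ℝ → ℂ) : Prop where
  fst : IsPrimitive u' u
  snd : IsPrimitive (fun r => q r * u r) u'

theorem IsSolution.hasDerivAt {q u u' : ℝ → ℂ} (h : IsSolution q u u') {r : ℝ} (hr : 0 < r) :
    HasDerivAt u (u' r) r := h.fst.hasDerivAt h.snd.continuousOn hr

theorem IsSolution.sub {q u u' v v' : ℝ → ℂ} (h : IsSolution q u u') (h' : IsSolution q v v') :
    IsSolution q (fun r => u r - v r) (fun r => u' r - v' r) :=
  ⟨h.fst.sub h'.fst, (h.snd.sub h'.snd).congr (fun r _ => by ring) (fun r _ => rfl)⟩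

theorem IsSolution.const_mul {q u u' : ℝ → ℂ} (h : IsSolution q u u') (c : ℂ) :
    IsSolution q (fun r => c * u r) (fun r => c * u' r) :=
  ⟨h.fst.const_mul c, (h.snd.const_mul c).congr (fun r _ => by ring) (fun r _ => rfl)⟩

theorem IsSolution.conj {q u u' : ℝ → ℂ} (h : IsSolution q u u') :
    IsSolution (fun r => conj (q r)) (fun r => conj (u r)) (fun r => conj (u' r)) :=
  ⟨h.fst.conj, h.snd.conj.congr (fun r _ => by simp) (fun r _ => rfl)⟩

/-- Lagrange's identity. -/
theorem IsSolution.wronskian {q₁ q₂ u u' v v' : ℝ → ℂ} (h : IsSolution q₁ u u')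
    (h' : IsSolution q₂ v v') :
    IsPrimitive (fun r => (q₁ r - q₂ r) * u r * v r) (fun r => u' r * v r - u r * v' r) :=
  ((h.snd.mul h'.fst).sub (h.fst.mul h'.snd)).congr (fun r _ => by ring) (fun r _ => rfl)

theorem IsSolution.wronskian_const {q u u' v v' : ℝ → ℂ} (h : IsSolution q u u')
    (h' : IsSolution q v v') {r s : ℝ} (hr : 0 < r) (hs : 0 < s) :
    u' r * v r - u r * v' r = u' s * v s - u s * v' s := by
  have := (h.wronskian h').sub_eq s r hs hr
  simp only [sub_self, zero_mul, intervalIntegral.integral_zero] at this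
  exact sub_eq_zero.mp this

/-! ### Picard iteration for second-order equations -/

section Picard

variable {A : Type*} [NormedCommRing A] [NormedAlgebra ℝ A]

/-- The Picard iterates of `u(r) = u₀(r) + ∫₀^r a(t) ∫₀^t b(s) u(s) ds dt`, the integrated form of
`((u - u₀)' / a)' = b u`. The values lie in a Banach algebra `A`; with `A` an algebra of continuous
functions of a parameter, the solution depends continuously on that parameter. -/
def picardIter (a : ℝ → ℝ) (b u₀ : ℝ → A) : ℕ → ℝ → A
  | 0 => u₀
  | n + 1 => fun r => ∫ t in (0 : ℝ)..r, a t • ∫ s in (0 : ℝ)..t, b s * picardIter a b u₀ n s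

/-- The sum of the Picard series. -/
def picardSol (a : ℝ → ℝ) (b u₀ : ℝ → A) (r : ℝ) : A := ∑' n, picardIter a b u₀ n r

/-- The bound `|a(t) b(s)| ≤ M` for `0 < s ≤ t ≤ X` on which the convergence of the Picard series
rests. The weight `a` itself may be singular at the origin. -/
structure PicardBound (a : ℝ → ℝ) (b : ℝ → A) (X M : ℝ) : Prop where
  length_nonneg : 0 ≤ X
  nonneg : 0 ≤ M
  cont : ContinuousOn a (Set.Ioc 0 X)
  integrable : IntervalIntegrable b volume 0 X
  bound : ∀ t ∈ Set.Ioc 0 X, ∀ᵐ s, s ∈ Set.Ioc 0 t → |a t| * ‖b s‖ ≤ M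

variable {a : ℝ → ℝ} {b : ℝ → A} {X M : ℝ}

namespace PicardBound

omit [NormedAlgebra ℝ A] in
theorem integrable_mul (h : PicardBound a b X M) {w : ℝ → A} (hw : ContinuousOn w (Set.Icc 0 X)) :
    IntervalIntegrable (fun s => b s * w s) volume 0 X :=
  h.integrable.mul_continuousOn (by rwa [Set.uIcc_of_le h.length_nonneg])

theorem norm_kernel_le (h : PicardBound a b X M) {w : ℝ → A} {c : ℝ} {n : ℕ} (hc : 0 ≤ c)
    (hb : ∀ s ∈ Set.Icc 0 X, ‖w s‖ ≤ c * s ^ n) {t : ℝ} (ht : t ∈ Set.Ioc 0 X) :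
    ‖a t • ∫ s in (0 : ℝ)..t, b s * w s‖ ≤ M * X * c * t ^ n := by
  rw [← intervalIntegral.integral_smul]
  have h1 : ‖∫ s in (0 : ℝ)..t, a t • (b s * w s)‖ ≤ ∫ _s in (0 : ℝ)..t, M * (c * t ^ n) := by
    refine intervalIntegral.norm_integral_le_of_norm_le ht.1.le ?_ (by simp)
    filter_upwards [h.bound t ht] with s hs hst
    rw [norm_smul, Real.norm_eq_abs]
    have hs0 : 0 ≤ s := hst.1.le
    calc |a t| * ‖b s * w s‖ ≤ |a t| * (‖b s‖ * ‖w s‖) := by gcongr; exact norm_mul_le _ _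
      _ = |a t| * ‖b s‖ * ‖w s‖ := by ring
      _ ≤ M * (c * t ^ n) := by
        refine mul_le_mul (hs hst) ?_ (norm_nonneg _) h.nonneg
        refine (hb s ⟨hs0, hst.2.trans ht.2⟩).trans ?_
        gcongr
        exact hst.2
  refine h1.trans ?_
  simp only [intervalIntegral.integral_const, sub_zero, smul_eq_mul]
  have := ht.2
  have h0 := ht.1.le
  have : t * (M * (c * t ^ n)) ≤ X * (M * (c * t ^ n)) := by
    gcongr
    exact mul_nonneg h.nonneg (by positivity)
  linarith

theorem continuousOn_kernel (h : PicardBound a b X M) {w : ℝ → A}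
    (hw : ContinuousOn w (Set.Icc 0 X)) :
    ContinuousOn (fun t => a t • ∫ s in (0 : ℝ)..t, b s * w s) (Set.Ioc 0 X) := by
  refine h.cont.smul ?_
  have := intervalIntegral.continuousOn_primitive_interval' (h.integrable_mul hw)
    Set.left_mem_uIcc
  rw [Set.uIcc_of_le h.length_nonneg] at this
  exact this.mono Set.Ioc_subset_Icc_self

theorem integrable_kernel (h : PicardBound a b X M) {w : ℝ → A}
    (hw : ContinuousOn w (Set.Icc 0 X)) :
    IntervalIntegrable (fun t => a t • ∫ s in (0 : ℝ)..t, b s * w s) volume 0 X := by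
  obtain ⟨c, hc⟩ := isCompact_Icc.exists_bound_of_continuousOn hw
  rw [intervalIntegrable_iff_integrableOn_Ioc_of_le h.length_nonneg]
  refine IntegrableOn.of_bound (C := M * X * max c 0 * 1) (by simp)
    ((h.continuousOn_kernel hw).aestronglyMeasurable measurableSet_Ioc) ?_
  filter_upwards [self_mem_ae_restrict measurableSet_Ioc] with t ht
  simpa using h.norm_kernel_le (n := 0) (c := max c 0) (le_max_right _ _)
    (fun s hs => by simpa using Or.inl (hc s hs)) ht

theorem continuousOn_integral (h : PicardBound a b X M) {w : ℝ → A}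
    (hw : ContinuousOn w (Set.Icc 0 X)) :
    ContinuousOn (fun r => ∫ t in (0 : ℝ)..r, a t • ∫ s in (0 : ℝ)..t, b s * w s)
      (Set.Icc 0 X) := by
  have := intervalIntegral.continuousOn_primitive_interval' (h.integrable_kernel hw)
    Set.left_mem_uIcc
  rwa [Set.uIcc_of_le h.length_nonneg] at this

theorem picardIter_spec (h : PicardBound a b X M) {u₀ : ℝ → A}
    (hu : ContinuousOn u₀ (Set.Icc 0 X)) {C : ℝ} (hC : ∀ r ∈ Set.Icc 0 X, ‖u₀ r‖ ≤ C) (n : ℕ) :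
    ContinuousOn (picardIter a b u₀ n) (Set.Icc 0 X) ∧
      ∀ r ∈ Set.Icc 0 X, ‖picardIter a b u₀ n r‖ ≤ C * (M * X) ^ n / n.factorial * r ^ n := by
  have hC0 : 0 ≤ C := (norm_nonneg _).trans (hC 0 ⟨le_rfl, h.length_nonneg⟩)
  have hMX : 0 ≤ M * X := mul_nonneg h.nonneg h.length_nonneg
  induction n with
  | zero => exact ⟨hu, fun r hr => by simpa [picardIter] using hC r hr⟩
  | succ n ih =>
    refine ⟨h.continuousOn_integral ih.1, fun r hr => ?_⟩
    have h1 : ‖∫ t in (0 : ℝ)..r, a t • ∫ s in (0 : ℝ)..t, b s * picardIter a b u₀ n s‖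
        ≤ ∫ t in (0 : ℝ)..r, M * X * (C * (M * X) ^ n / n.factorial) * t ^ n := by
      refine intervalIntegral.norm_integral_le_of_norm_le hr.1 ?_ (by
        apply Continuous.intervalIntegrable; fun_prop)
      filter_upwards with t ht
      exact h.norm_kernel_le (by positivity) ih.2 ⟨ht.1, ht.2.trans hr.2⟩
    refine h1.trans (le_of_eq ?_)
    rw [intervalIntegral.integral_const_mul, integral_pow, Nat.factorial_succ]
    push_cast
    rw [zero_pow (Nat.succ_ne_zero n), sub_zero, pow_succ (M * X)]
    field_simp

variable [CompleteSpace A]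

/-- The Picard series is continuous on `[0, X]` and solves the integral equation there. -/
theorem picardSol_spec (h : PicardBound a b X M) {u₀ : ℝ → A}
    (hu : ContinuousOn u₀ (Set.Icc 0 X)) :
    ContinuousOn (picardSol a b u₀) (Set.Icc 0 X) ∧ ∀ r ∈ Set.Icc 0 X, picardSol a b u₀ r
      = u₀ r + ∫ t in (0 : ℝ)..r, a t • ∫ s in (0 : ℝ)..t, b s * picardSol a b u₀ s := by
  obtain ⟨C, hC⟩ := isCompact_Icc.exists_bound_of_continuousOn hu
  have hC0 : 0 ≤ C := (norm_nonneg _).trans (hC 0 ⟨le_rfl, h.length_nonneg⟩)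
  have hM := h.nonneg
  have hX := h.length_nonneg
  have hMX : 0 ≤ M * X := mul_nonneg hM hX
  have hspec := h.picardIter_spec hu hC
  set β : ℕ → ℝ := fun n => C * (M * X) ^ n / n.factorial * X ^ n with hβ
  have hβs : Summable β := by
    have := (Real.summable_pow_div_factorial (M * X * X)).mul_left C
    refine this.congr fun n => ?_
    rw [hβ]; simp only [mul_pow]; ring
  have hle : ∀ n, ∀ r ∈ Set.Icc 0 X, ‖picardIter a b u₀ n r‖ ≤ β n := fun n r hr => by
    refine ((hspec n).2 r hr).trans ?_
    have h1 := hr.1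
    have h2 := hr.2
    simp only [hβ]
    gcongr
  have hsum : ∀ r ∈ Set.Icc 0 X, Summable fun n => picardIter a b u₀ n r := fun r hr =>
    Summable.of_norm_bounded hβs fun n => hle n r hr
  have hcont : ContinuousOn (picardSol a b u₀) (Set.Icc 0 X) :=
    continuousOn_tsum (fun n => (hspec n).1) hβs hle
  refine ⟨hcont, fun r hr => ?_⟩
  have key : HasSum (fun n => picardIter a b u₀ (n + 1) r)
      (∫ t in (0 : ℝ)..r, a t • ∫ s in (0 : ℝ)..t, b s * picardSol a b u₀ s) := by
    refine intervalIntegral.hasSum_integral_of_dominated_convergence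
      (fun n _ => M * X * β n) (fun n => ?_) (fun n => ?_) ?_ ?_ ?_
    · rw [Set.uIoc_of_le hr.1]
      exact ((h.continuousOn_kernel (hspec n).1).mono
        (Set.Ioc_subset_Ioc_right hr.2)).aestronglyMeasurable measurableSet_Ioc
    · rw [Set.uIoc_of_le hr.1]
      filter_upwards with t ht
      simpa using h.norm_kernel_le (n := 0) (c := β n) (by positivity)
        (fun s hs => by simpa using hle n s hs) ⟨ht.1, ht.2.trans hr.2⟩
    · filter_upwards with t ht using hβs.mul_left _
    · simp
    · rw [Set.uIoc_of_le hr.1]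
      filter_upwards with t ht
      refine HasSum.const_smul _ ?_
      have hbi : IntervalIntegrable b volume 0 t := h.integrable.mono_set (by
        rw [Set.uIcc_of_le ht.1.le, Set.uIcc_of_le hX]
        exact Set.Icc_subset_Icc_right (ht.2.trans hr.2))
      refine intervalIntegral.hasSum_integral_of_dominated_convergence
        (fun n s => ‖b s‖ * β n) (fun n => ?_) (fun n => ?_) ?_ ?_ ?_
      · rw [Set.uIoc_of_le ht.1.le]
        have := (h.integrable_mul (hspec n).1).1.mono_set
          (Set.Ioc_subset_Ioc_right (ht.2.trans hr.2))
        exact this.aestronglyMeasurable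
      · rw [Set.uIoc_of_le ht.1.le]
        filter_upwards with s hs
        refine (norm_mul_le _ _).trans ?_
        gcongr
        exact hle n s ⟨hs.1.le, hs.2.trans (ht.2.trans hr.2)⟩
      · filter_upwards with s hs using hβs.mul_left _
      · simp_rw [tsum_mul_left]
        exact hbi.norm.mul_const _
      · rw [Set.uIoc_of_le ht.1.le]
        filter_upwards with s hs
        exact (hsum s ⟨hs.1.le, hs.2.trans (ht.2.trans hr.2)⟩).hasSum.mul_left _
  rw [picardSol, (hsum r hr).tsum_eq_zero_add, key.tsum_eq]
  rfl

end PicardBound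

end Picard

/-! ### Regular solutions and continuation to the whole half-line -/

theorem isPrimitive_pow (n : ℕ) :
    IsPrimitive (fun r => n * (r : ℂ) ^ n / r) (fun r => (r : ℂ) ^ n) := by
  refine isPrimitive_of_hasDerivAt (fun r hr => ?_) ?_
  · have hr' : (r : ℂ) ≠ 0 := by exact_mod_cast hr.ne'
    have := ((hasDerivAt_id (r : ℂ)).pow n).comp_ofReal
    refine this.congr_deriv ?_
    rcases n with _ | n
    · simp
    · simp only [id, Nat.add_sub_cancel, pow_succ]
      field_simp
  · refine ContinuousOn.div (by fun_prop) (by fun_prop) fun r hr => ?_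
    exact_mod_cast (ne_of_gt hr)

theorem isPrimitive_inv_pow (n : ℕ) :
    IsPrimitive (fun r => -n * ((r : ℂ) ^ n)⁻¹ / r) (fun r => ((r : ℂ) ^ n)⁻¹) := by
  have h0 : ∀ r : ℝ, 0 < r → (r : ℂ) ≠ 0 := fun r hr => by exact_mod_cast hr.ne'
  refine isPrimitive_of_hasDerivAt (fun r hr => ?_) ?_
  · have hr' := h0 r hr
    have := (((hasDerivAt_id (r : ℂ)).pow n).inv (pow_ne_zero n hr')).comp_ofReal
    refine this.congr_deriv ?_
    rcases n with _ | n
    · simp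
    · simp only [id, Nat.add_sub_cancel, pow_succ, Pi.pow_apply]
      field_simp
  · refine ContinuousOn.div (continuousOn_const.mul (ContinuousOn.inv₀ (by fun_prop) ?_))
      (by fun_prop) fun r hr => h0 r hr
    exact fun r hr => pow_ne_zero n (h0 r hr)

/-- The coefficient `ℓ(ℓ+1)/r² + vt(r) - z` of the radial equation `u'' = q u` at energy `z`. -/
def radialCoeff (vt : ℝ → ℂ) (ℓ : ℕ) (z : ℂ) (r : ℝ) : ℂ :=
  ((ℓ * (ℓ + 1) / r ^ 2 : ℝ) : ℂ) + vt r - z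

/-- A family of solutions, continuous in the parameter `x ∈ K`, that is regular at the origin:
it behaves there like `r^(ℓ+1)`. -/
structure IsRegularFamily {K : Type*} [TopologicalSpace K] [CompactSpace K] (vt : ℝ → ℂ) (ℓ : ℕ)
    (z : K → ℂ) (φ φ' : ℝ → C(K, ℂ)) : Prop where
  isSolution : ∀ x, IsSolution (radialCoeff vt ℓ (z x)) (fun r => φ r x) (fun r => φ' r x)
  bound : ∀ X, 0 < X → ∃ C, 0 ≤ C ∧ ∀ r ∈ Set.Ioc 0 X, ∀ x,
    ‖φ r x‖ ≤ C * r ^ (ℓ + 1) ∧ ‖φ' r x‖ ≤ C * r ^ ℓ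
  tendsto : ∀ x, Tendsto (fun r : ℝ => φ r x / (r : ℂ) ^ (ℓ + 1)) (𝓝[>] 0) (𝓝 1)

/-- The regular solutions `r^(ℓ+1) p(r)` for the energies `z x`, `x ∈ K`, are obtained all at once by
Picard iteration for `p` in the Banach algebra `C(K, ℂ)`; hence they depend continuously on `x`, and
their bounds are uniform in `x`. -/
theorem exists_isRegularFamily {K : Type*} [TopologicalSpace K] [CompactSpace K] {vt : ℝ → ℂ}
    (hm : AEStronglyMeasurable vt (volume.restrict (Set.Ioi 0))) {B : ℝ}
    (hB : ∀ᵐ r, 0 < r → ‖vt r‖ ≤ B) (ℓ : ℕ) (z : C(K, ℂ)) :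
    ∃ φ φ' : ℝ → C(K, ℂ), IsRegularFamily vt ℓ z φ φ' := by
  set m := 2 * ℓ + 2 with hm_def
  set a : ℝ → ℝ := fun t => (t ^ m)⁻¹ with ha
  set b : ℝ → C(K, ℂ) := fun s => s ^ m • (ContinuousMap.const K (vt s) - z) with hb
  set M := max B 0 + ‖z‖ with hM
  have hM0 : 0 ≤ M := by positivity
  have hbb : ∀ᵐ s, 0 < s → ‖b s‖ ≤ s ^ m * M := by
    filter_upwards [hB] with s hs hs0
    rw [hb]
    simp only [norm_smul, norm_pow, Real.norm_eq_abs, abs_of_pos hs0]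
    gcongr
    refine (norm_sub_le _ _).trans ?_
    rw [hM]
    gcongr
    rw [ContinuousMap.norm_le _ (by positivity)]
    exact fun _ => (hs hs0).trans (le_max_left _ _)
  have hPB : ∀ X, 0 < X → PicardBound a b X M := by
    intro X hX
    refine ⟨hX.le, hM0, ?_, ?_, ?_⟩
    · exact ContinuousOn.inv₀ (by fun_prop) fun t ht => pow_ne_zero _ ht.1.ne'
    · rw [intervalIntegrable_iff_integrableOn_Ioc_of_le hX.le]
      refine IntegrableOn.of_bound (C := X ^ m * M) (by simp) ?_ ?_
      · have h1 : AEStronglyMeasurable vt (volume.restrict (Set.Ioc 0 X)) :=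
          hm.mono_measure (Measure.restrict_mono Set.Ioc_subset_Ioi_self le_rfl)
        have h2 := ContinuousMap.continuous_const'.comp_aestronglyMeasurable
          (g := ContinuousMap.const K) h1
        exact (by fun_prop : Continuous fun s : ℝ => s ^ m).aestronglyMeasurable.smul
          (h2.sub aestronglyMeasurable_const)
      · filter_upwards [ae_restrict_of_ae hbb, self_mem_ae_restrict measurableSet_Ioc] with s hs hsX
        refine (hs hsX.1).trans ?_
        have := hsX.1
        gcongr
        exact hsX.2
    · intro t ht
      filter_upwards [hbb] with s hs hst
      rw [ha]
      have ht0 := ht.1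
      have hs0 := hst.1
      simp only [abs_inv, abs_of_pos (pow_pos ht0 m)]
      rw [inv_mul_le_iff₀ (pow_pos ht0 m)]
      refine (hs hs0).trans ?_
      gcongr
      exact hst.2
  set p := picardSol a b (fun _ => (1 : C(K, ℂ))) with hp
  have hspec := fun X hX => (hPB X hX).picardSol_spec (u₀ := fun _ => (1 : C(K, ℂ)))
    continuousOn_const
  rw [← hp] at hspec
  set p₂ : ℝ → C(K, ℂ) := fun t => ∫ s in (0 : ℝ)..t, b s * p s with hp₂
  have i₂ : ∀ X, 0 < X → IntervalIntegrable (fun s => b s * p s) volume 0 X := fun X hX =>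
    (hPB X hX).integrable_mul (hspec X hX).1
  have i₁ : ∀ X, 0 < X → IntervalIntegrable (fun t => a t • p₂ t) volume 0 X := fun X hX =>
    (hPB X hX).integrable_kernel (hspec X hX).1
  have heq : ∀ X, 0 < X → p X = 1 + ∫ t in (0 : ℝ)..X, a t • p₂ t := fun X hX =>
    (hspec X hX).2 X ⟨hX.le, le_rfl⟩
  -- evaluation at a point of `K` turns the identities in `C(K, ℂ)` into scalar ones
  have ev : ∀ (x : K) (f F : ℝ → C(K, ℂ)) (c : C(K, ℂ)),
      (∀ X, 0 < X → IntervalIntegrable f volume 0 X) →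
      (∀ X, 0 < X → F X = c + ∫ t in (0 : ℝ)..X, f t) →
      IsPrimitive (fun r => f r x) (fun r => F r x) := by
    intro x f F c hf hF
    have hfab : ∀ r s, 0 < r → 0 < s → IntervalIntegrable f volume r s := fun r s hr hs =>
      (hf r hr).symm.trans (hf s hs)
    refine ⟨fun r s hr hs => ?_, fun r s hr hs => ?_⟩
    · have := hfab r s hr hs
      have e : ∀ t, (ContinuousMap.evalCLM ℂ x) (f t) = f t x := fun t => rfl
      have h1 := (ContinuousMap.evalCLM ℂ x).integrable_comp this.1
      have h2 := (ContinuousMap.evalCLM ℂ x).integrable_comp this.2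
      simp only [e] at h1 h2
      exact ⟨h1, h2⟩
    · have h1 := (ContinuousMap.evalCLM ℂ x).intervalIntegral_comp_comm (hfab r s hr hs)
      have h2 : ∫ t in r..s, f t = F s - F r := by
        rw [← intervalIntegral.integral_interval_sub_left (hf s hs) (hf r hr), hF s hs, hF r hr]
        abel
      rw [h2] at h1
      exact h1.symm
  have P₁ := fun x => ev x (fun t => a t • p₂ t) p 1 i₁ heq
  have P₂ := fun x => ev x (fun s => b s * p s) p₂ 0 i₂ (fun X _ => by rw [zero_add])
  have bound₁ : ∀ X, 0 < X → ∃ C, 0 ≤ C ∧ ∀ r ∈ Set.Ioc 0 X,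
      ‖p r‖ ≤ C ∧ ‖a r • p₂ r‖ ≤ M * X * C := by
    intro X hX
    obtain ⟨C, hC⟩ := isCompact_Icc.exists_bound_of_continuousOn (hspec X hX).1
    refine ⟨C, (norm_nonneg _).trans (hC X ⟨hX.le, le_rfl⟩), fun r hr =>
      ⟨hC r ⟨hr.1.le, hr.2⟩, ?_⟩⟩
    simpa using (hPB X hX).norm_kernel_le (n := 0) (c := C)
      ((norm_nonneg _).trans (hC X ⟨hX.le, le_rfl⟩)) (fun s hs => by simpa using hC s hs) hr
  refine ⟨fun r => r ^ (ℓ + 1) • p r,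
    fun r => ((ℓ + 1 : ℝ) * r ^ ℓ) • p r + r ^ (ℓ + 1) • (a r • p₂ r), ?_, ?_, ?_⟩
  · intro x
    have hL := (isPrimitive_pow (ℓ + 1)).mul (P₁ x)
    have hR := (((isPrimitive_pow ℓ).mul (P₁ x)).const_mul ((ℓ : ℂ) + 1)).add
      ((isPrimitive_inv_pow (ℓ + 1)).mul (P₂ x))
    refine ⟨hL.congr (fun r hr => ?_) (fun r hr => ?_), hR.congr (fun r hr => ?_) fun r hr => ?_⟩
    all_goals
      have hr' : (r : ℂ) ≠ 0 := by exact_mod_cast hr.ne'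
      simp only [ha, hb, hm_def, radialCoeff, ContinuousMap.coe_smul, ContinuousMap.coe_add,
        ContinuousMap.coe_sub, ContinuousMap.coe_mul, Pi.smul_apply, Pi.add_apply, Pi.sub_apply,
        Pi.mul_apply, Complex.real_smul, ContinuousMap.const_apply]
      push_cast
      try field_simp
      try ring
  · intro X hX
    obtain ⟨C, hC0, hC⟩ := bound₁ X hX
    refine ⟨C + ((ℓ + 1) * C + X * (M * X * C)), by positivity, fun r hr x => ⟨?_, ?_⟩⟩
    · have h1 := (ContinuousMap.norm_coe_le_norm (p r) x).trans (hC r hr).1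
      simp only [ContinuousMap.coe_smul, Pi.smul_apply, norm_smul, norm_pow, Real.norm_eq_abs,
        abs_of_pos hr.1]
      rw [mul_comm]
      have := hr.1
      gcongr
      refine h1.trans (le_add_of_nonneg_right (by positivity))
    · have h1 := (ContinuousMap.norm_coe_le_norm (p r) x).trans (hC r hr).1
      have h2 := (ContinuousMap.norm_coe_le_norm (a r • p₂ r) x).trans (hC r hr).2
      have h0 := hr.1
      have hX2 := hr.2
      rw [ContinuousMap.coe_add, Pi.add_apply]
      refine (norm_add_le _ _).trans ?_
      rw [ContinuousMap.coe_smul, ContinuousMap.coe_smul, Pi.smul_apply, Pi.smul_apply, norm_smul,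
        norm_smul, norm_mul, norm_pow, norm_pow, Real.norm_eq_abs, Real.norm_eq_abs, abs_of_pos h0,
        abs_of_pos (by positivity : (0 : ℝ) < ℓ + 1)]
      calc (ℓ + 1) * r ^ ℓ * ‖p r x‖ + r ^ (ℓ + 1) * ‖(a r • p₂ r) x‖
          ≤ (ℓ + 1) * r ^ ℓ * C + r ^ ℓ * X * (M * X * C) := by rw [pow_succ]; gcongr
        _ ≤ (C + ((ℓ + 1) * C + X * (M * X * C))) * r ^ ℓ := by
          have : 0 ≤ C * r ^ ℓ := by positivity
          nlinarith
  · intro x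
    have hc : Tendsto (fun r => p r x) (𝓝[>] 0) (𝓝 (p 0 x)) := by
      have h1 := (hspec 1 one_pos).1 0 ⟨le_rfl, zero_le_one⟩
      have h2 : Tendsto p (𝓝[>] 0) (𝓝 (p 0)) :=
        h1.mono_left (nhdsWithin_le_of_mem (mem_of_superset (Ioc_mem_nhdsGT one_pos)
          Set.Ioc_subset_Icc_self))
      exact ((ContinuousMap.evalCLM ℂ x).continuous.tendsto _).comp h2
    have h0 : p 0 = 1 := by
      have := (hspec 1 one_pos).2 0 ⟨le_rfl, zero_le_one⟩
      simpa using this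
    rw [h0] at hc
    refine hc.congr' ?_
    filter_upwards [self_mem_nhdsWithin] with r hr
    have hr' : (r : ℂ) ≠ 0 := by exact_mod_cast (ne_of_gt hr)
    simp only [ContinuousMap.coe_smul, Pi.smul_apply, Complex.real_smul]
    push_cast
    field_simp

/-- A solution of one radial equation continues to a solution of any equation with the same
coefficient beyond `c`. -/
theorem exists_isSolution_extension {q₀ q y y' : ℝ → ℂ} (h : IsSolution q₀ y y') {c : ℝ}
    (hc : 0 < c) (hq : ∀ r, c ≤ r → q r = q₀ r)
    (hm : AEStronglyMeasurable q (volume.restrict (Set.Ioi 0)))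
    (hb : ∀ ε, 0 < ε → ∃ M, ∀ᵐ r, r ∈ Set.Ioo ε c → ‖q r‖ ≤ M) :
    ∃ ψ ψ' : ℝ → ℂ, IsSolution q ψ ψ' ∧ ∀ r, c ≤ r → ψ r = y r ∧ ψ' r = y' r := by
  set b : ℝ → ℂ := fun s => q (c - s) with hb_def
  set p := picardSol (fun _ => 1) b (fun s => y c - y' c * s) with hp
  have hPB : ∀ X, 0 < X → X < c → ∃ M, PicardBound (fun _ => 1) b X M := by
    intro X hX hXc
    obtain ⟨M, hM⟩ := hb (c - X) (by linarith)
    have hM' : ∀ᵐ s : ℝ, c - s ∈ Set.Ioo (c - X) c → ‖q (c - s)‖ ≤ M :=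
      (Measure.measurePreserving_sub_left volume c).quasiMeasurePreserving.ae hM
    have hX' : ∀ᵐ s : ℝ, s ≠ X := by simp [ae_iff]
    have hbs : ∀ᵐ s : ℝ, s ∈ Set.Ioc 0 X → ‖b s‖ ≤ max M 0 := by
      filter_upwards [hM', hX'] with s hs hsX hs0
      exact (hs ⟨by have := lt_of_le_of_ne hs0.2 hsX; linarith, by linarith [hs0.1]⟩).trans
        (le_max_left _ _)
    refine ⟨max M 0, hX.le, le_max_right _ _, continuousOn_const, ?_, ?_⟩
    · rw [intervalIntegrable_iff_integrableOn_Ioc_of_le hX.le]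
      refine IntegrableOn.of_bound (C := max M 0) (by simp) ?_ ?_
      · have h1 := hm.comp_quasiMeasurePreserving
          (((Measure.measurePreserving_sub_left volume c).restrict_preimage
            (s := Set.Ioi 0) measurableSet_Ioi).quasiMeasurePreserving)
        refine h1.mono_measure (Measure.restrict_mono (fun s hs => ?_) le_rfl)
        have := hs.2
        simp only [Set.mem_preimage, Set.mem_Ioi]
        linarith
      · filter_upwards [ae_restrict_of_ae hbs, self_mem_ae_restrict measurableSet_Ioc] with s hs hs'
        exact hs hs'
    · intro t ht
      filter_upwards [hbs] with s hs hst
      simpa using hs ⟨hst.1, hst.2.trans ht.2⟩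
  have hspec : ∀ X, 0 < X → X < c → IntervalIntegrable (fun s => b s * p s) volume 0 X ∧
      IntervalIntegrable (fun t => ∫ s in (0 : ℝ)..t, b s * p s) volume 0 X ∧
      p X = y c - y' c * X + ∫ t in (0 : ℝ)..X, ∫ s in (0 : ℝ)..t, b s * p s := by
    intro X hX hXc
    obtain ⟨M, hM⟩ := hPB X hX hXc
    have hs := hM.picardSol_spec (u₀ := fun s => y c - y' c * s) (by fun_prop)
    refine ⟨hM.integrable_mul hs.1, ?_, ?_⟩
    · simpa using hM.integrable_kernel hs.1
    · simpa using hs.2 X ⟨hX.le, le_rfl⟩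
  set v' : ℝ → ℂ := fun r => y' c - ∫ s in (0 : ℝ)..(c - r), b s * p s with hv'
  classical
  refine ⟨fun r => if r < c then p (c - r) else y r, fun r => if r < c then v' r else y' r,
    ⟨?_, ?_⟩, fun r hr => by simp [not_lt.mpr hr]⟩
  · refine IsPrimitive.of_base (c := c) fun r hr => ?_
    rcases lt_or_ge r c with hrc | hrc
    · obtain ⟨h1, h2, h3⟩ := hspec (c - r) (by linarith) (by linarith)
      have e : ∀ t ∈ Set.uIoo c r, (if t < c then v' t else y' t) = v' t := by
        intro t ht
        rw [Set.uIoo_of_ge hrc.le] at ht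
        simp [ht.2]
      have i1 : IntervalIntegrable v' volume c r := by
        have := h2.comp_sub_left c
        simp only [sub_zero, sub_sub_cancel] at this
        exact intervalIntegrable_const.sub this
      constructor
      · exact i1.congr_uIoo fun t ht => (e t ht).symm
      · rw [intervalIntegral.integral_congr_uIoo e]
        have h4 : IntervalIntegrable (fun t => ∫ s in (0 : ℝ)..(c - t), b s * p s) volume c r := by
          have := h2.comp_sub_left c
          simpa only [sub_zero, sub_sub_cancel] using this
        simp only [hv']
        rw [intervalIntegral.integral_sub intervalIntegrable_const h4,
          intervalIntegral.integral_comp_sub_left (fun t => ∫ s in (0 : ℝ)..t, b s * p s)]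
        simp only [hrc, lt_irrefl, if_true, if_false, sub_self, h3,
          intervalIntegral.integral_const, Complex.real_smul]
        rw [intervalIntegral.integral_symm (c - r) 0]
        push_cast
        ring
    · have e : ∀ t ∈ Set.uIcc c r, (if t < c then v' t else y' t) = y' t := by
        intro t ht
        rw [Set.uIcc_of_le hrc] at ht
        simp [not_lt.mpr ht.1]
      constructor
      · exact (h.fst.integrable c r hc hr).congr fun t ht =>
          (e t (Set.uIoc_subset_uIcc ht)).symm
      · rw [intervalIntegral.integral_congr e, ← h.fst.sub_eq c r hc hr]
        simp [not_lt.mpr hrc]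
  · refine IsPrimitive.of_base (c := c) fun r hr => ?_
    rcases lt_or_ge r c with hrc | hrc
    · obtain ⟨h1, h2, h3⟩ := hspec (c - r) (by linarith) (by linarith)
      have e : ∀ t ∈ Set.uIoo c r, q t * (if t < c then p (c - t) else y t)
          = b (c - t) * p (c - t) := by
        intro t ht
        rw [Set.uIoo_of_ge hrc.le] at ht
        simp [ht.2, hb_def]
      have i1 : IntervalIntegrable (fun t => b (c - t) * p (c - t)) volume c r := by
        simpa only [sub_zero, sub_sub_cancel] using h1.comp_sub_left c
      constructor
      · exact i1.congr_uIoo fun t ht => (e t ht).symm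
      · rw [intervalIntegral.integral_congr_uIoo e,
          intervalIntegral.integral_comp_sub_left (fun s => b s * p s)]
        simp only [hrc, lt_irrefl, if_true, if_false, sub_self, hv']
        rw [intervalIntegral.integral_symm (c - r) 0]
        ring
    · have e : ∀ t ∈ Set.uIcc c r, q t * (if t < c then p (c - t) else y t) = q₀ t * y t := by
        intro t ht
        rw [Set.uIcc_of_le hrc] at ht
        simp [not_lt.mpr ht.1, hq t ht.1]
      constructor
      · exact (h.snd.integrable c r hc hr).congr fun t ht =>
          (e t (Set.uIoc_subset_uIcc ht)).symm
      · rw [intervalIntegral.integral_congr e, ← h.snd.sub_eq c r hc hr]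
        simp [not_lt.mpr hrc]

/-! ### Laplace transforms -/

/-- `ρ` is continuous on `(0, ∞)`, at most of order `t^(-1/2)` at the origin and of subexponential
growth at infinity. -/
structure IsLaplaceDensity (ρ : ℝ → ℂ) : Prop where
  cont : ContinuousOn ρ (Set.Ioi 0)
  bound : ∀ ε, 0 < ε → ∃ D, 0 ≤ D ∧ ∀ t, 0 < t →
    ‖ρ t‖ ≤ D * (t ^ (-(1 / 2) : ℝ) * Real.exp (ε * t))

/-- The Laplace transform `∫₀^∞ e^{-rt} ρ(t) dt`. -/
def laplaceTransform (ρ : ℝ → ℂ) (r : ℝ) : ℂ :=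
  ∫ t in Set.Ioi (0 : ℝ), (Real.exp (-(r * t)) : ℂ) * ρ t

theorem integrable_rpow_mul_exp_neg {b s : ℝ} (hb : 0 < b) (hs : -1 < s) :
    IntegrableOn (fun t : ℝ => t ^ s * Real.exp (-(b * t))) (Set.Ioi 0) := by
  have := integrableOn_rpow_mul_exp_neg_mul_rpow (p := 1) hs one_pos hb
  simpa using this

theorem exists_pow_le_exp (c : ℝ) (hc : 0 ≤ c) (N : ℕ) {ε : ℝ} (hε : 0 < ε) :
    ∃ D, 0 ≤ D ∧ ∀ t, 0 < t → (t + c) ^ N ≤ D * Real.exp (ε * t) := by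
  refine ⟨N.factorial / ε ^ N * Real.exp (ε * c), by positivity, fun t ht => ?_⟩
  have := Real.pow_div_factorial_le_exp (ε * (t + c)) (by positivity) N
  rw [div_le_iff₀ (by positivity), mul_pow, mul_add, Real.exp_add] at this
  rw [div_mul_eq_mul_div, div_mul_eq_mul_div, le_div_iff₀ (by positivity)]
  linarith

namespace IsLaplaceDensity

variable {ρ : ℝ → ℂ}

theorem mul_pow (h : IsLaplaceDensity ρ) (j : ℕ) :
    IsLaplaceDensity (fun t => (t : ℂ) ^ j * ρ t) where
  cont := ContinuousOn.mul (by fun_prop) h.cont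
  bound ε hε := by
    obtain ⟨D, hD0, hD⟩ := h.bound (ε / 2) (by linarith)
    obtain ⟨D', hD0', hD'⟩ := exists_pow_le_exp 0 le_rfl j (ε := ε / 2) (by linarith)
    refine ⟨D' * D, by positivity, fun t ht => ?_⟩
    have h1 := hD t ht
    have h2 := hD' t ht
    rw [add_zero] at h2
    rw [norm_mul, norm_pow, Complex.norm_real, Real.norm_eq_abs, abs_of_pos ht]
    have e : ε * t = ε / 2 * t + ε / 2 * t := by ring
    rw [e, Real.exp_add]
    calc t ^ j * ‖ρ t‖ ≤ (D' * Real.exp (ε / 2 * t)) *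
          (D * (t ^ (-(1 / 2) : ℝ) * Real.exp (ε / 2 * t))) := by gcongr
      _ = _ := by ring

theorem norm_kernel_le {D ε : ℝ} (hD : ∀ t, 0 < t →
    ‖ρ t‖ ≤ D * (t ^ (-(1 / 2) : ℝ) * Real.exp (ε * t))) {r t : ℝ} (ht : 0 < t)
    (hr : 2 * ε ≤ r) : ‖(Real.exp (-(r * t)) : ℂ) * ρ t‖
      ≤ D * (t ^ (-(1 / 2) : ℝ) * Real.exp (-(ε * t))) := by
  rw [norm_mul, Complex.norm_real, Real.norm_eq_abs, abs_of_pos (Real.exp_pos _)]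
  have h0 : 0 ≤ D * (t ^ (-(1 / 2) : ℝ) * Real.exp (ε * t)) := (norm_nonneg _).trans (hD t ht)
  have e : Real.exp (-(ε * t)) = Real.exp (-(2 * ε * t)) * Real.exp (ε * t) := by
    rw [← Real.exp_add]; ring_nf
  calc Real.exp (-(r * t)) * ‖ρ t‖
      ≤ Real.exp (-(2 * ε * t)) * (D * (t ^ (-(1 / 2) : ℝ) * Real.exp (ε * t))) := by
        refine mul_le_mul ?_ (hD t ht) (norm_nonneg _) (Real.exp_pos _).le
        gcongr
    _ = _ := by rw [e]; ring

theorem integrableOn (h : IsLaplaceDensity ρ) {r : ℝ} (hr : 0 < r) :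
    IntegrableOn (fun t : ℝ => (Real.exp (-(r * t)) : ℂ) * ρ t) (Set.Ioi 0) := by
  obtain ⟨D, hD0, hD⟩ := h.bound (r / 2) (by linarith)
  refine Integrable.mono' ((integrable_rpow_mul_exp_neg (b := r / 2) (s := -(1 / 2))
    (by linarith) (by norm_num)).const_mul D) ?_ ?_
  · exact (ContinuousOn.mul (by fun_prop) h.cont).aestronglyMeasurable measurableSet_Ioi
  · filter_upwards [self_mem_ae_restrict measurableSet_Ioi] with t ht
    exact norm_kernel_le hD ht (by linarith)

theorem hasDerivAt (h : IsLaplaceDensity ρ) {r : ℝ} (hr : 0 < r) :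
    HasDerivAt (laplaceTransform ρ) (-laplaceTransform (fun t => t * ρ t) r) r := by
  have h1 : IsLaplaceDensity (fun t => (t : ℂ) * ρ t) := by simpa using h.mul_pow 1
  obtain ⟨D, hD0, hD⟩ := h1.bound (r / 4) (by linarith)
  have key := (hasDerivAt_integral_of_dominated_loc_of_deriv_le
    (μ := volume.restrict (Set.Ioi (0 : ℝ))) (x₀ := r) (s := Set.Ioi (r / 2))
    (F := fun r t => (Real.exp (-(r * t)) : ℂ) * ρ t)
    (F' := fun r t => -((Real.exp (-(r * t)) : ℂ) * (t * ρ t)))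
    (bound := fun t => D * (t ^ (-(1 / 2) : ℝ) * Real.exp (-(r / 4 * t))))
    (Ioi_mem_nhds (by linarith)) ?_ (h.integrableOn hr) ?_ ?_ ?_ ?_).2
  · refine key.congr_deriv ?_
    rw [integral_neg]
    rfl
  · filter_upwards with x
    exact (ContinuousOn.mul (by fun_prop) h.cont).aestronglyMeasurable measurableSet_Ioi
  · exact (h1.integrableOn hr).aestronglyMeasurable.neg
  · filter_upwards [self_mem_ae_restrict measurableSet_Ioi] with t ht x hx
    rw [norm_neg]
    exact norm_kernel_le hD ht (by linarith [Set.mem_Ioi.mp hx])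
  · exact (integrable_rpow_mul_exp_neg (by linarith) (by norm_num)).const_mul D
  · filter_upwards with t x _
    have h2 : HasDerivAt (fun x : ℝ => Real.exp (-(x * t))) (Real.exp (-(x * t)) * -(1 * t)) x :=
      (((hasDerivAt_id x).mul_const t).neg).exp
    have h3 := (h2.ofReal_comp).mul_const (ρ t)
    refine h3.congr_deriv ?_
    push_cast
    ring

theorem norm_laplaceTransform_le {D ε : ℝ} (hε : 0 < ε) (hD : ∀ t, 0 < t →
    ‖ρ t‖ ≤ D * (t ^ (-(1 / 2) : ℝ) * Real.exp (ε * t))) {r : ℝ} (hr : 2 * ε ≤ r) :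
    ‖laplaceTransform ρ r‖
      ≤ D * ∫ t in Set.Ioi (0 : ℝ), t ^ (-(1 / 2) : ℝ) * Real.exp (-(ε * t)) := by
  rw [← integral_const_mul]
  refine norm_integral_le_of_norm_le
    ((integrable_rpow_mul_exp_neg hε (by norm_num)).const_mul D) ?_
  filter_upwards [self_mem_ae_restrict measurableSet_Ioi] with t ht
  exact norm_kernel_le hD ht hr

end IsLaplaceDensity

/-! ### The outgoing Coulomb wave function -/

/-- The density `t^(ℓ+iη) (t - 2iκ)^(ℓ-iη)`, `η = α / (2κ)`, in the Laplace representation of the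
outgoing Coulomb wave. -/
def coulombDensity (α : ℝ) (κ : ℂ) (ℓ : ℕ) (t : ℝ) : ℂ :=
  (t : ℂ) ^ (ℓ + Complex.I * (α / (2 * κ))) *
    ((t : ℂ) - 2 * Complex.I * κ) ^ (ℓ - Complex.I * (α / (2 * κ)))

/-- A closed vertical segment of momenta above `k` on which `|Im η| ≤ 1/2`, so that the Coulomb
densities are uniformly integrable at the origin. -/
structure IsAdmissible (α k : ℝ) (κ : ℂ) : Prop where
  re_eq : κ.re = k
  im_nonneg : 0 ≤ κ.im
  im_le : κ.im ≤ 1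
  eta_im : |((α : ℂ) / (2 * κ)).im| ≤ 1 / 2

theorem rpow_le_add_inv_pow {x y : ℝ} (hx : 0 < x) {n : ℕ} (hy : |y| ≤ n) :
    x ^ y ≤ (x + x⁻¹) ^ n := by
  have hx' := inv_pos.mpr hx
  obtain ⟨h1, h2⟩ := abs_le.mp hy
  rcases le_total 1 x with h | h
  · calc x ^ y ≤ x ^ (n : ℝ) := Real.rpow_le_rpow_of_exponent_le h h2
      _ = x ^ n := Real.rpow_natCast x n
      _ ≤ _ := by gcongr; linarith
  · calc x ^ y ≤ x ^ (-(n : ℝ)) := Real.rpow_le_rpow_of_exponent_ge hx h h1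
      _ = (x⁻¹) ^ n := by rw [Real.rpow_neg hx.le, Real.rpow_natCast, inv_pow]
      _ ≤ _ := by gcongr; linarith

section

variable {α k : ℝ} {κ : ℂ}

theorem sub_two_I_mul_mem_slitPlane (hκ : 0 < κ.re) (t : ℝ) :
    (t : ℂ) - 2 * Complex.I * κ ∈ Complex.slitPlane := by
  refine Complex.mem_slitPlane_iff.mpr (Or.inr ?_)
  simp [hκ.ne']

theorem norm_cpow_le_exp (z w : ℂ) (hz : z ≠ 0) :
    ‖z ^ w‖ ≤ ‖z‖ ^ w.re * Real.exp (Real.pi * |w.im|) := by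
  rw [Complex.norm_cpow_of_ne_zero hz, div_eq_mul_inv, ← Real.exp_neg]
  gcongr
  refine (neg_le_abs _).trans ?_
  rw [abs_mul]
  gcongr
  exact Complex.abs_arg_le_pi z

theorem norm_coulombDensity_le (hk : 0 < k) (hκ : IsAdmissible α k κ) (ℓ : ℕ) {t : ℝ}
    (ht : 0 < t) : ‖coulombDensity α κ ℓ t‖ ≤ Real.exp (Real.pi * (|α| / (2 * k))) *
      (t ^ (-(1 / 2) : ℝ) * (t + (2 * k + 3 + (2 * k)⁻¹)) ^ (2 * ℓ + 2)) := by
  have hre := hκ.re_eq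
  set η : ℂ := α / (2 * κ) with hη
  set c := 2 * k + 3 + (2 * k)⁻¹ with hc
  have hki : 0 < (2 * k)⁻¹ := by positivity
  have him := abs_le.mp hκ.eta_im
  rw [← hη] at him
  have hκn : k ≤ ‖κ‖ := by rw [← hre]; exact (le_abs_self _).trans (Complex.abs_re_le_norm κ)
  have hκu : ‖κ‖ ≤ k + 1 := by
    refine (Complex.norm_le_abs_re_add_abs_im κ).trans ?_
    rw [hre, abs_of_pos hk, abs_of_nonneg hκ.im_nonneg]
    linarith [hκ.im_le]
  have hηre : |η.re| ≤ |α| / (2 * k) := by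
    refine (Complex.abs_re_le_norm η).trans ?_
    rw [hη, norm_div, norm_mul, Complex.norm_real, Complex.norm_two, Real.norm_eq_abs]
    gcongr
  have hz0 := Complex.slitPlane_ne_zero (sub_two_I_mul_mem_slitPlane (hre ▸ hk : 0 < κ.re) t)
  set z : ℂ := (t : ℂ) - 2 * Complex.I * κ with hz
  have hzl : 2 * k ≤ ‖z‖ := by
    have : z.im = -(2 * k) := by rw [hz, ← hre]; simp
    calc 2 * k = |z.im| := by rw [this, abs_neg, abs_of_pos (by linarith)]
      _ ≤ ‖z‖ := Complex.abs_im_le_norm z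
  have hzu : ‖z‖ ≤ t + 2 * (k + 1) := by
    refine (norm_sub_le _ _).trans ?_
    simp only [Complex.norm_real, norm_mul, Complex.norm_two, Complex.norm_I, Real.norm_eq_abs,
      abs_of_pos ht]
    linarith
  have hzpos : 0 < ‖z‖ := by linarith
  rw [coulombDensity, norm_mul, Complex.norm_cpow_eq_rpow_re_of_pos ht]
  have e1 : ((ℓ : ℂ) + Complex.I * η).re = ℓ - η.im := by simp [sub_eq_add_neg]
  have e2 : ((ℓ : ℂ) - Complex.I * η).re = ℓ + η.im := by simp
  have e3 : ((ℓ : ℂ) - Complex.I * η).im = -η.re := by simp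
  have h1 : t ^ ((ℓ : ℂ) + Complex.I * η).re ≤ t ^ (-(1 / 2) : ℝ) * (t + c) ^ (ℓ + 1) := by
    have : ((ℓ : ℂ) + Complex.I * η).re = -(1 / 2) + (ℓ - η.im + 1 / 2) := by rw [e1]; ring
    rw [this, Real.rpow_add ht]
    gcongr
    calc t ^ ((ℓ : ℝ) - η.im + 1 / 2) ≤ (t + c) ^ ((ℓ : ℝ) - η.im + 1 / 2) := by
          refine Real.rpow_le_rpow ht.le (by linarith) ?_
          have : (0 : ℝ) ≤ ℓ := by positivity
          linarith
      _ ≤ (t + c) ^ ((ℓ + 1 : ℕ) : ℝ) := by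
          refine Real.rpow_le_rpow_of_exponent_le (by linarith) ?_
          push_cast
          linarith
      _ = (t + c) ^ (ℓ + 1) := Real.rpow_natCast _ _
  have h2 : ‖z ^ ((ℓ : ℂ) - Complex.I * η)‖
      ≤ (t + c) ^ (ℓ + 1) * Real.exp (Real.pi * (|α| / (2 * k))) := by
    refine (norm_cpow_le_exp _ _ hz0).trans ?_
    rw [e2, e3, abs_neg]
    gcongr
    refine (rpow_le_add_inv_pow hzpos (n := ℓ + 1) ?_).trans ?_
    · push_cast
      have : (0 : ℝ) ≤ ℓ := by positivity
      rw [abs_le]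
      constructor <;> linarith
    · have : ‖z‖⁻¹ ≤ (2 * k)⁻¹ := by gcongr
      refine pow_le_pow_left₀ (by positivity) ?_ _
      linarith
  calc _ ≤ (t ^ (-(1 / 2) : ℝ) * (t + c) ^ (ℓ + 1)) *
        ((t + c) ^ (ℓ + 1) * Real.exp (Real.pi * (|α| / (2 * k)))) := by
        gcongr
    _ = _ := by ring

/-- The bound on the Coulomb densities is uniform over admissible momenta. -/
theorem exists_norm_coulombDensity_le (hk : 0 < k) (α : ℝ) (ℓ : ℕ) {ε : ℝ} (hε : 0 < ε) :
    ∃ D, 0 ≤ D ∧ ∀ κ, IsAdmissible α k κ → ∀ t, 0 < t →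
      ‖coulombDensity α κ ℓ t‖ ≤ D * (t ^ (-(1 / 2) : ℝ) * Real.exp (ε * t)) := by
  obtain ⟨D, hD0, hD⟩ := exists_pow_le_exp (2 * k + 3 + (2 * k)⁻¹) (by positivity) (2 * ℓ + 2) hε
  refine ⟨Real.exp (Real.pi * (|α| / (2 * k))) * D, by positivity, fun κ hκ t ht => ?_⟩
  refine (norm_coulombDensity_le hk hκ ℓ ht).trans ?_
  rw [mul_assoc]
  gcongr ?_ * ?_
  rw [mul_left_comm]
  gcongr
  exact hD t ht

theorem hasDerivAt_coulombDensity (hκ : 0 < κ.re) (ℓ : ℕ) {t : ℝ} (ht : 0 < t) :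
    HasDerivAt (coulombDensity α κ ℓ) ((2 * ℓ * t - 2 * Complex.I * κ * ℓ + α) /
      (t * (t - 2 * Complex.I * κ)) * coulombDensity α κ ℓ t) t := by
  have hz := sub_two_I_mul_mem_slitPlane hκ t
  have hz0 := Complex.slitPlane_ne_zero hz
  have ht0 : (t : ℂ) ≠ 0 := by exact_mod_cast ht.ne'
  have hκ0 : κ ≠ 0 := fun h => by simp [h] at hκ
  have d1 : HasDerivAt (fun s : ℂ => s ^ (ℓ + Complex.I * (α / (2 * κ))))
      ((ℓ + Complex.I * (α / (2 * κ))) * (t : ℂ) ^ (ℓ + Complex.I * (α / (2 * κ)) - 1) * 1) t :=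
    (hasDerivAt_id (t : ℂ)).cpow_const (by simp [ht])
  have d2 : HasDerivAt (fun s : ℂ => (s - 2 * Complex.I * κ) ^ (ℓ - Complex.I * (α / (2 * κ))))
      ((ℓ - Complex.I * (α / (2 * κ))) *
        ((t : ℂ) - 2 * Complex.I * κ) ^ (ℓ - Complex.I * (α / (2 * κ)) - 1) * 1) t :=
    ((hasDerivAt_id (t : ℂ)).sub_const _).cpow_const hz
  refine (d1.mul d2).comp_ofReal.congr_deriv ?_
  rw [Complex.cpow_sub _ 1 ht0, Complex.cpow_sub _ 1 hz0, Complex.cpow_one, Complex.cpow_one,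
    coulombDensity]
  set X := (t : ℂ) ^ (ℓ + Complex.I * (α / (2 * κ)))
  set Y := ((t : ℂ) - 2 * Complex.I * κ) ^ (ℓ - Complex.I * (α / (2 * κ)))
  clear_value X Y
  clear hz d1 d2
  generalize hz : (t : ℂ) - 2 * Complex.I * κ = z at hz0 ⊢
  field_simp
  rw [← hz]
  linear_combination (-2 * α * κ) * X * Y * Complex.I_sq

theorem isLaplaceDensity_coulombDensity (hk : 0 < k) (hκ : IsAdmissible α k κ) (ℓ : ℕ) :
    IsLaplaceDensity (coulombDensity α κ ℓ) where
  cont t ht := (hasDerivAt_coulombDensity (hκ.re_eq ▸ hk : 0 < κ.re) ℓ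
    ht).continuousAt.continuousWithinAt
  bound ε hε := by
    obtain ⟨D, hD0, hD⟩ := exists_norm_coulombDensity_le hk α ℓ hε
    exact ⟨D, hD0, hD κ hκ⟩

/-- The moments `∫₀^∞ t^j e^{-rt} ρ(t) dt` of the Coulomb density `ρ`. -/
def coulombMoment (α : ℝ) (κ : ℂ) (ℓ j : ℕ) (r : ℝ) : ℂ :=
  laplaceTransform (fun t => (t : ℂ) ^ j * coulombDensity α κ ℓ t) r

theorem hasDerivAt_coulombMoment (hk : 0 < k) (hκ : IsAdmissible α k κ) (ℓ j : ℕ) {r : ℝ}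
    (hr : 0 < r) :
    HasDerivAt (coulombMoment α κ ℓ j) (-coulombMoment α κ ℓ (j + 1) r) r := by
  refine (((isLaplaceDensity_coulombDensity hk hκ ℓ).mul_pow j).hasDerivAt hr).congr_deriv ?_
  simp only [coulombMoment, pow_succ']
  simp only [mul_assoc]

/-- The recursion for the moments that encodes the Coulomb equation; it is an integration by
parts. -/
theorem coulombMoment_recursion (hk : 0 < k) (hκ : IsAdmissible α k κ) (ℓ : ℕ) {r : ℝ}
    (hr : 0 < r) :
    r * coulombMoment α κ ℓ 2 r - (2 * ℓ + 2 + 2 * Complex.I * κ * r) * coulombMoment α κ ℓ 1 r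
      + (2 * Complex.I * κ * (ℓ + 1) - α) * coulombMoment α κ ℓ 0 r = 0 := by
  have hρ := isLaplaceDensity_coulombDensity hk hκ ℓ
  have hκ' : 0 < κ.re := hκ.re_eq ▸ hk
  set ρ := coulombDensity α κ ℓ with hρ_def
  have i := fun j => (hρ.mul_pow j).integrableOn hr
  set w : ℝ → ℂ := fun t => (Real.exp (-(r * t)) : ℂ) * ρ t with hw
  set g : ℝ → ℂ := fun t => (t : ℂ) * (t - 2 * Complex.I * κ) * w t with hg
  set g' : ℝ → ℂ := fun t => -r * ((Real.exp (-(r * t)) : ℂ) * ((t : ℂ) ^ 2 * ρ t))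
    + (2 * ℓ + 2 + 2 * Complex.I * κ * r) * ((Real.exp (-(r * t)) : ℂ) * ((t : ℂ) ^ 1 * ρ t))
    - (2 * Complex.I * κ * (ℓ + 1) - α) * ((Real.exp (-(r * t)) : ℂ) * ((t : ℂ) ^ 0 * ρ t))
    with hg'
  have hi : IntegrableOn g' (Set.Ioi 0) :=
    (((i 2).const_mul _).add ((i 1).const_mul _)).sub ((i 0).const_mul _)
  have hd : ∀ t ∈ Set.Ioi (0 : ℝ), HasDerivAt g (g' t) t := by
    intro t ht
    have ht0 : (t : ℂ) ≠ 0 := by exact_mod_cast (ne_of_gt ht)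
    have hz0 := Complex.slitPlane_ne_zero (sub_two_I_mul_mem_slitPlane hκ' t)
    have d1 : HasDerivAt (fun t : ℝ => (Real.exp (-(r * t)) : ℂ))
        ((Real.exp (-(r * t)) * -(r * 1) : ℝ) : ℂ) t :=
      (((hasDerivAt_id t).const_mul r).neg.exp).ofReal_comp
    have d2 : HasDerivAt (fun t : ℝ => (t : ℂ)) 1 t := by
      simpa using (hasDerivAt_id t).ofReal_comp
    have d3 := (d2.mul (d2.sub_const (2 * Complex.I * κ))).mul
      (d1.mul (hasDerivAt_coulombDensity (α := α) hκ' ℓ ht))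
    refine d3.congr_deriv ?_
    simp only [hg', Pi.mul_apply]
    rw [← hρ_def]
    push_cast
    field_simp
    ring
  -- both boundary terms vanish because of the factor `t` and of the exponential
  obtain ⟨D, hD0, hD⟩ := hρ.bound (r / 2) (by linarith)
  have hgb : ∀ t, 0 < t → ‖g t‖ ≤ D * (‖(t : ℂ) - 2 * Complex.I * κ‖ *
      (t ^ (1 / 2 : ℝ) * Real.exp (-(r / 2 * t)))) := by
    intro t ht
    have h1 := IsLaplaceDensity.norm_kernel_le hD ht (r := r) (by linarith)
    rw [hg]
    simp only
    rw [norm_mul, norm_mul, Complex.norm_real, Real.norm_eq_abs, abs_of_pos ht]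
    have e : t ^ (1 / 2 : ℝ) = t * t ^ (-(1 / 2) : ℝ) := by
      rw [← Real.rpow_one_add' ht.le (by norm_num)]
      norm_num
    rw [e]
    calc t * ‖(t : ℂ) - 2 * Complex.I * κ‖ * ‖w t‖
        ≤ t * ‖(t : ℂ) - 2 * Complex.I * κ‖ *
          (D * (t ^ (-(1 / 2) : ℝ) * Real.exp (-(r / 2 * t)))) := by gcongr
      _ = _ := by ring
  have hg0 : g 0 = 0 := by simp [hg]
  have hc : ContinuousWithinAt g (Set.Ici 0) 0 := by
    rw [← continuousWithinAt_Ioi_iff_Ici, ContinuousWithinAt, hg0]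
    refine squeeze_zero_norm' (a := fun t : ℝ => D * (‖(t : ℂ) - 2 * Complex.I * κ‖ *
      (t ^ (1 / 2 : ℝ) * Real.exp (-(r / 2 * t))))) ?_ ?_
    · filter_upwards [self_mem_nhdsWithin] with t ht using hgb t ht
    · have : Continuous (fun t : ℝ => D * (‖(t : ℂ) - 2 * Complex.I * κ‖ *
          (t ^ (1 / 2 : ℝ) * Real.exp (-(r / 2 * t))))) := by
        have := Real.continuous_rpow_const (q := 1 / 2) (by norm_num)
        fun_prop
      have h2 := this.tendsto 0
      rw [Real.zero_rpow (by norm_num)] at h2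
      simp only [zero_mul, mul_zero] at h2
      exact h2.mono_left nhdsWithin_le_nhds
  have ht : Tendsto g atTop (𝓝 0) := by
    refine squeeze_zero_norm' (a := fun t : ℝ => D * ((1 + ‖2 * Complex.I * κ‖) *
      (t ^ (3 / 2 : ℝ) * Real.exp (-(r / 2) * t)))) ?_ ?_
    · filter_upwards [eventually_ge_atTop 1] with t ht
      refine (hgb t (by linarith)).trans ?_
      have e : t ^ (3 / 2 : ℝ) = t * t ^ (1 / 2 : ℝ) := by
        rw [← Real.rpow_one_add' (by linarith) (by norm_num)]
        norm_num
      have h1 : ‖(t : ℂ) - 2 * Complex.I * κ‖ ≤ (1 + ‖2 * Complex.I * κ‖) * t := by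
        refine (norm_sub_le _ _).trans ?_
        rw [Complex.norm_real, Real.norm_eq_abs, abs_of_pos (by linarith)]
        nlinarith [norm_nonneg (2 * Complex.I * κ)]
      rw [e, neg_mul]
      calc D * (‖(t : ℂ) - 2 * Complex.I * κ‖ * (t ^ (1 / 2 : ℝ) * Real.exp (-(r / 2 * t))))
          ≤ D * ((1 + ‖2 * Complex.I * κ‖) * t *
            (t ^ (1 / 2 : ℝ) * Real.exp (-(r / 2 * t)))) := by gcongr
        _ = _ := by ring
    · have := tendsto_rpow_mul_exp_neg_mul_atTop_nhds_zero (3 / 2) (r / 2) (by linarith)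
      simpa using (this.const_mul (1 + ‖2 * Complex.I * κ‖)).const_mul D
  have key := integral_Ioi_of_hasDerivAt_of_tendsto hc hd hi ht
  have j2 := (i 2).const_mul (-r : ℂ)
  have j1 := (i 1).const_mul (2 * ℓ + 2 + 2 * Complex.I * κ * r)
  have j0 := (i 0).const_mul (2 * Complex.I * κ * (ℓ + 1) - α)
  have e1 := integral_sub (j2.add j1) j0
  have e2 := integral_add j2 j1
  simp only [Pi.add_apply] at e1
  rw [e2, integral_const_mul, integral_const_mul, integral_const_mul] at e1
  rw [hg0, sub_zero, hg', e1] at key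
  simp only [coulombMoment, laplaceTransform]
  linear_combination -key

/-- The outgoing Coulomb wave `r^(ℓ+1) e^{iκr} ∫₀^∞ e^{-rt} ρ(t) dt`, up to normalization. -/
def coulombWave (α : ℝ) (κ : ℂ) (ℓ : ℕ) (r : ℝ) : ℂ :=
  (r : ℂ) ^ (ℓ + 1) * Complex.exp (Complex.I * κ * r) * coulombMoment α κ ℓ 0 r

/-- The derivative of the outgoing Coulomb wave. -/
def coulombWaveDeriv (α : ℝ) (κ : ℂ) (ℓ : ℕ) (r : ℝ) : ℂ :=
  (r : ℂ) ^ (ℓ + 1) * Complex.exp (Complex.I * κ * r) *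
    (((ℓ + 1) / r + Complex.I * κ) * coulombMoment α κ ℓ 0 r - coulombMoment α κ ℓ 1 r)

theorem isSolution_coulombWave (hk : 0 < k) (hκ : IsAdmissible α k κ) (ℓ : ℕ) :
    IsSolution (radialCoeff (fun r => ((α / r : ℝ) : ℂ)) ℓ (κ ^ 2)) (coulombWave α κ ℓ)
      (coulombWaveDeriv α κ ℓ) := by
  have hE : ∀ r : ℝ, 0 < r → HasDerivAt
      (fun r : ℝ => (r : ℂ) ^ (ℓ + 1) * Complex.exp (Complex.I * κ * r))
      (((ℓ + 1) / r + Complex.I * κ) * ((r : ℂ) ^ (ℓ + 1) * Complex.exp (Complex.I * κ * r)))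
      r := by
    intro r hr
    have hr0 : (r : ℂ) ≠ 0 := by exact_mod_cast hr.ne'
    have d1 := ((hasDerivAt_id (r : ℂ)).pow (ℓ + 1)).mul
      (((hasDerivAt_id (r : ℂ)).const_mul (Complex.I * κ)).cexp)
    refine d1.comp_ofReal.congr_deriv ?_
    simp only [id, Pi.pow_apply, Nat.add_sub_cancel, pow_succ]
    push_cast
    field_simp
  have hm := fun j r (hr : 0 < r) => hasDerivAt_coulombMoment hk hκ ℓ j hr
  have hy : ∀ r, 0 < r → HasDerivAt (coulombWave α κ ℓ) (coulombWaveDeriv α κ ℓ r) r := by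
    intro r hr
    refine ((hE r hr).mul (hm 0 r hr)).congr_deriv ?_
    rw [coulombWaveDeriv]
    ring
  have hy' : ∀ r, 0 < r → HasDerivAt (coulombWaveDeriv α κ ℓ)
      (radialCoeff (fun r => ((α / r : ℝ) : ℂ)) ℓ (κ ^ 2) r * coulombWave α κ ℓ r) r := by
    intro r hr
    have hr0 : (r : ℂ) ≠ 0 := by exact_mod_cast hr.ne'
    have dinv : HasDerivAt (fun r : ℝ => ((ℓ : ℂ) + 1) / r + Complex.I * κ)
        (-((ℓ : ℂ) + 1) / (r : ℂ) ^ 2) r := by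
      have := (((hasDerivAt_id (r : ℂ)).inv hr0).const_mul ((ℓ : ℂ) + 1)).add_const
        (Complex.I * κ)
      refine (this.comp_ofReal.congr_deriv ?_)
      simp only [id]
      ring
    have d := (hE r hr).mul ((dinv.mul (hm 0 r hr)).sub (hm 1 r hr))
    refine d.congr_deriv ?_
    have hrec := coulombMoment_recursion hk hκ ℓ hr
    have hI := Complex.I_sq
    simp only [radialCoeff, coulombWave, Pi.sub_apply, Pi.mul_apply, zero_add, Nat.reduceAdd]
    set E := (r : ℂ) ^ (ℓ + 1) * Complex.exp (Complex.I * κ * r)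
    set m₀ := coulombMoment α κ ℓ 0 r
    set m₁ := coulombMoment α κ ℓ 1 r
    set m₂ := coulombMoment α κ ℓ 2 r
    push_cast
    field_simp
    linear_combination (E * r) * hrec + E * r ^ 2 * κ ^ 2 * m₀ * hI
  refine ⟨isPrimitive_of_hasDerivAt hy fun r hr => (hy' r hr).continuousAt.continuousWithinAt,
    isPrimitive_of_hasDerivAt hy' ?_⟩
  refine ContinuousOn.mul ?_ fun r hr => (hy r hr).continuousAt.continuousWithinAt
  unfold radialCoeff
  refine ContinuousOn.sub (ContinuousOn.add ?_ ?_) continuousOn_const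
  · refine Complex.continuous_ofReal.comp_continuousOn
      (ContinuousOn.div (by fun_prop) (by fun_prop) fun r hr => pow_ne_zero 2 (ne_of_gt hr))
  · refine Complex.continuous_ofReal.comp_continuousOn
      (ContinuousOn.div (by fun_prop) (by fun_prop) fun r hr => ne_of_gt hr)

/-- Exponential decay of the outgoing wave, uniform over admissible momenta. -/
theorem exists_norm_coulombWave_le (hk : 0 < k) (α : ℝ) (ℓ : ℕ) {r₀ : ℝ} (hr₀ : 0 < r₀) :
    ∃ C, 0 ≤ C ∧ ∀ κ, IsAdmissible α k κ → ∀ r, r₀ ≤ r →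
      ‖coulombWave α κ ℓ r‖ ≤ C * (r ^ (ℓ + 1) * Real.exp (-(κ.im * r))) := by
  obtain ⟨D, hD0, hD⟩ := exists_norm_coulombDensity_le hk α ℓ (ε := r₀ / 2) (by linarith)
  refine ⟨D * ∫ t in Set.Ioi (0 : ℝ), t ^ (-(1 / 2) : ℝ) * Real.exp (-(r₀ / 2 * t)), ?_,
    fun κ hκ r hr => ?_⟩
  · refine mul_nonneg hD0 (setIntegral_nonneg measurableSet_Ioi fun t ht => ?_)
    have : (0 : ℝ) < t := ht
    positivity
  · have h1 := IsLaplaceDensity.norm_laplaceTransform_le (ρ := coulombDensity α κ ℓ)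
      (by linarith) (hD κ hκ) (r := r) (by linarith)
    have h2 : coulombMoment α κ ℓ 0 r = laplaceTransform (coulombDensity α κ ℓ) r := by
      simp [coulombMoment]
    rw [coulombWave, norm_mul, norm_mul, norm_pow, Complex.norm_real, Real.norm_eq_abs,
      abs_of_pos (by linarith : 0 < r), Complex.norm_exp, h2, mul_comm]
    have : (Complex.I * κ * r).re = -(κ.im * r) := by simp
    rw [this]
    have hr0 : 0 ≤ r := by linarith
    gcongr

theorem continuous_coulombMoment {K : Type*} [TopologicalSpace K] [FirstCountableTopology K]
    (hk : 0 < k) {κ : K → ℂ} (hc : Continuous κ) (hκ : ∀ x, IsAdmissible α k (κ x)) (ℓ j : ℕ)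
    {r : ℝ} (hr : 0 < r) : Continuous fun x => coulombMoment α (κ x) ℓ j r := by
  obtain ⟨D, hD0, hD⟩ := exists_norm_coulombDensity_le hk α ℓ (ε := r / 4) (by linarith)
  obtain ⟨D', hD0', hD'⟩ := exists_pow_le_exp 0 le_rfl j (ε := r / 4) (by linarith)
  have hκ0 : ∀ x, 2 * κ x ≠ 0 := fun x h => by
    have := congrArg Complex.re h
    simp [(hκ x).re_eq, hk.ne'] at this
  unfold coulombMoment laplaceTransform
  refine continuous_of_dominated (bound := fun t => (D' * D) * (t ^ (-(1 / 2) : ℝ) *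
    Real.exp (-(r / 2 * t)))) (fun x => ?_) (fun x => ?_) ?_ ?_
  · exact (((isLaplaceDensity_coulombDensity hk (hκ x) ℓ).mul_pow j).integrableOn
      hr).aestronglyMeasurable
  · filter_upwards [self_mem_ae_restrict measurableSet_Ioi] with t (ht : 0 < t)
    refine IsLaplaceDensity.norm_kernel_le (ρ := fun t => (t : ℂ) ^ j *
      coulombDensity α (κ x) ℓ t) (ε := r / 2) (fun t ht => ?_) ht (by linarith)
    have h2 := hD' t ht
    rw [add_zero] at h2
    have e : r / 2 * t = r / 4 * t + r / 4 * t := by ring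
    rw [norm_mul, norm_pow, Complex.norm_real, Real.norm_eq_abs, abs_of_pos ht, e, Real.exp_add]
    calc t ^ j * ‖coulombDensity α (κ x) ℓ t‖ ≤ (D' * Real.exp (r / 4 * t)) *
          (D * (t ^ (-(1 / 2) : ℝ) * Real.exp (r / 4 * t))) := by
          gcongr
          exact hD (κ x) (hκ x) t ht
      _ = _ := by ring
  · exact (integrable_rpow_mul_exp_neg (by linarith) (by norm_num)).const_mul _
  · filter_upwards [self_mem_ae_restrict measurableSet_Ioi] with t (ht : 0 < t)
    refine continuous_const.mul (continuous_const.mul ?_)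
    unfold coulombDensity
    have h1 : Continuous fun x => (ℓ : ℂ) + Complex.I * (α / (2 * κ x)) :=
      continuous_const.add (continuous_const.mul (continuous_const.div (by fun_prop) hκ0))
    have h2 : Continuous fun x => (ℓ : ℂ) - Complex.I * (α / (2 * κ x)) :=
      continuous_const.sub (continuous_const.mul (continuous_const.div (by fun_prop) hκ0))
    refine Continuous.mul (h1.const_cpow (Or.inl (by exact_mod_cast ht.ne'))) ?_
    exact (by fun_prop : Continuous fun x => (t : ℂ) - 2 * Complex.I * κ x).cpow h2 fun x =>
      sub_two_I_mul_mem_slitPlane ((hκ x).re_eq ▸ hk : 0 < (κ x).re) t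

theorem continuous_coulombWave {K : Type*} [TopologicalSpace K] [FirstCountableTopology K]
    (hk : 0 < k) {κ : K → ℂ} (hc : Continuous κ) (hκ : ∀ x, IsAdmissible α k (κ x)) (ℓ : ℕ)
    {r : ℝ} (hr : 0 < r) : Continuous (fun x => coulombWave α (κ x) ℓ r) ∧
      Continuous fun x => coulombWaveDeriv α (κ x) ℓ r := by
  have h0 := continuous_coulombMoment hk hc hκ ℓ 0 hr
  have h1 := continuous_coulombMoment hk hc hκ ℓ 1 hr
  unfold coulombWave coulombWaveDeriv
  constructor <;> fun_prop

end

/-! ### Asymptotics of the Coulomb wave -/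

/-- The elementary half of Watson's lemma: a density of order `t^n` at the origin has a Laplace
transform of order `r^(-n-1)` at infinity. -/
theorem norm_laplaceTransform_le_inv_pow {σ : ℝ → ℂ} {C : ℝ} {n : ℕ} (hC : 0 ≤ C)
    (h : ∀ t, 0 < t → ‖σ t‖ ≤ C * (t ^ n * Real.exp (t / 2))) {r : ℝ} (hr : 1 ≤ r) :
    ‖laplaceTransform σ r‖ ≤ C * (2 ^ (n + 1) * Real.Gamma (n + 1)) / r ^ (n + 1) := by
  have hr0 : 0 < r := by linarith
  have hint := integrable_rpow_mul_exp_neg (b := r / 2) (s := (n : ℝ)) (by linarith)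
    (by have : (0 : ℝ) ≤ n := by positivity
        linarith)
  have hG := Real.integral_rpow_mul_exp_neg_mul_Ioi (a := (n : ℝ) + 1) (r := r / 2)
    (by positivity) (by linarith)
  rw [add_sub_cancel_right] at hG
  have h1 : ‖laplaceTransform σ r‖
      ≤ ∫ t in Set.Ioi (0 : ℝ), C * (t ^ (n : ℝ) * Real.exp (-(r / 2 * t))) := by
    refine norm_integral_le_of_norm_le (hint.const_mul C) ?_
    filter_upwards [self_mem_ae_restrict measurableSet_Ioi] with t (ht : 0 < t)
    rw [norm_mul, Complex.norm_real, Real.norm_eq_abs, abs_of_pos (Real.exp_pos _),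
      Real.rpow_natCast]
    calc Real.exp (-(r * t)) * ‖σ t‖
        ≤ Real.exp (-(r * t)) * (C * (t ^ n * Real.exp (t / 2))) := by gcongr; exact h t ht
      _ = C * (t ^ n * Real.exp (-(r * t) + t / 2)) := by rw [Real.exp_add]; ring
      _ ≤ C * (t ^ n * Real.exp (-(r / 2 * t))) := by
        gcongr
        nlinarith
  refine h1.trans (le_of_eq ?_)
  rw [integral_const_mul, hG, one_div_div, ← Nat.cast_add_one, Real.rpow_natCast, div_pow]
  ring

theorem isAdmissible_ofReal {k : ℝ} (α : ℝ) : IsAdmissible α k (k : ℂ) where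
  re_eq := Complex.ofReal_re k
  im_nonneg := by simp
  im_le := by simp
  eta_im := by
    have : (α : ℂ) / (2 * k) = ((α / (2 * k) : ℝ) : ℂ) := by push_cast; rfl
    rw [this, Complex.ofReal_im]
    norm_num

theorem norm_sub_two_I_mul_cpow_le {k : ℝ} (hk : 0 < k) {n : ℕ} {w : ℂ} (hw : |w.re| ≤ n) {t : ℝ}
    (ht : 0 ≤ t) : ‖((t : ℂ) - 2 * Complex.I * k) ^ w‖
      ≤ Real.exp (Real.pi * |w.im|) * (t + (2 * k + (2 * k)⁻¹)) ^ n := by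
  have hz0 := Complex.slitPlane_ne_zero (sub_two_I_mul_mem_slitPlane
    (κ := (k : ℂ)) (by simpa using hk) t)
  set z : ℂ := (t : ℂ) - 2 * Complex.I * k with hz
  have hzl : 2 * k ≤ ‖z‖ := by
    have : z.im = -(2 * k) := by rw [hz]; simp
    calc 2 * k = |z.im| := by rw [this, abs_neg, abs_of_pos (by linarith)]
      _ ≤ ‖z‖ := Complex.abs_im_le_norm z
  have hzu : ‖z‖ ≤ t + 2 * k := by
    refine (norm_sub_le _ _).trans ?_
    simp [abs_of_nonneg ht, abs_of_pos hk]
  refine (norm_cpow_le_exp _ _ hz0).trans ?_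
  rw [mul_comm]
  gcongr
  refine (rpow_le_add_inv_pow (by linarith) hw).trans ?_
  have : ‖z‖⁻¹ ≤ (2 * k)⁻¹ := by gcongr
  refine pow_le_pow_left₀ (by positivity) ?_ _
  linarith

section

variable {k : ℝ}

/-- Asymptotics of the outgoing Coulomb wave, and Sommerfeld's radiation condition for it, at real
momenta. -/
theorem coulombWave_asymptotics (hk : 0 < k) (α : ℝ) (ℓ : ℕ) :
    (fun r : ℝ => coulombWave α k ℓ r -
      Complex.Gamma (ℓ + 1 + Complex.I * ((α / (2 * k) : ℝ) : ℂ)) *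
        (-(2 * Complex.I * k)) ^ (ℓ - Complex.I * ((α / (2 * k) : ℝ) : ℂ)) *
        Complex.exp (Complex.I * ((k * r - α / (2 * k) * Real.log r : ℝ) : ℂ)))
      =O[atTop] (fun r : ℝ => 1 / r) ∧
    (fun r : ℝ => coulombWaveDeriv α k ℓ r - Complex.I * k * coulombWave α k ℓ r)
      =O[atTop] (fun r : ℝ => 1 / r) := by
  set η : ℝ := α / (2 * k) with hη
  have hηc : (α : ℂ) / (2 * k) = (η : ℂ) := by rw [hη]; push_cast; rfl
  set z₀ : ℂ := -(2 * Complex.I * k) with hz₀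
  set B : ℂ := ℓ - Complex.I * η with hB
  set c := 2 * k + (2 * k)⁻¹ with hc
  have hc0 : 0 ≤ c := by positivity
  obtain ⟨D, hD0, hD⟩ := exists_pow_le_exp c hc0 (ℓ + 1) (ε := 1 / 2) (by norm_num)
  have hslit : ∀ t : ℝ, (t : ℂ) - 2 * Complex.I * k ∈ Complex.slitPlane := fun t =>
    sub_two_I_mul_mem_slitPlane (κ := (k : ℂ)) (by simpa using hk) t
  have hBre : B.re = ℓ := by simp [hB]
  have hBim : B.im = -η := by simp [hB]
  have hℓ : (0 : ℝ) ≤ ℓ := by positivity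
  -- the density and its leading part at the origin
  have hρb : ∀ t : ℝ, 0 < t → ‖coulombDensity α k ℓ t‖
      ≤ Real.exp (Real.pi * |B.im|) * D * (t ^ ℓ * Real.exp (t / 2)) := by
    intro t ht
    rw [coulombDensity, hηc, norm_mul, Complex.norm_cpow_eq_rpow_re_of_pos ht]
    have e : ((ℓ : ℂ) + Complex.I * η).re = ℓ := by simp
    rw [e, Real.rpow_natCast]
    have h1 := norm_sub_two_I_mul_cpow_le hk (w := B) (n := ℓ + 1)
      (by rw [hBre, abs_of_nonneg hℓ]; push_cast; linarith) ht.le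
    have h2 := hD t ht
    rw [show (1 : ℝ) / 2 * t = t / 2 by ring] at h2
    calc t ^ ℓ * ‖((t : ℂ) - 2 * Complex.I * k) ^ B‖
        ≤ t ^ ℓ * (Real.exp (Real.pi * |B.im|) * (D * Real.exp (t / 2))) := by
          gcongr
          exact h1.trans (by gcongr)
      _ = _ := by ring
  set E := ‖B‖ * Real.exp (Real.pi * |B.im|) with hE
  have hdiff : ∀ t : ℝ, 0 < t → ‖((t : ℂ) - 2 * Complex.I * k) ^ B - z₀ ^ B‖
      ≤ E * (D * Real.exp (t / 2)) * t := by
    intro t ht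
    have h1 := norm_image_sub_le_of_norm_deriv_le_segment_01'
      (f := fun s : ℝ => (((s * t : ℝ) : ℂ) - 2 * Complex.I * k) ^ B)
      (f' := fun s : ℝ => B * (((s * t : ℝ) : ℂ) - 2 * Complex.I * k) ^ (B - 1) * t)
      (C := E * (D * Real.exp (t / 2)) * t) ?_ ?_
    · simpa [hz₀] using h1
    · intro s hs
      have d1 : HasDerivAt (fun s : ℂ => (s - 2 * Complex.I * k) ^ B)
          (B * (((s * t : ℝ) : ℂ) - 2 * Complex.I * k) ^ (B - 1) * 1) ((s * t : ℝ) : ℂ) :=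
        ((hasDerivAt_id (((s * t : ℝ) : ℂ))).sub_const _).cpow_const (hslit (s * t))
      have d2 : HasDerivAt (fun s : ℝ => s * t) (1 * t) s := (hasDerivAt_id s).mul_const t
      refine ((d1.comp_ofReal.scomp s d2).congr_deriv ?_).hasDerivWithinAt
      rw [Complex.real_smul]
      push_cast
      ring
    · intro s hs
      have hst : 0 ≤ s * t := mul_nonneg hs.1 ht.le
      have h2 := norm_sub_two_I_mul_cpow_le hk (w := B - 1) (n := ℓ + 1)
        (by
          rw [Complex.sub_re, hBre, Complex.one_re, abs_le]
          push_cast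
          constructor <;> linarith) hst
      have e : (B - 1).im = B.im := by simp
      rw [e] at h2
      have h3 := hD t ht
      rw [show (1 : ℝ) / 2 * t = t / 2 by ring] at h3
      have h4 : (s * t + c) ^ (ℓ + 1) ≤ D * Real.exp (t / 2) := by
        refine le_trans (pow_le_pow_left₀ (by positivity) ?_ _) h3
        have : s * t ≤ 1 * t := by gcongr; exact hs.2.le
        linarith
      rw [norm_mul, norm_mul, Complex.norm_real, Real.norm_eq_abs, abs_of_pos ht]
      calc ‖B‖ * ‖(((s * t : ℝ) : ℂ) - 2 * Complex.I * k) ^ (B - 1)‖ * t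
          ≤ ‖B‖ * (Real.exp (Real.pi * |B.im|) * (D * Real.exp (t / 2))) * t := by
            gcongr
            exact h2.trans (by gcongr)
        _ = _ := by rw [hE]; ring
  -- the moment of order zero
  have hm₀ : ∀ r : ℝ, 1 ≤ r → ‖coulombMoment α k ℓ 0 r -
      z₀ ^ B * ((1 / r : ℂ) ^ ((ℓ : ℂ) + 1 + Complex.I * η) *
        Complex.Gamma (ℓ + 1 + Complex.I * η))‖
      ≤ E * D * (2 ^ (ℓ + 2) * Real.Gamma (ℓ + 2)) / r ^ (ℓ + 2) := by
    intro r hr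
    have hr0 : 0 < r := by linarith
    have hG := Complex.integral_cpow_mul_exp_neg_mul_Ioi (a := (ℓ : ℂ) + 1 + Complex.I * η)
      (r := r) (by simp; linarith) hr0
    have e1 : (ℓ : ℂ) + 1 + Complex.I * η - 1 = ℓ + Complex.I * η := by ring
    rw [e1] at hG
    have i1 := (isLaplaceDensity_coulombDensity hk (isAdmissible_ofReal α) ℓ).integrableOn hr0
    have i2 : IntegrableOn (fun t : ℝ => (Real.exp (-(r * t)) : ℂ) *
        ((t : ℂ) ^ ((ℓ : ℂ) + Complex.I * η))) (Set.Ioi 0) := by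
      refine Integrable.mono' (integrable_rpow_mul_exp_neg (b := r) (s := ℓ) hr0
        (by linarith)) ?_ ?_
      · refine ContinuousOn.aestronglyMeasurable (ContinuousOn.mul (by fun_prop) ?_)
          measurableSet_Ioi
        refine ContinuousOn.cpow_const (by fun_prop) fun t (ht : 0 < t) => Or.inl (by simpa)
      · filter_upwards [self_mem_ae_restrict measurableSet_Ioi] with t (ht : 0 < t)
        rw [norm_mul, Complex.norm_real, Real.norm_eq_abs, abs_of_pos (Real.exp_pos _),
          Complex.norm_cpow_eq_rpow_re_of_pos ht, mul_comm]
        simp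
    have e2 : ∫ t in Set.Ioi (0 : ℝ), (Real.exp (-(r * t)) : ℂ) *
        ((t : ℂ) ^ ((ℓ : ℂ) + Complex.I * η)) =
        (1 / r : ℂ) ^ ((ℓ : ℂ) + 1 + Complex.I * η) *
          Complex.Gamma (ℓ + 1 + Complex.I * η) := by
      rw [← hG]
      refine integral_congr_ae (Eventually.of_forall fun t => ?_)
      simp only
      push_cast
      ring
    have e3 : coulombMoment α k ℓ 0 r - z₀ ^ B * ((1 / r : ℂ) ^ ((ℓ : ℂ) + 1 + Complex.I * η) *
        Complex.Gamma (ℓ + 1 + Complex.I * η)) = laplaceTransform (fun t =>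
          (t : ℂ) ^ ((ℓ : ℂ) + Complex.I * η) *
            (((t : ℂ) - 2 * Complex.I * k) ^ B - z₀ ^ B)) r := by
      rw [← e2, ← integral_const_mul]
      simp only [coulombMoment, laplaceTransform, pow_zero, one_mul]
      rw [← integral_sub i1 (i2.const_mul _)]
      refine integral_congr_ae (Eventually.of_forall fun t => ?_)
      simp only [coulombDensity, hηc]
      ring
    rw [e3]
    have h4 := norm_laplaceTransform_le_inv_pow (σ := fun t =>
          (t : ℂ) ^ ((ℓ : ℂ) + Complex.I * η) * (((t : ℂ) - 2 * Complex.I * k) ^ B - z₀ ^ B))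
      (C := E * D) (n := ℓ + 1) (by positivity) (fun t ht => ?_) hr
    · push_cast at h4
      rw [show (ℓ : ℝ) + 1 + 1 = ℓ + 2 by ring] at h4
      exact h4
    · rw [norm_mul, Complex.norm_cpow_eq_rpow_re_of_pos ht]
      have e : ((ℓ : ℂ) + Complex.I * η).re = ℓ := by simp
      rw [e, Real.rpow_natCast, pow_succ]
      calc t ^ ℓ * ‖((t : ℂ) - 2 * Complex.I * k) ^ B - z₀ ^ B‖
          ≤ t ^ ℓ * (E * (D * Real.exp (t / 2)) * t) := by gcongr; exact hdiff t ht
        _ = _ := by ring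
  have hm₁ : ∀ r : ℝ, 1 ≤ r → ‖coulombMoment α k ℓ 1 r‖
      ≤ Real.exp (Real.pi * |B.im|) * D * (2 ^ (ℓ + 2) * Real.Gamma (ℓ + 2)) / r ^ (ℓ + 2) := by
    intro r hr
    have h4 := norm_laplaceTransform_le_inv_pow (σ := fun t =>
          (t : ℂ) ^ 1 * coulombDensity α k ℓ t)
      (C := Real.exp (Real.pi * |B.im|) * D) (n := ℓ + 1) (by positivity) (fun t ht => ?_) hr
    · push_cast at h4
      rw [show (ℓ : ℝ) + 1 + 1 = ℓ + 2 by ring] at h4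
      exact h4
    · rw [norm_mul, pow_one, Complex.norm_real, Real.norm_eq_abs, abs_of_pos ht, pow_succ]
      calc t * ‖coulombDensity α k ℓ t‖
          ≤ t * (Real.exp (Real.pi * |B.im|) * D * (t ^ ℓ * Real.exp (t / 2))) := by
            gcongr; exact hρb t ht
        _ = _ := by ring
  have hexp : ∀ r : ℝ, 0 < r → ‖(r : ℂ) ^ (ℓ + 1) * Complex.exp (Complex.I * k * r)‖
      = r ^ (ℓ + 1) := by
    intro r hr
    rw [norm_mul, norm_pow, Complex.norm_real, Real.norm_eq_abs, abs_of_pos hr, Complex.norm_exp]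
    simp
  have hpow : ∀ r C : ℝ, 0 < r → r ^ (ℓ + 1) * (C / r ^ (ℓ + 2)) = C * (1 / r) := by
    intro r C hr
    rw [pow_succ r (ℓ + 1)]
    field_simp
  have first : (fun r : ℝ => coulombWave α k ℓ r -
      Complex.Gamma (ℓ + 1 + Complex.I * η) * z₀ ^ B *
        Complex.exp (Complex.I * ((k * r - η * Real.log r : ℝ) : ℂ)))
      =O[atTop] (fun r : ℝ => 1 / r) := by
    refine IsBigO.of_bound (E * D * (2 ^ (ℓ + 2) * Real.Gamma (ℓ + 2))) ?_
    filter_upwards [eventually_ge_atTop 1] with r hr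
    have hr0 : 0 < r := by linarith
    have hr0' : (r : ℂ) ≠ 0 := by exact_mod_cast hr0.ne'
    have e : Complex.exp (Complex.I * ((k * r - η * Real.log r : ℝ) : ℂ)) =
        (r : ℂ) ^ (ℓ + 1) * Complex.exp (Complex.I * k * r) *
          (1 / r : ℂ) ^ ((ℓ : ℂ) + 1 + Complex.I * η) := by
      have h1 : (1 / r : ℂ) ≠ 0 := one_div_ne_zero hr0'
      have h2 : Complex.log (1 / r : ℂ) = -(Real.log r : ℂ) := by
        rw [← Complex.ofReal_one, ← Complex.ofReal_div, ← Complex.ofReal_log (by positivity)]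
        rw [one_div, Real.log_inv]
        push_cast
        rfl
      have h3 : (r : ℂ) ^ (ℓ + 1) = Complex.exp (((ℓ : ℂ) + 1) * Real.log r) := by
        rw [Complex.ofReal_log hr0.le]
        rw [← Nat.cast_succ, Complex.exp_nat_mul, Complex.exp_log hr0']
      rw [Complex.cpow_def_of_ne_zero h1, h2, h3, ← Complex.exp_add, ← Complex.exp_add]
      congr 1
      push_cast
      ring
    rw [coulombWave, e]
    have e5 : (r : ℂ) ^ (ℓ + 1) * Complex.exp (Complex.I * k * r) * coulombMoment α k ℓ 0 r -
        Complex.Gamma (ℓ + 1 + Complex.I * η) * z₀ ^ B * ((r : ℂ) ^ (ℓ + 1) *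
          Complex.exp (Complex.I * k * r) * (1 / r : ℂ) ^ ((ℓ : ℂ) + 1 + Complex.I * η))
        = ((r : ℂ) ^ (ℓ + 1) * Complex.exp (Complex.I * k * r)) *
        (coulombMoment α k ℓ 0 r - z₀ ^ B * ((1 / r : ℂ) ^ ((ℓ : ℂ) + 1 + Complex.I * η) *
        Complex.Gamma (ℓ + 1 + Complex.I * η))) := by ring
    rw [e5, norm_mul, hexp r hr0, Real.norm_eq_abs, abs_of_pos (by positivity : 0 < 1 / r),
      ← hpow r _ hr0]
    gcongr
    exact hm₀ r hr
  refine ⟨first, ?_⟩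
  have hbdd : (fun r : ℝ => coulombWave α k ℓ r) =O[atTop] (fun _ : ℝ => (1 : ℝ)) := by
    have h1 : (fun r : ℝ => (1 : ℝ) / r) =O[atTop] (fun _ : ℝ => (1 : ℝ)) := by
      refine IsBigO.of_bound 1 ?_
      filter_upwards [eventually_ge_atTop 1] with r hr
      rw [Real.norm_eq_abs, abs_of_pos (by positivity), norm_one, mul_one, div_le_one (by linarith)]
      exact hr
    have h2 : (fun r : ℝ => Complex.Gamma (ℓ + 1 + Complex.I * η) * z₀ ^ B *
        Complex.exp (Complex.I * ((k * r - η * Real.log r : ℝ) : ℂ)))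
        =O[atTop] (fun _ : ℝ => (1 : ℝ)) := by
      refine IsBigO.of_bound ‖Complex.Gamma (ℓ + 1 + Complex.I * η) * z₀ ^ B‖
        (Eventually.of_forall fun r => ?_)
      rw [norm_mul, mul_comm Complex.I ((k * r - η * Real.log r : ℝ) : ℂ), Complex.norm_exp_ofReal_mul_I]
      simp
    simpa using (first.trans h1).add h2
  have second : (fun r : ℝ => (r : ℂ) ^ (ℓ + 1) * Complex.exp (Complex.I * k * r) *
      coulombMoment α k ℓ 1 r) =O[atTop] (fun r : ℝ => 1 / r) := by
    refine IsBigO.of_bound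
      (Real.exp (Real.pi * |B.im|) * D * (2 ^ (ℓ + 2) * Real.Gamma (ℓ + 2))) ?_
    filter_upwards [eventually_ge_atTop 1] with r hr
    have hr0 : 0 < r := by linarith
    rw [norm_mul, hexp r hr0, Real.norm_eq_abs, abs_of_pos (by positivity : 0 < 1 / r),
      ← hpow r _ hr0]
    gcongr
    exact hm₁ r hr
  have third : (fun r : ℝ => ((ℓ : ℂ) + 1) / r * coulombWave α k ℓ r)
      =O[atTop] (fun r : ℝ => 1 / r) := by
    have h1 : (fun r : ℝ => ((ℓ : ℂ) + 1) / r) =O[atTop] (fun r : ℝ => 1 / r) := by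
      refine IsBigO.of_bound ((ℓ : ℝ) + 1) (Eventually.of_forall fun r => ?_)
      rw [norm_div, norm_div, Complex.norm_real, norm_one]
      have : ‖(ℓ : ℂ) + 1‖ = (ℓ : ℝ) + 1 := by
        rw [← Nat.cast_succ, Complex.norm_natCast]
        push_cast
        rfl
      rw [this]
      exact le_of_eq (by ring)
    simpa using h1.mul hbdd
  refine (third.sub second).congr_left fun r => ?_
  rw [coulombWaveDeriv, coulombWave]
  ring

end

/-! ### Uniqueness of the outgoing Coulomb wave -/

/-- A solution of order `1/r` has a derivative of order `1/r`, if the coefficient is bounded at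
infinity. -/
theorem IsSolution.deriv_isBigO {q u u' : ℝ → ℂ} (h : IsSolution q u u') {M : ℝ}
    (hM : ∀ᶠ r in atTop, ‖q r‖ ≤ M) (hu : u =O[atTop] (fun r : ℝ => 1 / r)) :
    u' =O[atTop] (fun r : ℝ => 1 / r) := by
  obtain ⟨C, hC0, hC⟩ := hu.exists_pos
  rw [IsBigOWith] at hC
  obtain ⟨R, hR⟩ := (hM.and hC).exists_forall_of_atTop
  refine IsBigO.of_bound (2 * C + M * C) ?_
  filter_upwards [eventually_ge_atTop (max R 1)] with r hr
  have hrR : R ≤ r := (le_max_left _ _).trans hr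
  have hr1 : 1 ≤ r := (le_max_right _ _).trans hr
  have hr0 : 0 < r := by linarith
  have hM0 : 0 ≤ M := (norm_nonneg _).trans (hR r hrR).1
  have hb : ∀ t, r ≤ t → ‖u t‖ ≤ C * (1 / r) := fun t ht => by
    have ht0 : 0 < t := by linarith
    refine (hR t (hrR.trans ht)).2.trans ?_
    rw [Real.norm_eq_abs, abs_of_pos (by positivity)]
    gcongr
  have h1 : ∀ t ∈ Set.Icc r (r + 1), ‖u' t - u' r‖ ≤ M * C * (1 / r) := by
    intro t ht
    rw [h.snd.sub_eq r t hr0 (by linarith [ht.1])]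
    have h2 := intervalIntegral.norm_integral_le_of_norm_le_const (a := r) (b := t)
      (f := fun t => q t * u t) (C := M * (C * (1 / r))) (fun s hs => by
        rw [Set.uIoc_of_le ht.1] at hs
        rw [norm_mul]
        have := (hR s (hrR.trans hs.1.le)).1
        have := hb s hs.1.le
        gcongr)
    refine h2.trans ?_
    rw [abs_of_nonneg (by linarith [ht.1])]
    have : t - r ≤ 1 := by linarith [ht.2]
    calc M * (C * (1 / r)) * (t - r) ≤ M * (C * (1 / r)) * 1 := by gcongr
      _ = _ := by ring
  have h3 := (convex_Icc r (r + 1)).norm_image_sub_le_of_norm_hasDerivWithin_le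
    (f := fun t => u t - u' r * t) (f' := fun t => u' t - u' r) (x := r) (y := r + 1)
    (C := M * C * (1 / r))
    (fun t ht => (((h.hasDerivAt (by linarith [ht.1] : 0 < t)).sub
      (((hasDerivAt_id (t : ℂ)).comp_ofReal.const_mul (u' r)))).congr_deriv
        (by simp)).hasDerivWithinAt) h1 ⟨le_rfl, by linarith⟩ ⟨by linarith, le_rfl⟩
  have e : u' r = u (r + 1) - u r - ((u (r + 1) - u' r * ((r + 1 : ℝ) : ℂ)) - (u r - u' r * r)) := by
    push_cast
    ring
  rw [e, Real.norm_eq_abs, abs_of_pos (by positivity : 0 < 1 / r)]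
  refine (norm_sub_le _ _).trans ?_
  have h4 := norm_sub_le (u (r + 1)) (u r)
  have h5 := hb r le_rfl
  have h6 := hb (r + 1) (by linarith)
  have h7 : ‖(r + 1 - r : ℝ)‖ = 1 := by simp
  rw [h7, mul_one] at h3
  have h8 : ‖u (r + 1) - u' r * ((r + 1 : ℝ) : ℂ) - (u r - u' r * r)‖ ≤ M * C * (1 / r) := h3
  nlinarith

/-- Solutions with vanishing Wronskian are proportional. The multiple is computed with the help of a
solution `w` that is linearly independent of `v`. -/
theorem IsSolution.eq_const_mul {q u u' v v' w w' : ℝ → ℂ} (hu : IsSolution q u u')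
    (hv : IsSolution q v v') (hw : IsSolution q w w')
    (h0 : u' 1 * v 1 - u 1 * v' 1 = 0) (h1 : v' 1 * w 1 - v 1 * w' 1 ≠ 0) {r : ℝ} (hr : 0 < r) :
    u r = (u' 1 * w 1 - u 1 * w' 1) / (v' 1 * w 1 - v 1 * w' 1) * v r := by
  rw [div_mul_eq_mul_div, eq_div_iff h1]
  have e0 := hu.wronskian_const hv hr one_pos
  have e1 := hv.wronskian_const hw hr one_pos
  have e2 := hu.wronskian_const hw hr one_pos
  rw [h0] at e0
  rw [← e1, ← e2]
  linear_combination (-w r) * e0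

section Coulomb

variable {α k : ℝ} {ℓ : ℕ}

theorem radialCoeff_coulomb (α k : ℝ) (ℓ : ℕ) (r : ℝ) :
    radialCoeff (fun r => ((α / r : ℝ) : ℂ)) ℓ ((k : ℂ) ^ 2) r
      = ((ℓ * (ℓ + 1) / r ^ 2 + α / r - k ^ 2 : ℝ) : ℂ) := by
  simp only [radialCoeff]
  push_cast
  ring

theorem isSolution_conj_coulombWave (hk : 0 < k) (α : ℝ) (ℓ : ℕ) :
    IsSolution (radialCoeff (fun r => ((α / r : ℝ) : ℂ)) ℓ ((k : ℂ) ^ 2))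
      (fun r => conj (coulombWave α k ℓ r)) (fun r => conj (coulombWaveDeriv α k ℓ r)) := by
  have h := (isSolution_coulombWave hk (isAdmissible_ofReal α) ℓ).conj
  have e : (fun r => conj (radialCoeff (fun r => ((α / r : ℝ) : ℂ)) ℓ ((k : ℂ) ^ 2) r))
      = radialCoeff (fun r => ((α / r : ℝ) : ℂ)) ℓ ((k : ℂ) ^ 2) := by
    funext r
    rw [radialCoeff_coulomb, Complex.conj_ofReal]
  rwa [e] at h

theorem tendsto_norm_coulombWave (hk : 0 < k) (α : ℝ) (ℓ : ℕ) :
    ∃ c, 0 < c ∧ Tendsto (fun r => ‖coulombWave α k ℓ r‖) atTop (𝓝 c) := by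
  set c := Complex.Gamma (ℓ + 1 + Complex.I * ((α / (2 * k) : ℝ) : ℂ)) *
        (-(2 * Complex.I * k)) ^ (ℓ - Complex.I * ((α / (2 * k) : ℝ) : ℂ)) with hc
  have h := (coulombWave_asymptotics hk α ℓ).1
  rw [← hc] at h
  have hc0 : c ≠ 0 := by
    refine mul_ne_zero (Complex.Gamma_ne_zero_of_re_pos ?_) ?_
    · simp only [Complex.add_re, Complex.natCast_re, Complex.one_re, Complex.mul_re, Complex.I_re,
        Complex.ofReal_re, Complex.I_im, Complex.ofReal_im]
      have : (0 : ℝ) ≤ ℓ := by positivity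
      linarith
    · have : -(2 * Complex.I * k) ≠ 0 := by simp [hk.ne']
      simp [Complex.cpow_def_of_ne_zero this]
  refine ⟨‖c‖, norm_pos_iff.mpr hc0, ?_⟩
  have h1 : Tendsto (fun r : ℝ => 1 / r) atTop (𝓝 0) := tendsto_const_nhds.div_atTop tendsto_id
  have h2 := (h.trans_tendsto h1).norm
  rw [norm_zero] at h2
  rw [tendsto_iff_norm_sub_tendsto_zero]
  refine squeeze_zero (fun _ => norm_nonneg _) (fun r => ?_) h2
  have := abs_norm_sub_norm_le (coulombWave α k ℓ r)
    (c * Complex.exp (Complex.I * ((k * r - α / (2 * k) * Real.log r : ℝ) : ℂ)))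
  rw [norm_mul, mul_comm Complex.I ((k * r - α / (2 * k) * Real.log r : ℝ) : ℂ),
    Complex.norm_exp_ofReal_mul_I, mul_one] at this
  rwa [mul_comm Complex.I ((k * r - α / (2 * k) * Real.log r : ℝ) : ℂ)]

/-- The radiation condition in the bilinear form that enters the Wronskian of `ψ̄` and `ψ`. -/
theorem coulombWave_flux (hk : 0 < k) (α : ℝ) (ℓ : ℕ) :
    (fun r : ℝ => conj (coulombWaveDeriv α k ℓ r) * coulombWave α k ℓ r
      - conj (coulombWave α k ℓ r) * coulombWaveDeriv α k ℓ r
      + 2 * Complex.I * k * (conj (coulombWave α k ℓ r) * coulombWave α k ℓ r))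
      =O[atTop] (fun r : ℝ => 1 / r) := by
  obtain ⟨c, -, hc⟩ := tendsto_norm_coulombWave hk α ℓ
  have hb : (fun r => coulombWave α k ℓ r) =O[atTop] (fun _ : ℝ => (1 : ℝ)) :=
    (isBigO_norm_left.mp (hc.isBigO_one ℝ))
  have hs := (coulombWave_asymptotics hk α ℓ).2
  have hb' : (fun r => conj (coulombWave α k ℓ r)) =O[atTop] (fun _ : ℝ => (1 : ℝ)) := by
    exact isBigO_norm_left.mp (hb.norm_left.congr_left fun r => by rw [RCLike.norm_conj])
  have hs' : (fun r : ℝ => conj (coulombWaveDeriv α k ℓ r - Complex.I * k * coulombWave α k ℓ r))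
      =O[atTop] (fun r : ℝ => 1 / r) := by
    exact isBigO_norm_left.mp (hs.norm_left.congr_left fun r => by rw [RCLike.norm_conj])
  have h0 := hs'.mul hb
  have h0' := hb'.mul hs
  simp only [mul_one, one_mul] at h0 h0'
  have h1 := h0.sub h0'
  refine h1.congr_left fun r => ?_
  simp only [map_sub, map_mul, Complex.conj_I, Complex.conj_ofReal]
  ring

/-- The outgoing wave and its conjugate, the incoming one, are linearly independent: their Wronskian
is constant, and by the radiation condition it equals `2ik lim |ψ|² ≠ 0`. -/
theorem coulombWave_wronskian_conj_ne_zero (hk : 0 < k) (α : ℝ) (ℓ : ℕ) :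
    coulombWaveDeriv α k ℓ 1 * conj (coulombWave α k ℓ 1)
      - coulombWave α k ℓ 1 * conj (coulombWaveDeriv α k ℓ 1) ≠ 0 := by
  intro h0
  obtain ⟨c, hc0, hc⟩ := tendsto_norm_coulombWave hk α ℓ
  have hsol := isSolution_coulombWave hk (isAdmissible_ofReal α) ℓ
  have hsolc := isSolution_conj_coulombWave hk α ℓ
  have h1 : Tendsto (fun r : ℝ => 1 / r) atTop (𝓝 0) := tendsto_const_nhds.div_atTop tendsto_id
  have h2 := ((coulombWave_flux hk α ℓ).trans_tendsto h1).norm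
  rw [norm_zero] at h2
  have h3 : Tendsto (fun r => 2 * k * ‖coulombWave α k ℓ r‖ ^ 2) atTop (𝓝 (2 * k * c ^ 2)) :=
    (hc.pow 2).const_mul _
  have h4 := h3.congr' (f₂ := fun r : ℝ => ‖conj (coulombWaveDeriv α k ℓ r) * coulombWave α k ℓ r
      - conj (coulombWave α k ℓ r) * coulombWaveDeriv α k ℓ r
      + 2 * Complex.I * k * (conj (coulombWave α k ℓ r) * coulombWave α k ℓ r)‖) (by
    filter_upwards [eventually_gt_atTop 0] with r hr
    have h5 := hsol.wronskian_const hsolc hr one_pos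
    rw [h0] at h5
    have h6 : conj (coulombWaveDeriv α k ℓ r) * coulombWave α k ℓ r
      - conj (coulombWave α k ℓ r) * coulombWaveDeriv α k ℓ r = 0 := by
      linear_combination -h5
    rw [h6, zero_add, norm_mul, norm_mul, norm_mul, norm_mul, RCLike.norm_conj]
    simp only [Complex.norm_two, Complex.norm_I, Complex.norm_real, Real.norm_eq_abs,
      abs_of_pos hk]
    ring)
  have := tendsto_nhds_unique h4 h2
  have : 0 < 2 * k * c ^ 2 := by positivity
  linarith

theorem IsOutgoingCoulomb.isSolution {H : ℝ → ℂ} (h : IsOutgoingCoulomb α k ℓ H) :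
    IsSolution (radialCoeff (fun r => ((α / r : ℝ) : ℂ)) ℓ ((k : ℂ) ^ 2)) H (deriv H) := by
  have hc : ContinuousOn (deriv H) (Set.Ioi 0) := fun r hr =>
    (h.equation r hr).continuousAt.continuousWithinAt
  have hcH : ContinuousOn H (Set.Ioi 0) := fun r hr =>
    (h.hasDerivAt r hr).continuousAt.continuousWithinAt
  refine ⟨isPrimitive_of_hasDerivAt h.hasDerivAt hc, isPrimitive_of_hasDerivAt (fun r hr => ?_) ?_⟩
  · rw [radialCoeff_coulomb]
    exact h.equation r hr
  · simp only [radialCoeff_coulomb]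
    refine ContinuousOn.mul (Complex.continuous_ofReal.comp_continuousOn ?_) hcH
    refine ContinuousOn.sub (ContinuousOn.add ?_ ?_) continuousOn_const
    · exact ContinuousOn.div (by fun_prop) (by fun_prop) fun r hr => pow_ne_zero 2 (ne_of_gt hr)
    · exact ContinuousOn.div (by fun_prop) (by fun_prop) fun r hr => ne_of_gt hr

theorem exists_isOutgoingCoulomb (hk : 0 < k) (α : ℝ) (ℓ : ℕ) :
    ∃ c : ℂ, c ≠ 0 ∧ IsOutgoingCoulomb α k ℓ (fun r => c * coulombWave α k ℓ r) := by
  set g := Complex.Gamma (ℓ + 1 + Complex.I * ((α / (2 * k) : ℝ) : ℂ)) with hg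
  set z := (-(2 * Complex.I * k)) ^ (ℓ - Complex.I * ((α / (2 * k) : ℝ) : ℂ)) with hz
  have hg0 : g ≠ 0 := by
    refine Complex.Gamma_ne_zero_of_re_pos ?_
    simp only [Complex.add_re, Complex.natCast_re, Complex.one_re, Complex.mul_re, Complex.I_re,
        Complex.ofReal_re, Complex.I_im, Complex.ofReal_im]
    have : (0 : ℝ) ≤ ℓ := by positivity
    linarith
  have hz0 : z ≠ 0 := by
    have : -(2 * Complex.I * k) ≠ 0 := by simp [hk.ne']
    simp [hz, Complex.cpow_def_of_ne_zero this]
  set θ : ℝ := -(α / (2 * k) * Real.log (2 * k)) - ℓ * Real.pi / 2 + g.arg with hθ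
  set c : ℂ := Complex.exp (Complex.I * θ) / (g * z) with hc
  have hc0 : c ≠ 0 := div_ne_zero (Complex.exp_ne_zero _) (mul_ne_zero hg0 hz0)
  have hsol := isSolution_coulombWave hk (isAdmissible_ofReal α) ℓ
  have hd : ∀ r, 0 < r → HasDerivAt (fun r => c * coulombWave α k ℓ r)
      (c * coulombWaveDeriv α k ℓ r) r := fun r hr => (hsol.hasDerivAt hr).const_mul c
  have hd' : ∀ r, 0 < r → deriv (fun r => c * coulombWave α k ℓ r) r
      = c * coulombWaveDeriv α k ℓ r := fun r hr => (hd r hr).deriv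
  refine ⟨c, hc0, ⟨fun r hr => ?_, fun r hr => ?_, ?_⟩⟩
  · rw [hd' r hr]
    exact hd r hr
  · have hcont : ContinuousOn (fun r => radialCoeff (fun r => ((α / r : ℝ) : ℂ)) ℓ ((k : ℂ) ^ 2) r
        * coulombWave α k ℓ r) (Set.Ioi 0) := by
      simp only [radialCoeff_coulomb]
      refine ContinuousOn.mul (Complex.continuous_ofReal.comp_continuousOn ?_)
        hsol.fst.continuousOn
      refine ContinuousOn.sub (ContinuousOn.add ?_ ?_) continuousOn_const
      · exact ContinuousOn.div (by fun_prop) (by fun_prop) fun r hr => pow_ne_zero 2 (ne_of_gt hr)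
      · exact ContinuousOn.div (by fun_prop) (by fun_prop) fun r hr => ne_of_gt hr
    have h1 := (hsol.snd.hasDerivAt hcont hr).const_mul c
    refine (h1.congr_of_eventuallyEq ?_).congr_deriv ?_
    · filter_upwards [lt_mem_nhds hr] with s hs using hd' s hs
    · rw [radialCoeff_coulomb]
      ring
  · have h1 := (coulombWave_asymptotics hk α ℓ).1.const_mul_left c
    refine h1.congr' ?_ EventuallyEq.rfl
    filter_upwards [eventually_gt_atTop 0] with r hr
    rw [mul_sub, ← hg, ← hz]
    congr 1
    have e : c * (g * z * Complex.exp (Complex.I *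
        ((k * r - α / (2 * k) * Real.log r : ℝ) : ℂ))) = Complex.exp (Complex.I * θ) *
        Complex.exp (Complex.I * ((k * r - α / (2 * k) * Real.log r : ℝ) : ℂ)) := by
      rw [hc]
      field_simp
    rw [e, ← Complex.exp_add, ← mul_add, ← Complex.ofReal_add, coulombPhase,
      Real.log_mul (by positivity) hr.ne', hθ, ← hg]
    congr 3
    ring

/-- All outgoing Coulomb functions are multiples of `coulombWave`. -/
theorem IsOutgoingCoulomb.eq_const_mul (hk : 0 < k) {H : ℝ → ℂ} (h : IsOutgoingCoulomb α k ℓ H) :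
    ∃ c : ℂ, ∀ r, 0 < r → H r = c * coulombWave α k ℓ r := by
  obtain ⟨c, hc0, hH₀⟩ := exists_isOutgoingCoulomb hk α ℓ
  have hy := isSolution_coulombWave hk (isAdmissible_ofReal α) ℓ
  have hyc := isSolution_conj_coulombWave hk α ℓ
  have hD := h.isSolution.sub (hy.const_mul c)
  have hDO : (fun r => H r - c * coulombWave α k ℓ r) =O[atTop] (fun r : ℝ => 1 / r) :=
    (h.asymptotics.sub hH₀.asymptotics).congr_left fun r => by ring
  have hM : ∀ᶠ r in atTop, ‖radialCoeff (fun r => ((α / r : ℝ) : ℂ)) ℓ ((k : ℂ) ^ 2) r‖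
      ≤ ℓ * (ℓ + 1) + |α| + k ^ 2 := by
    filter_upwards [eventually_ge_atTop 1] with r hr
    rw [radialCoeff_coulomb, Complex.norm_real, Real.norm_eq_abs]
    refine (abs_sub _ _).trans (add_le_add ((abs_add_le _ _).trans (add_le_add ?_ ?_)) ?_)
    · rw [abs_of_nonneg (by positivity)]
      exact div_le_self (by positivity) (one_le_pow₀ hr)
    · rw [abs_div, abs_of_pos (by linarith : 0 < r)]
      exact div_le_self (abs_nonneg _) hr
    · rw [abs_of_nonneg (by positivity)]
  have hDO' := hD.deriv_isBigO hM hDO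
  have h1 : Tendsto (fun r : ℝ => 1 / r) atTop (𝓝 0) := tendsto_const_nhds.div_atTop tendsto_id
  obtain ⟨b, -, hb⟩ := tendsto_norm_coulombWave hk α ℓ
  have hyO : (fun r => coulombWave α k ℓ r) =O[atTop] (fun _ : ℝ => (1 : ℝ)) :=
    (isBigO_norm_left.mp (hb.isBigO_one ℝ))
  have hyO' : (fun r => coulombWaveDeriv α k ℓ r) =O[atTop] (fun _ : ℝ => (1 : ℝ)) := by
    have h2 := ((coulombWave_asymptotics hk α ℓ).2.trans (h1.isBigO_one ℝ)).add
      (hyO.const_mul_left (Complex.I * k))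
    simpa using h2
  have hW := (hDO'.mul hyO).sub (hDO.mul hyO')
  simp only [mul_one] at hW
  have hW0 := hW.trans_tendsto h1
  have hW1 := tendsto_nhds_unique hW0 (tendsto_const_nhds.congr' (by
    filter_upwards [eventually_gt_atTop 0] with r hr
    exact hD.wronskian_const hy one_pos hr))
  obtain ⟨d, hd⟩ : ∃ d, ∀ r, 0 < r → H r - c * coulombWave α k ℓ r = d * coulombWave α k ℓ r :=
    ⟨_, fun r hr => hD.eq_const_mul hy hyc hW1.symm
      (coulombWave_wronskian_conj_ne_zero hk α ℓ) hr⟩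
  exact ⟨c + d, fun r hr => by linear_combination hd r hr⟩

end Coulomb

/-! ### Radial functions times a solid harmonic in three dimensions -/

/-- The isotropic vector `(1, i, 0)`. -/
def isotropic : Fin 3 → ℂ := ![1, Complex.I, 0]

/-- The linear form `x₀ + i x₁`, whose powers are solid harmonics. -/
def isotropicForm (x : Space) : ℂ := ∑ j, isotropic j * x j

/-- The vectors of the standard basis of `ℝ³`. -/
def stdVec (i : Fin 3) : Space := EuclideanSpace.single i 1

theorem isotropicForm_add_smul (x : Space) (t : ℝ) (i : Fin 3) :
    isotropicForm (x + t • stdVec i) = isotropicForm x + t * isotropic i := by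
  simp only [isotropicForm, stdVec, PiLp.add_apply, PiLp.smul_apply,
    PiLp.single_apply, smul_eq_mul]
  push_cast
  simp only [mul_add, Finset.sum_add_distrib]
  congr 1
  rw [Finset.sum_eq_single i]
  · simp; ring
  · intro j _ hj
    simp [hj]
  · simp

theorem norm_sq_add_smul (x : Space) (t : ℝ) (i : Fin 3) :
    ‖x + t • stdVec i‖ ^ 2 = ‖x‖ ^ 2 + 2 * t * x i + t ^ 2 := by
  rw [norm_add_sq_real, norm_smul, inner_smul_right]
  simp [stdVec, EuclideanSpace.inner_single_right]
  ring

theorem continuous_isotropicForm : Continuous isotropicForm := by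
  unfold isotropicForm
  fun_prop

theorem contDiff_isotropicForm {n : WithTop ℕ∞} : ContDiff ℝ n isotropicForm := by
  unfold isotropicForm
  refine ContDiff.sum fun i _ => contDiff_const.mul ?_
  exact Complex.ofRealCLM.contDiff.comp (by fun_prop)

theorem hasLineDerivAt_isotropicForm_pow_mul {g g' : ℝ → ℂ} (hg : ∀ N, HasDerivAt g (g' N) N)
    (n : ℕ) (x : Space) (i : Fin 3) :
    HasLineDerivAt ℝ (fun x => isotropicForm x ^ n * g (‖x‖ ^ 2))
      (n * isotropicForm x ^ (n - 1) * isotropic i * g (‖x‖ ^ 2)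
        + isotropicForm x ^ n * (2 * x i * g' (‖x‖ ^ 2))) x (stdVec i) := by
  rw [HasLineDerivAt]
  simp only [isotropicForm_add_smul, norm_sq_add_smul]
  have d1 : HasDerivAt (fun t : ℝ => isotropicForm x + t * isotropic i) (isotropic i) 0 := by
    have := ((hasDerivAt_id ((0 : ℝ) : ℂ)).comp_ofReal.mul_const (isotropic i)).const_add
      (isotropicForm x)
    simpa using this
  have d2 : HasDerivAt (fun t : ℝ => ‖x‖ ^ 2 + 2 * t * x i + t ^ 2) (2 * x i) 0 := by
    have := ((((hasDerivAt_id (0 : ℝ)).const_mul 2).mul_const (x i)).const_add (‖x‖ ^ 2)).add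
      (hasDerivAt_pow 2 (0 : ℝ))
    refine this.congr_deriv ?_
    simp
  have e : ‖x‖ ^ 2 + 2 * 0 * x i + 0 ^ 2 = ‖x‖ ^ 2 := by ring
  have d3 : HasDerivAt g (g' (‖x‖ ^ 2)) (‖x‖ ^ 2 + 2 * 0 * x i + 0 ^ 2) := by
    rw [e]
    exact hg _
  have d4 := (d1.pow n).mul (d3.scomp (0 : ℝ) d2)
  refine d4.congr_deriv ?_
  simp only [Function.comp, Pi.pow_apply, e, Complex.ofReal_zero, zero_mul, add_zero, Complex.real_smul]
  push_cast
  ring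

theorem hasLineDerivAt_coord (x : Space) (i : Fin 3) :
    HasLineDerivAt ℝ (fun x : Space => (x i : ℂ)) 1 x (stdVec i) := by
  rw [HasLineDerivAt]
  have : ∀ t : ℝ, (((x + t • stdVec i) i : ℝ) : ℂ) = x i + t := fun t => by simp [stdVec]
  simp only [this]
  simpa using (hasDerivAt_id ((0 : ℝ) : ℂ)).comp_ofReal.const_add (x i : ℂ)

/-- The second derivative along a coordinate axis of a solid harmonic times a radial function. -/
theorem hasLineDerivAt_deriv_isotropicForm_pow_mul {g g' g'' : ℝ → ℂ}
    (hg : ∀ N, HasDerivAt g (g' N) N) (hg' : ∀ N, HasDerivAt g' (g'' N) N)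
    (n : ℕ) (x : Space) (i : Fin 3) :
    HasLineDerivAt ℝ (fun x => n * isotropicForm x ^ (n - 1) * isotropic i * g (‖x‖ ^ 2)
        + isotropicForm x ^ n * (2 * x i * g' (‖x‖ ^ 2)))
      (n * isotropic i * (((n - 1 : ℕ) : ℂ) * isotropicForm x ^ (n - 1 - 1) * isotropic i
          * g (‖x‖ ^ 2) + isotropicForm x ^ (n - 1) * (2 * x i * g' (‖x‖ ^ 2)))
        + (2 * (isotropicForm x ^ n * g' (‖x‖ ^ 2)) + 2 * x i *
          (n * isotropicForm x ^ (n - 1) * isotropic i * g' (‖x‖ ^ 2)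
            + isotropicForm x ^ n * (2 * x i * g'' (‖x‖ ^ 2))))) x (stdVec i) := by
  have h1 := hasLineDerivAt_isotropicForm_pow_mul hg (n - 1) x i
  have h2 := hasLineDerivAt_isotropicForm_pow_mul hg' n x i
  have h3 := hasLineDerivAt_coord x i
  rw [HasLineDerivAt] at h1 h2 h3 ⊢
  have h4 := (h1.const_mul (n * isotropic i)).add ((h3.const_mul 2).mul h2)
  refine (h4.congr_of_eventuallyEq (Eventually.of_forall fun t => ?_)).congr_deriv ?_
  · simp only [Pi.add_apply, Pi.mul_apply]
    ring
  · simp only [zero_smul, add_zero]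
    ring

theorem laplacian_eq_sum_fderiv {f : Space → ℂ} (hf : ContDiff ℝ 2 f) (x : Space) :
    (Δ f) x = ∑ i, fderiv ℝ (fun y => fderiv ℝ f y (stdVec i)) x (stdVec i) := by
  rw [InnerProductSpace.laplacian_eq_iteratedFDeriv_orthonormalBasis f
    (EuclideanSpace.basisFun (Fin 3) ℝ)]
  simp only [iteratedFDeriv_two_apply]
  refine Finset.sum_congr rfl fun i _ => ?_
  have h1 : DifferentiableAt ℝ (fderiv ℝ f) x :=
    ((hf.fderiv_right (m := 1) (by norm_num)).differentiable (by norm_num)) x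
  have h2 := (h1.hasFDerivAt.clm_apply (hasFDerivAt_const (stdVec i) x)).fderiv
  rw [h2]
  simp [stdVec]

/-- Green's second identity for `u = S p`, with `S` a solid harmonic of degree `n` and
`p(x) = g(|x|²)` radial, against a test function. -/
theorem integral_solid_mul_laplacian_of_hasDerivAt {g g' g'' : ℝ → ℂ}
    (hg : ∀ N, HasDerivAt g (g' N) N) (hg' : ∀ N, HasDerivAt g' (g'' N) N)
    (hg'' : Continuous g'') (n : ℕ) (η : SpaceTest) :
    ∫ x : Space, isotropicForm x ^ n * g (‖x‖ ^ 2) * (Δ (η : Space → ℂ)) x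
      = ∫ x : Space, isotropicForm x ^ n *
        ((4 * n + 6) * g' (‖x‖ ^ 2) + 4 * ((‖x‖ ^ 2 : ℝ) : ℂ) * g'' (‖x‖ ^ 2)) * η x := by
  have hη : ContDiff ℝ (⊤ : ℕ∞) (η : Space → ℂ) := η.contDiff
  have hηs := η.hasCompactSupport
  have hz := continuous_isotropicForm
  have cg : Continuous g := continuous_iff_continuousAt.mpr fun N => (hg N).continuousAt
  have cg' : Continuous g' := continuous_iff_continuousAt.mpr fun N => (hg' N).continuousAt
  set u : Space → ℂ := fun x => isotropicForm x ^ n * g (‖x‖ ^ 2) with hu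
  set u₁ : Fin 3 → Space → ℂ := fun i x => n * isotropicForm x ^ (n - 1) * isotropic i *
    g (‖x‖ ^ 2) + isotropicForm x ^ n * (2 * x i * g' (‖x‖ ^ 2)) with hu₁
  set u₂ : Fin 3 → Space → ℂ := fun i x => (n * isotropic i * (((n - 1 : ℕ) : ℂ) *
          isotropicForm x ^ (n - 1 - 1) * isotropic i
          * g (‖x‖ ^ 2) + isotropicForm x ^ (n - 1) * (2 * x i * g' (‖x‖ ^ 2)))
        + (2 * (isotropicForm x ^ n * g' (‖x‖ ^ 2)) + 2 * x i *
          (n * isotropicForm x ^ (n - 1) * isotropic i * g' (‖x‖ ^ 2)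
            + isotropicForm x ^ n * (2 * x i * g'' (‖x‖ ^ 2))))) with hu₂
  have cu : Continuous u := by rw [hu]; fun_prop
  have cu₁ : ∀ i, Continuous (u₁ i) := fun i => by rw [hu₁]; fun_prop
  have cu₂ : ∀ i, Continuous (u₂ i) := fun i => by rw [hu₂]; fun_prop
  set η₁ : Fin 3 → Space → ℂ := fun i y => fderiv ℝ η y (stdVec i) with hη₁
  have sη₁ : ∀ i, ContDiff ℝ (⊤ : ℕ∞) (η₁ i) := fun i =>
    (hη.fderiv_right (m := (⊤ : ℕ∞)) (by simp)).clm_apply contDiff_const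
  have kη₁ : ∀ i, HasCompactSupport (η₁ i) := fun i => hηs.fderiv_apply ℝ _
  set η₂ : Fin 3 → Space → ℂ := fun i y => fderiv ℝ (η₁ i) y (stdVec i) with hη₂
  have sη₂ : ∀ i, Continuous (η₂ i) := fun i =>
    ((sη₁ i).continuous_fderiv (by simp)).clm_apply continuous_const
  have kη₂ : ∀ i, HasCompactSupport (η₂ i) := fun i => (kη₁ i).fderiv_apply ℝ _
  have int : ∀ {f h : Space → ℂ}, Continuous f → Continuous h → HasCompactSupport h →
      Integrable (fun x => f x * h x) := fun hf hh hk =>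
    (hf.mul hh).integrable_of_hasCompactSupport hk.mul_left
  have step : ∀ i, ∫ x, u x * η₂ i x = ∫ x, u₂ i x * η x := by
    intro i
    have h1 := integral_bilinear_hasLineDerivAt_right_eq_neg_left_of_integrable
      (μ := (volume : Measure Space))
      (B := ContinuousLinearMap.mul ℝ ℂ) (f := u) (f' := u₁ i) (g := η₁ i) (g' := η₂ i)
      (v := stdVec i) (int (cu₁ i) (sη₁ i).continuous (kη₁ i)) (int cu (sη₂ i) (kη₂ i))
      (int cu (sη₁ i).continuous (kη₁ i))
      (fun x _ => hasLineDerivAt_isotropicForm_pow_mul hg n x i)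
      (fun x _ => (((sη₁ i).differentiable (by simp)) x).hasFDerivAt.hasLineDerivAt _)
    have h2 := integral_bilinear_hasLineDerivAt_right_eq_neg_left_of_integrable
      (μ := (volume : Measure Space))
      (B := ContinuousLinearMap.mul ℝ ℂ) (f := u₁ i) (f' := u₂ i) (g := η) (g' := η₁ i)
      (v := stdVec i) (int (cu₂ i) η.continuous hηs) (int (cu₁ i) (sη₁ i).continuous (kη₁ i))
      (int (cu₁ i) η.continuous hηs)
      (fun x _ => hasLineDerivAt_deriv_isotropicForm_pow_mul hg hg' n x i)
      (fun x _ => ((hη.differentiable (by simp)) x).hasFDerivAt.hasLineDerivAt _)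
    simp only [ContinuousLinearMap.mul_apply'] at h1 h2
    rw [h1, h2, neg_neg]
  have hη2 : ContDiff ℝ 2 (η : Space → ℂ) := contDiff_infty.mp hη 2
  simp only [laplacian_eq_sum_fderiv hη2, Finset.mul_sum]
  rw [integral_finsetSum _ fun i _ => int cu (sη₂ i) (kη₂ i), Finset.sum_congr rfl
    fun i _ => step i, ← integral_finsetSum _ fun i _ => int (cu₂ i) η.continuous hηs]
  refine integral_congr_ae (Eventually.of_forall fun x => ?_)
  simp only
  rw [← Finset.sum_mul]
  congr 1
  -- `(1, i, 0)` is isotropic, so the terms without derivatives of `g` cancel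
  have hN : (‖x‖ : ℂ) ^ 2 = (x 0 : ℂ) ^ 2 + (x 1 : ℂ) ^ 2 + (x 2 : ℂ) ^ 2 := by
    rw [← Complex.ofReal_pow, EuclideanSpace.norm_sq_eq]
    simp [Fin.sum_univ_three]
  have hzz : isotropicForm x = x 0 + Complex.I * x 1 := by
    simp [isotropicForm, isotropic, Fin.sum_univ_three]
  have hpow : (n : ℂ) * isotropicForm x ^ (n - 1) * isotropicForm x
      = n * isotropicForm x ^ n := by
    rcases n with _ | n
    · simp
    · rw [Nat.add_sub_cancel, pow_succ]; ring
  have hI := Complex.I_sq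
  have i0 : isotropic 0 = 1 := rfl
  have i1 : isotropic 1 = Complex.I := rfl
  have i2 : isotropic 2 = 0 := rfl
  simp only [hu₂, Fin.sum_univ_three, i0, i1, i2]
  push_cast
  rw [hN]
  set G := g (‖x‖ ^ 2)
  set G' := g' (‖x‖ ^ 2)
  set G'' := g'' (‖x‖ ^ 2)
  rw [hzz] at hpow ⊢
  set w : ℂ := (x 0 : ℂ) + Complex.I * x 1 with hw
  linear_combination (n * ((n - 1 : ℕ) : ℂ) * w ^ (n - 1 - 1) * G) * hI + 4 * G' * hpow

/-- The derivative of `radialPrimitive m Q`. -/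
def radialFlux (m : ℕ) (Q : ℝ → ℂ) (t : ℝ) : ℂ :=
  ((t : ℂ) ^ m)⁻¹ * ∫ s in (0 : ℝ)..t, (s : ℂ) ^ m * Q s

/-- The solution `P` of `r^{-m} (r^m P')' = Q` with `P(0) = 0` and `r^m P' → 0` at the origin. -/
def radialPrimitive (m : ℕ) (Q : ℝ → ℂ) (r : ℝ) : ℂ := ∫ t in (0 : ℝ)..r, radialFlux m Q t

section Smooth

variable {m : ℕ} {Q : ℝ → ℂ} {a : ℝ}

theorem integral_pow_mul_eq_zero (h0 : ∀ r, r ≤ a → Q r = 0) (ha : 0 < a) {t : ℝ} (ht : t ≤ a) :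
    ∫ s in (0 : ℝ)..t, (s : ℂ) ^ m * Q s = 0 := by
  rw [intervalIntegral.integral_congr (g := fun _ => (0 : ℂ)), intervalIntegral.integral_zero]
  intro s hs
  have : s ≤ a := hs.2.trans (max_le ha.le ht)
  simp [h0 s this]

theorem radialFlux_eq_zero (h0 : ∀ r, r ≤ a → Q r = 0) (ha : 0 < a) {t : ℝ} (ht : t ≤ a) :
    radialFlux m Q t = 0 := by
  rw [radialFlux, integral_pow_mul_eq_zero h0 ha ht, mul_zero]

theorem radialPrimitive_eq_zero (h0 : ∀ r, r ≤ a → Q r = 0) (ha : 0 < a) {t : ℝ} (ht : t ≤ a) :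
    radialPrimitive m Q t = 0 := by
  rw [radialPrimitive, intervalIntegral.integral_congr (g := fun _ => (0 : ℂ)),
    intervalIntegral.integral_zero]
  intro s hs
  exact radialFlux_eq_zero h0 ha (hs.2.trans (max_le ha.le ht))

theorem hasDerivAt_radialFlux (hQ : Continuous Q) {t : ℝ} (ht : 0 < t) :
    HasDerivAt (radialFlux m Q) (Q t - m / t * radialFlux m Q t) t := by
  have ht0 : (t : ℂ) ≠ 0 := by exact_mod_cast ht.ne'
  have hc : Continuous fun s : ℝ => (s : ℂ) ^ m * Q s := by fun_prop
  have d1 := hc.integral_hasStrictDerivAt 0 t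
  have d2 := (((hasDerivAt_id (t : ℂ)).pow m).inv (pow_ne_zero m ht0)).comp_ofReal
  refine (d2.mul d1.hasDerivAt).congr_deriv ?_
  simp only [radialFlux, id, Pi.pow_apply, Pi.inv_apply]
  rcases m with _ | n
  · simp
  · simp only [Nat.add_sub_cancel, pow_succ]
    field_simp
    ring

theorem continuous_radialFlux (hQ : Continuous Q) (h0 : ∀ r, r ≤ a → Q r = 0) (ha : 0 < a) :
    Continuous (radialFlux m Q) := by
  rw [continuous_iff_continuousAt]
  intro t
  rcases lt_or_ge t a with h | h
  · refine (continuousAt_const (y := (0 : ℂ))).congr ?_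
    filter_upwards [gt_mem_nhds h] with s hs
    exact (radialFlux_eq_zero h0 ha hs.le).symm
  · exact (hasDerivAt_radialFlux hQ (ha.trans_le h)).continuousAt

/-- Green's identity against a test function for a continuous radial source that vanishes near the
origin. -/
theorem integral_solid_mul_laplacian_of_continuous (hQ : Continuous Q)
    (h0 : ∀ r, r ≤ a → Q r = 0) (ha : 0 < a) (n : ℕ) (c : ℂ) (η : SpaceTest) :
    ∫ x : Space, isotropicForm x ^ n * (c + radialPrimitive (2 * n + 2) Q ‖x‖)
        * (Δ (η : Space → ℂ)) x
      = ∫ x : Space, isotropicForm x ^ n * Q ‖x‖ * η x := by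
  set P₁ := radialFlux (2 * n + 2) Q with hP₁
  set P : ℝ → ℂ := fun r => c + radialPrimitive (2 * n + 2) Q r with hP
  have cP₁ : Continuous P₁ := continuous_radialFlux hQ h0 ha
  have z₁ : ∀ t, t ≤ a → P₁ t = 0 := fun t ht => radialFlux_eq_zero h0 ha ht
  have zP : ∀ t, t ≤ a → P t = c := fun t ht => by
    simp only [hP, radialPrimitive_eq_zero h0 ha ht, add_zero]
  have dP : ∀ t, HasDerivAt P (P₁ t) t := fun t =>
    ((cP₁.integral_hasStrictDerivAt 0 t).hasDerivAt).const_add c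
  set g : ℝ → ℂ := fun N => P (√N) with hg
  set g' : ℝ → ℂ := fun N => P₁ (√N) / (2 * √N) with hg'
  set g'' : ℝ → ℂ := fun N =>
    (Q (√N) - (2 * n + 3) / √N * P₁ (√N)) / (4 * (√N : ℂ) ^ 2) with hg''
  have hsmall : ∀ N : ℝ, N ≤ 0 → ∀ᶠ M in 𝓝 N, √M ≤ a := by
    intro N hN
    filter_upwards [gt_mem_nhds (lt_of_le_of_lt hN (by positivity : 0 < a ^ 2))] with M hM
    exact Real.sqrt_le_iff.mpr ⟨ha.le, hM.le⟩
  have dg : ∀ N, HasDerivAt g (g' N) N := by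
    intro N
    rcases le_or_gt N 0 with hN | hN
    · have e : g' N = 0 := by simp [hg', z₁ _ (hsmall N hN).self_of_nhds]
      rw [e]
      refine (hasDerivAt_const N c).congr_of_eventuallyEq ?_
      filter_upwards [hsmall N hN] with M hM using zP _ hM
    · refine ((dP (√N)).scomp N (Real.hasDerivAt_sqrt hN.ne')).congr_deriv ?_
      rw [Complex.real_smul, hg']
      push_cast
      ring
  have dg' : ∀ N, HasDerivAt g' (g'' N) N := by
    intro N
    rcases le_or_gt N 0 with hN | hN
    · have h1 := (hsmall N hN).self_of_nhds
      have e : g'' N = 0 := by simp [hg'', z₁ _ h1, h0 _ h1]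
      rw [e]
      refine (hasDerivAt_const N (0 : ℂ)).congr_of_eventuallyEq ?_
      filter_upwards [hsmall N hN] with M hM
      simp [hg', z₁ _ hM]
    · have hs : 0 < √N := Real.sqrt_pos.mpr hN
      have hs0 : ((√N : ℝ) : ℂ) ≠ 0 := by exact_mod_cast hs.ne'
      have d1 := hasDerivAt_radialFlux (m := 2 * n + 2) hQ hs
      have d2 : HasDerivAt (fun r : ℝ => 2 * (r : ℂ)) (2 * 1) (√N) :=
        (hasDerivAt_id ((√N : ℝ) : ℂ)).comp_ofReal.const_mul 2
      refine ((d1.div d2 (by simpa using hs0)).scomp N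
        (Real.hasDerivAt_sqrt hN.ne')).congr_deriv ?_
      rw [Complex.real_smul, hg'']
      simp only
      rw [← hP₁]
      push_cast
      field_simp
      ring
  have cg'' : Continuous g'' := by
    rw [continuous_iff_continuousAt]
    intro N
    rcases le_or_gt N 0 with hN | hN
    · refine (continuousAt_const (y := (0 : ℂ))).congr ?_
      filter_upwards [hsmall N hN] with M hM
      simp [hg'', z₁ _ hM, h0 _ hM]
    · have hs0 : ((√N : ℝ) : ℂ) ≠ 0 := by exact_mod_cast (Real.sqrt_pos.mpr hN).ne'
      have c1 : ContinuousAt (fun N : ℝ => ((√N : ℝ) : ℂ)) N := by fun_prop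
      refine ContinuousAt.div (ContinuousAt.sub (by fun_prop) (ContinuousAt.mul
        (continuousAt_const.div c1 hs0) (by fun_prop))) (by fun_prop) ?_
      simpa using hs0
  have key := integral_solid_mul_laplacian_of_hasDerivAt dg dg' cg'' n η
  have e1 : ∀ x : Space, g (‖x‖ ^ 2) = P ‖x‖ := fun x => by
    simp only [hg, Real.sqrt_sq (norm_nonneg x)]
  simp only [e1] at key
  rw [key]
  refine integral_congr_ae ?_
  have hne : ∀ᵐ x : Space, x ≠ 0 := by simp [ae_iff]
  filter_upwards [hne] with x hx
  have hx0 : (‖x‖ : ℂ) ≠ 0 := by exact_mod_cast norm_ne_zero_iff.mpr hx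
  congr 2
  simp only [hg', hg'', Real.sqrt_sq (norm_nonneg x)]
  push_cast
  field_simp
  ring

end Smooth

/-! ### Approximation of rough radial sources -/

/-- Continuous functions vanishing near the origin are dense in `L¹(0, X)`. They serve to pass from
classical solutions to solutions with a merely bounded potential. -/
theorem exists_continuous_approx {Q : ℝ → ℂ} {X : ℝ} (hX : 0 < X)
    (hQ : IntegrableOn Q (Set.Ioc 0 X)) {ε : ℝ} (hε : 0 < ε) :
    ∃ (Q' : ℝ → ℂ) (a : ℝ), 0 < a ∧ Continuous Q' ∧ (∀ r, r ≤ a → Q' r = 0) ∧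
      ∫ r in (0 : ℝ)..X, ‖Q r - Q' r‖ ≤ ε := by
  have hQ' : IntervalIntegrable Q volume 0 X :=
    (intervalIntegrable_iff_integrableOn_Ioc_of_le hX.le).mpr hQ
  -- first discard a small neighbourhood of the origin
  obtain ⟨a, ha, haX, hsmall⟩ : ∃ a : ℝ, 0 < a ∧ 2 * a < X ∧
      ∫ r in (0 : ℝ)..(2 * a), ‖Q r‖ ≤ ε / 2 := by
    have h1 := intervalIntegral.continuousOn_primitive_interval' hQ'.norm Set.left_mem_uIcc
    rw [Set.uIcc_of_le hX.le] at h1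
    have h2 := h1 0 (Set.left_mem_Icc.mpr hX.le)
    have h3 : Tendsto (fun b => ∫ r in (0 : ℝ)..b, ‖Q r‖) (𝓝[>] 0) (𝓝 0) := by
      have := h2.mono_left (nhdsWithin_le_of_mem (mem_of_superset (Ioc_mem_nhdsGT hX)
          Set.Ioc_subset_Icc_self))
      simpa using this
    have h4 : ∀ᶠ b in 𝓝[>] (0 : ℝ), b ∈ Set.Ioo 0 X := Ioo_mem_nhdsGT hX
    obtain ⟨b, hb, hbX⟩ := ((h3.eventually_lt_const (half_pos hε)).and h4).exists
    have hb2 : 2 * (b / 2) < X := by linarith [hbX.2]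
    refine ⟨b / 2, half_pos hbX.1, hb2, ?_⟩
    rw [mul_div_cancel₀ _ two_ne_zero]
    exact hb.le
  set Q₁ : ℝ → ℂ := Set.indicator (Set.Ioc (2 * a) X) Q with hQ₁
  have hsub : Set.Ioc (2 * a) X ⊆ Set.Ioc 0 X := Set.Ioc_subset_Ioc_left (by linarith)
  have iQ₁ : Integrable Q₁ := (hQ.mono_set hsub).integrable_indicator measurableSet_Ioc
  obtain ⟨q, hqc, hqi, hq, hqint⟩ := iQ₁.exists_hasCompactSupport_integral_sub_le (half_pos hε)
  set χ : ℝ → ℝ := fun r => min 1 (max 0 (r / a - 1)) with hχ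
  have cχ : Continuous χ := by rw [hχ]; fun_prop
  have χ0 : ∀ r, 0 ≤ χ r := fun r => le_min zero_le_one (le_max_left _ _)
  have χ1 : ∀ r, χ r ≤ 1 := fun r => min_le_left _ _
  refine ⟨fun r => χ r * q r, a, ha, by fun_prop, fun r hr => ?_, ?_⟩
  · have : r / a - 1 ≤ 0 := by
      rw [sub_nonpos, div_le_one ha]
      exact hr
    simp [hχ, max_eq_left this]
  · have hle : ∀ r ∈ Set.Ioc 0 X, ‖Q r - χ r * q r‖
        ≤ Set.indicator (Set.Ioc 0 (2 * a)) (fun r => ‖Q r‖) r + ‖Q₁ r - q r‖ := by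
      intro r hr
      rcases le_or_gt r (2 * a) with h | h
      · have e1 : Q₁ r = 0 := Set.indicator_of_notMem (fun h' => absurd h'.1 (not_lt.mpr h)) _
        have e2 : Set.indicator (Set.Ioc 0 (2 * a)) (fun r => ‖Q r‖) r = ‖Q r‖ :=
          Set.indicator_of_mem (s := Set.Ioc 0 (2 * a)) ⟨hr.1, h⟩ _
        rw [e1, e2, zero_sub, norm_neg]
        refine (norm_sub_le _ _).trans ?_
        gcongr
        rw [norm_mul, Complex.norm_real, Real.norm_eq_abs, abs_of_nonneg (χ0 r)]
        exact mul_le_of_le_one_left (norm_nonneg _) (χ1 r)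
      · have e1 : Q₁ r = Q r := Set.indicator_of_mem (s := Set.Ioc (2 * a) X) ⟨h, hr.2⟩ _
        have e3 : χ r = 1 := by
          have : 1 ≤ r / a - 1 := by
            rw [le_sub_iff_add_le, le_div_iff₀ ha]
            linarith
          simp [hχ, this]
        rw [e1, e3, Complex.ofReal_one, one_mul]
        exact le_add_of_nonneg_left (Set.indicator_nonneg (fun _ _ => norm_nonneg _) _)
    have i1 : IntegrableOn (Set.indicator (Set.Ioc 0 (2 * a)) (fun r => ‖Q r‖)) (Set.Ioc 0 X) :=
      hQ.norm.indicator measurableSet_Ioc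
    have i2 : Integrable (fun r => ‖Q₁ r - q r‖) := (iQ₁.sub hqint).norm
    rw [intervalIntegral.integral_of_le hX.le]
    calc ∫ r in Set.Ioc 0 X, ‖Q r - χ r * q r‖
        ≤ ∫ r in Set.Ioc 0 X, (Set.indicator (Set.Ioc 0 (2 * a)) (fun r => ‖Q r‖) r
            + ‖Q₁ r - q r‖) := by
          refine setIntegral_mono_on ?_ (i1.add i2.integrableOn) measurableSet_Ioc hle
          refine (hQ.sub ?_).norm
          exact ((by fun_prop : Continuous fun r => (χ r : ℂ) * q r).integrableOn_Icc).mono_set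
            Set.Ioc_subset_Icc_self
      _ ≤ ε / 2 + ε / 2 := by
          rw [integral_add i1 i2.integrableOn]
          refine add_le_add ?_ ?_
          · rw [setIntegral_indicator measurableSet_Ioc, Set.Ioc_inter_Ioc, max_self,
              min_eq_right haX.le, ← intervalIntegral.integral_of_le (by linarith)]
            exact hsmall
          · refine (setIntegral_le_integral i2 (Eventually.of_forall fun _ => norm_nonneg _)).trans
              hqi
      _ = ε := by ring

theorem norm_radialFlux_le {m : ℕ} {Q : ℝ → ℂ} {X : ℝ} (hQ : IntegrableOn Q (Set.Ioc 0 X)) {t : ℝ}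
    (ht : t ∈ Set.Ioc 0 X) : ‖radialFlux m Q t‖ ≤ ∫ r in (0 : ℝ)..X, ‖Q r‖ := by
  have h0 := ht.1
  have hX : 0 ≤ X := h0.le.trans ht.2
  have hQt : IntegrableOn Q (Set.Ioc 0 t) := hQ.mono_set (Set.Ioc_subset_Ioc_right ht.2)
  have h1 : ‖∫ s in (0 : ℝ)..t, (s : ℂ) ^ m * Q s‖ ≤ ∫ s in (0 : ℝ)..t, t ^ m * ‖Q s‖ := by
    refine intervalIntegral.norm_integral_le_of_norm_le h0.le ?_ ?_
    · filter_upwards with s hs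
      rw [norm_mul, norm_pow, Complex.norm_real, Real.norm_eq_abs, abs_of_pos hs.1]
      gcongr
      · exact hs.1.le
      · exact hs.2
    · exact ((intervalIntegrable_iff_integrableOn_Ioc_of_le h0.le).mpr hQt).norm.const_mul _
  rw [intervalIntegral.integral_const_mul] at h1
  rw [radialFlux, norm_mul, norm_inv, norm_pow, Complex.norm_real, Real.norm_eq_abs, abs_of_pos h0,
    inv_mul_le_iff₀ (by positivity)]
  refine h1.trans ?_
  gcongr
  rw [intervalIntegral.integral_of_le h0.le, intervalIntegral.integral_of_le hX]
  exact setIntegral_mono_set hQ.norm (Eventually.of_forall fun _ => norm_nonneg _)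
    (Set.Ioc_subset_Ioc_right ht.2).eventuallyLE

theorem integrableOn_radialFlux {m : ℕ} {Q : ℝ → ℂ} {X : ℝ} (hQ : IntegrableOn Q (Set.Ioc 0 X)) :
    IntegrableOn (radialFlux m Q) (Set.Ioc 0 X) := by
  rcases le_or_gt X 0 with hX | hX
  · simp [Set.Ioc_eq_empty (not_lt.mpr hX)]
  refine IntegrableOn.of_bound (C := ∫ r in (0 : ℝ)..X, ‖Q r‖) (by simp) ?_ ?_
  · refine ContinuousOn.aestronglyMeasurable (ContinuousOn.mul (ContinuousOn.inv₀ (by fun_prop)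
      fun t ht => pow_ne_zero _ (by exact_mod_cast ht.1.ne')) ?_) measurableSet_Ioc
    have h1 : IntervalIntegrable (fun s : ℝ => (s : ℂ) ^ m * Q s) volume 0 X :=
      ((intervalIntegrable_iff_integrableOn_Ioc_of_le hX.le).mpr hQ).continuousOn_mul (by fun_prop)
    have := intervalIntegral.continuousOn_primitive_interval' h1 Set.left_mem_uIcc
    rw [Set.uIcc_of_le hX.le] at this
    exact this.mono Set.Ioc_subset_Icc_self
  · filter_upwards [self_mem_ae_restrict measurableSet_Ioc] with t ht using norm_radialFlux_le hQ ht

theorem norm_radialPrimitive_le {m : ℕ} {Q : ℝ → ℂ} {X : ℝ} (hQ : IntegrableOn Q (Set.Ioc 0 X))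
    {r : ℝ} (hr : r ∈ Set.Icc 0 X) :
    ‖radialPrimitive m Q r‖ ≤ X * ∫ r in (0 : ℝ)..X, ‖Q r‖ := by
  have h1 := intervalIntegral.norm_integral_le_of_norm_le_const (a := 0) (b := r)
    (f := radialFlux m Q) (C := ∫ r in (0 : ℝ)..X, ‖Q r‖) (fun t ht => by
      rw [Set.uIoc_of_le hr.1] at ht
      exact norm_radialFlux_le hQ ⟨ht.1, ht.2.trans hr.2⟩)
  rw [sub_zero, abs_of_nonneg hr.1, mul_comm] at h1
  refine h1.trans ?_
  have h2 : 0 ≤ ∫ r in (0 : ℝ)..X, ‖Q r‖ :=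
    intervalIntegral.integral_nonneg (hr.1.trans hr.2) fun _ _ => norm_nonneg _
  gcongr
  exact hr.2

theorem radialPrimitive_sub {m : ℕ} {Q Q' : ℝ → ℂ} {X : ℝ} (hQ : IntegrableOn Q (Set.Ioc 0 X))
    (hQ' : IntegrableOn Q' (Set.Ioc 0 X)) {r : ℝ} (hr : r ∈ Set.Icc 0 X) :
    radialPrimitive m (fun s => Q s - Q' s) r = radialPrimitive m Q r - radialPrimitive m Q' r := by
  have hs : Set.Ioc 0 r ⊆ Set.Ioc 0 X := Set.Ioc_subset_Ioc_right hr.2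
  have i : ∀ q : ℝ → ℂ, IntegrableOn q (Set.Ioc 0 X) →
      IntervalIntegrable (radialFlux m q) volume 0 r := fun q hq =>
    (intervalIntegrable_iff_integrableOn_Ioc_of_le hr.1).mpr
      ((integrableOn_radialFlux (m := m) hq).mono_set hs)
  rw [radialPrimitive, radialPrimitive, radialPrimitive,
    ← intervalIntegral.integral_sub (i Q hQ) (i Q' hQ')]
  refine intervalIntegral.integral_congr fun t ht => ?_
  rw [Set.uIcc_of_le hr.1] at ht
  have hst : Set.Ioc 0 t ⊆ Set.Ioc 0 X := Set.Ioc_subset_Ioc_right (ht.2.trans hr.2)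
  have j : ∀ q : ℝ → ℂ, IntegrableOn q (Set.Ioc 0 X) →
      IntervalIntegrable (fun s : ℝ => (s : ℂ) ^ m * q s) volume 0 t := fun q hq =>
    ((intervalIntegrable_iff_integrableOn_Ioc_of_le ht.1).mpr
      (hq.mono_set hst)).continuousOn_mul (by fun_prop)
  simp only [radialFlux, mul_sub]
  rw [intervalIntegral.integral_sub (j Q hQ) (j Q' hQ'), mul_sub]

theorem continuousOn_radialPrimitive {m : ℕ} {Q : ℝ → ℂ} {X : ℝ} (hX : 0 ≤ X)
    (hQ : IntegrableOn Q (Set.Ioc 0 X)) : ContinuousOn (radialPrimitive m Q) (Set.Icc 0 X) := by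
  have h1 : IntervalIntegrable (radialFlux m Q) volume 0 X :=
    (intervalIntegrable_iff_integrableOn_Ioc_of_le hX).mpr (integrableOn_radialFlux hQ)
  have h2 := intervalIntegral.continuousOn_primitive_interval' h1 Set.left_mem_uIcc
  rwa [Set.uIcc_of_le hX] at h2

theorem integrableOn_ball_radial {Q : ℝ → ℂ} {X : ℝ} (hQ : IntegrableOn Q (Set.Ioc 0 X)) :
    IntegrableOn (fun x : Space => Q ‖x‖) (Metric.ball 0 X) := by
  rw [integrableOn_fun_norm_addHaar]
  have h1 : IntegrableOn Q (Set.Ioo 0 X) := hQ.mono_set Set.Ioo_subset_Ioc_self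
  simp only [Complex.real_smul]
  refine Integrable.bdd_mul (c := X ^ (Module.finrank ℝ Space - 1)) h1
    (by fun_prop : Continuous _).aestronglyMeasurable ?_
  filter_upwards [self_mem_ae_restrict measurableSet_Ioo] with t ht
  rw [Complex.norm_real, norm_pow, Real.norm_eq_abs, abs_of_pos ht.1]
  exact pow_le_pow_left₀ ht.1.le ht.2.le _

/-- The integral of a radial function over a ball is controlled by its one-dimensional integral. -/
theorem integral_ball_radial_le {Q : ℝ → ℂ} {X : ℝ} (hX : 0 < X)
    (hQ : IntegrableOn Q (Set.Ioc 0 X)) :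
    ∫ x in Metric.ball (0 : Space) X, ‖Q ‖x‖‖
      ≤ 3 * (volume.real (Metric.ball (0 : Space) 1) * X ^ 2) * ∫ r in (0 : ℝ)..X, ‖Q r‖ := by
  have e : ∀ x : Space, Set.indicator (Metric.ball (0 : Space) X) (fun x => ‖Q ‖x‖‖) x
      = Set.indicator (Set.Iio X) (fun r => ‖Q r‖) ‖x‖ := by
    intro x
    by_cases h : ‖x‖ < X
    · rw [Set.indicator_of_mem (by simpa using h), Set.indicator_of_mem (by simpa using h)]
    · rw [Set.indicator_of_notMem (by simpa using h), Set.indicator_of_notMem (by simpa using h)]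
  rw [← integral_indicator measurableSet_ball]
  simp only [e]
  rw [integral_fun_norm_addHaar (volume : Measure Space) (Set.indicator (Set.Iio X) fun r => ‖Q r‖)]
  have hd : Module.finrank ℝ Space = 3 := by simp
  have e2 : ∀ y : ℝ, y ^ (Module.finrank ℝ Space - 1) • Set.indicator (Set.Iio X) (fun r => ‖Q r‖) y
      = Set.indicator (Set.Iio X) (fun r => r ^ 2 * ‖Q r‖) y := by
    intro y
    rw [hd]
    by_cases h : y < X
    · rw [Set.indicator_of_mem (by simpa using h), Set.indicator_of_mem (by simpa using h)]
      simp
    · rw [Set.indicator_of_notMem (by simpa using h), Set.indicator_of_notMem (by simpa using h)]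
      simp
  simp only [e2]
  rw [hd, setIntegral_indicator measurableSet_Iio, Set.Ioi_inter_Iio, nsmul_eq_mul, smul_eq_mul]
  have h1 : IntegrableOn Q (Set.Ioo 0 X) := hQ.mono_set Set.Ioo_subset_Ioc_self
  have h2 : ∫ r in Set.Ioo 0 X, r ^ 2 * ‖Q r‖ ≤ ∫ r in Set.Ioo 0 X, X ^ 2 * ‖Q r‖ := by
    refine setIntegral_mono_on ?_ (h1.norm.const_mul _) measurableSet_Ioo fun r hr => ?_
    · refine Integrable.bdd_mul (c := X ^ 2) h1.norm
        (by fun_prop : Continuous _).aestronglyMeasurable ?_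
      filter_upwards [self_mem_ae_restrict measurableSet_Ioo] with t ht
      rw [norm_pow, Real.norm_eq_abs, abs_of_pos ht.1]
      exact pow_le_pow_left₀ ht.1.le ht.2.le _
    · have := pow_le_pow_left₀ hr.1.le hr.2.le 2
      gcongr
  rw [integral_const_mul, ← integral_Ioc_eq_integral_Ioo,
    ← integral_Ioc_eq_integral_Ioo, ← intervalIntegral.integral_of_le hX.le,
    ← intervalIntegral.integral_of_le hX.le] at h2
  rw [← integral_Ioc_eq_integral_Ioo, ← intervalIntegral.integral_of_le hX.le]
  have h3 : 0 ≤ volume.real (Metric.ball (0 : Space) 1) := measureReal_nonneg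
  calc ((3 : ℕ) : ℝ) * (volume.real (Metric.ball (0 : Space) 1) * ∫ r in (0 : ℝ)..X, r ^ 2 * ‖Q r‖)
      ≤ ((3 : ℕ) : ℝ) * (volume.real (Metric.ball (0 : Space) 1)
        * (X ^ 2 * ∫ r in (0 : ℝ)..X, ‖Q r‖)) := by gcongr
    _ = _ := by push_cast; ring

theorem laplacian_eq_zero_of_notMem_tsupport {f : Space → ℂ} (hf : ContDiff ℝ 2 f) {x : Space}
    (hx : x ∉ tsupport f) : (Δ f) x = 0 := by
  have h0 : f =ᶠ[𝓝 x] fun _ => 0 := notMem_tsupport_iff_eventuallyEq.mp hx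
  rw [laplacian_eq_sum_fderiv hf]
  refine Finset.sum_eq_zero fun i _ => ?_
  have h1 : (fun y => fderiv ℝ f y (stdVec i)) =ᶠ[𝓝 x] fun _ => 0 := by
    filter_upwards [h0.fderiv (𝕜 := ℝ)] with y hy
    simp [hy]
  rw [h1.fderiv_eq]
  simp

theorem continuous_laplacian {f : Space → ℂ} (hf : ContDiff ℝ 2 f) : Continuous (Δ f) := by
  have : (Δ f) = fun x => ∑ i, fderiv ℝ (fun y => fderiv ℝ f y (stdVec i)) x (stdVec i) :=
    funext fun x => laplacian_eq_sum_fderiv hf x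
  rw [this]
  refine continuous_finsetSum _ fun i _ => ?_
  have h1 : ContDiff ℝ 1 fun y => fderiv ℝ f y (stdVec i) :=
    (hf.fderiv_right (m := 1) (by norm_num)).clm_apply contDiff_const
  exact (h1.continuous_fderiv (by norm_num)).clm_apply continuous_const

/-- A continuous function of compact support times a locally integrable radial one. -/
theorem integrable_mul_radial {A : Space → ℂ} (hA : Continuous A) (hc : HasCompactSupport A)
    {Q : ℝ → ℂ} (hQ : ∀ X, 0 < X → IntegrableOn Q (Set.Ioc 0 X)) :
    Integrable fun x : Space => A x * Q ‖x‖ := by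
  obtain ⟨X, hX, hAX⟩ := hc.isBounded.subset_ball_lt 0 0
  obtain ⟨C, hC⟩ := hc.exists_bound_of_continuous hA
  have h1 : IntegrableOn (fun x : Space => A x * Q ‖x‖) (Metric.ball 0 X) :=
    Integrable.bdd_mul (c := C) (integrableOn_ball_radial (hQ X hX)) hA.aestronglyMeasurable
      (Eventually.of_forall hC)
  refine (integrableOn_iff_integrable_of_support_subset fun x hx => ?_).mp h1
  exact hAX (subset_tsupport _ (left_ne_zero_of_mul hx))

/-- `Δ (S p) = S Q(|x|)` in the sense of distributions, for the solid harmonic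
`S = (x₀ + i x₁)^n` and `p(x) = c + radialPrimitive (2n+2) Q |x|`. -/
theorem integral_solid_mul_laplacian {Q : ℝ → ℂ} (hQ : ∀ X, 0 < X → IntegrableOn Q (Set.Ioc 0 X))
    (n : ℕ) (c : ℂ) (η : SpaceTest) :
    ∫ x : Space, isotropicForm x ^ n * (c + radialPrimitive (2 * n + 2) Q ‖x‖)
        * (Δ (η : Space → ℂ)) x
      = ∫ x : Space, isotropicForm x ^ n * Q ‖x‖ * η x := by
  obtain ⟨X, hX, hηX⟩ := η.hasCompactSupport.isBounded.subset_ball_lt 0 0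
  have hη : ContDiff ℝ 2 (η : Space → ℂ) := contDiff_infty.mp η.contDiff 2
  have hΔ : ∀ x, x ∉ Metric.ball (0 : Space) X → (Δ (η : Space → ℂ)) x = 0 := fun x hx =>
    laplacian_eq_zero_of_notMem_tsupport hη fun h => hx (hηX h)
  have hη0 : ∀ x, x ∉ Metric.ball (0 : Space) X → (η : Space → ℂ) x = 0 := fun x hx =>
    image_eq_zero_of_notMem_tsupport fun h => hx (hηX h)
  have cΔ := continuous_laplacian hη
  have cz := continuous_isotropicForm
  set A : Space → ℂ := fun x => isotropicForm x ^ n * (Δ (η : Space → ℂ)) x with hA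
  set B : Space → ℂ := fun x => isotropicForm x ^ n * η x with hB
  have cA : Continuous A := by rw [hA]; fun_prop
  have cB : Continuous B := by
    have := η.continuous
    rw [hB]; fun_prop
  obtain ⟨CA, hCA⟩ := (isCompact_closedBall (0 : Space) X).exists_bound_of_continuousOn
    cA.continuousOn
  obtain ⟨CB, hCB⟩ := (isCompact_closedBall (0 : Space) X).exists_bound_of_continuousOn
    cB.continuousOn
  have hCA0 : 0 ≤ CA := (norm_nonneg _).trans (hCA 0 (by simp [hX.le]))
  have hCB0 : 0 ≤ CB := (norm_nonneg _).trans (hCB 0 (by simp [hX.le]))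
  have hbc := Metric.ball_subset_closedBall (x := (0 : Space)) (ε := X)
  have eA : ∀ q : ℝ → ℂ, ∫ x : Space, isotropicForm x ^ n
        * (c + radialPrimitive (2 * n + 2) q ‖x‖) * (Δ (η : Space → ℂ)) x
      = ∫ x in Metric.ball (0 : Space) X, A x * (c + radialPrimitive (2 * n + 2) q ‖x‖) := by
    intro q
    rw [setIntegral_eq_integral_of_forall_compl_eq_zero]
    · refine integral_congr_ae (Eventually.of_forall fun x => ?_)
      simp only [hA]; ring
    · intro x hx
      simp [hA, hΔ x hx]
  have eB : ∀ q : ℝ → ℂ, ∫ x : Space, isotropicForm x ^ n * q ‖x‖ * η x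
      = ∫ x in Metric.ball (0 : Space) X, B x * q ‖x‖ := by
    intro q
    rw [setIntegral_eq_integral_of_forall_compl_eq_zero]
    · refine integral_congr_ae (Eventually.of_forall fun x => ?_)
      simp only [hB]; ring
    · intro x hx
      simp [hB, hη0 x hx]
  have iA : ∀ q : ℝ → ℂ, IntegrableOn q (Set.Ioc 0 X) → IntegrableOn
      (fun x : Space => A x * (c + radialPrimitive (2 * n + 2) q ‖x‖)) (Metric.ball 0 X) := by
    intro q hq
    refine (ContinuousOn.integrableOn_compact (isCompact_closedBall (0 : Space) X)
      (cA.continuousOn.mul (continuousOn_const.add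
        ((continuousOn_radialPrimitive hX.le hq).comp (by fun_prop) ?_)))).mono_set hbc
    intro x hx
    exact ⟨norm_nonneg x, by simpa using hx⟩
  have iB : ∀ q : ℝ → ℂ, IntegrableOn q (Set.Ioc 0 X) → IntegrableOn
      (fun x : Space => B x * q ‖x‖) (Metric.ball 0 X) := by
    intro q hq
    refine Integrable.bdd_mul (c := CB) (integrableOn_ball_radial hq) cB.aestronglyMeasurable ?_
    filter_upwards [self_mem_ae_restrict measurableSet_ball] with x hx using hCB x (hbc hx)
  set V := volume.real (Metric.ball (0 : Space) X)
  set V₁ := volume.real (Metric.ball (0 : Space) 1)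
  have hV : 0 ≤ V := measureReal_nonneg
  have hV₁ : 0 ≤ V₁ := measureReal_nonneg
  set M := CA * X * V + CB * (3 * (V₁ * X ^ 2)) with hM
  have hM0 : 0 ≤ M := by positivity
  have main : ∀ ε > 0, ‖(∫ x : Space, isotropicForm x ^ n
        * (c + radialPrimitive (2 * n + 2) Q ‖x‖) * (Δ (η : Space → ℂ)) x)
      - ∫ x : Space, isotropicForm x ^ n * Q ‖x‖ * η x‖ ≤ M * ε := by
    intro ε hε
    obtain ⟨Q', a, ha, cQ', h0, hQQ'⟩ := exists_continuous_approx hX (hQ X hX) hε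
    have iQ' : IntegrableOn Q' (Set.Ioc 0 X) :=
      cQ'.integrableOn_Icc.mono_set Set.Ioc_subset_Icc_self
    have iD : IntegrableOn (fun r => Q r - Q' r) (Set.Ioc 0 X) := (hQ X hX).sub iQ'
    have key := integral_solid_mul_laplacian_of_continuous cQ' h0 ha n c η
    rw [eA, eB] at key ⊢
    have e : (∫ x in Metric.ball (0 : Space) X, A x * (c + radialPrimitive (2 * n + 2) Q ‖x‖))
        - ∫ x in Metric.ball (0 : Space) X, B x * Q ‖x‖
        = (∫ x in Metric.ball (0 : Space) X, A x *
            radialPrimitive (2 * n + 2) (fun r => Q r - Q' r) ‖x‖)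
          - ∫ x in Metric.ball (0 : Space) X, B x * (Q ‖x‖ - Q' ‖x‖) := by
      have e1 : ∫ x in Metric.ball (0 : Space) X, A x *
            radialPrimitive (2 * n + 2) (fun r => Q r - Q' r) ‖x‖
          = (∫ x in Metric.ball (0 : Space) X, A x * (c + radialPrimitive (2 * n + 2) Q ‖x‖))
            - ∫ x in Metric.ball (0 : Space) X,
              A x * (c + radialPrimitive (2 * n + 2) Q' ‖x‖) := by
        rw [← integral_sub (iA Q (hQ X hX)) (iA Q' iQ')]
        refine setIntegral_congr_fun measurableSet_ball fun x hx => ?_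
        have hx' : ‖x‖ ∈ Set.Icc 0 X := ⟨norm_nonneg x, by simpa using hbc hx⟩
        simp only [radialPrimitive_sub (hQ X hX) iQ' hx']
        ring
      have e2 : ∫ x in Metric.ball (0 : Space) X, B x * (Q ‖x‖ - Q' ‖x‖)
          = (∫ x in Metric.ball (0 : Space) X, B x * Q ‖x‖)
            - ∫ x in Metric.ball (0 : Space) X, B x * Q' ‖x‖ := by
        rw [← integral_sub (iB Q (hQ X hX)) (iB Q' iQ')]
        simp only [mul_sub]
      rw [e1, e2, key]
      ring
    rw [e]
    have hδ : 0 ≤ ∫ r in (0 : ℝ)..X, ‖Q r - Q' r‖ :=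
      intervalIntegral.integral_nonneg hX.le fun _ _ => norm_nonneg _
    have b1 : ‖∫ x in Metric.ball (0 : Space) X, A x *
        radialPrimitive (2 * n + 2) (fun r => Q r - Q' r) ‖x‖‖ ≤ CA * (X * ε) * V := by
      refine norm_setIntegral_le_of_norm_le_const measure_ball_lt_top fun x hx => ?_
      have hx' : ‖x‖ ∈ Set.Icc 0 X := ⟨norm_nonneg x, by simpa using hbc hx⟩
      rw [norm_mul]
      refine mul_le_mul (hCA x (hbc hx)) ((norm_radialPrimitive_le iD hx').trans ?_)
        (norm_nonneg _) hCA0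
      gcongr
    have b2 : ‖∫ x in Metric.ball (0 : Space) X, B x * (Q ‖x‖ - Q' ‖x‖)‖
        ≤ CB * (3 * (V₁ * X ^ 2) * ε) := by
      have := integral_ball_radial_le hX iD
      calc _ ≤ ∫ x in Metric.ball (0 : Space) X, CB * ‖Q ‖x‖ - Q' ‖x‖‖ := by
            refine norm_integral_le_of_norm_le
              ((integrableOn_ball_radial iD).norm.const_mul CB) ?_
            filter_upwards [self_mem_ae_restrict measurableSet_ball] with x hx
            rw [norm_mul]
            exact mul_le_mul_of_nonneg_right (hCB x (hbc hx)) (norm_nonneg _)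
        _ ≤ _ := by
            rw [integral_const_mul]
            refine mul_le_mul_of_nonneg_left (this.trans ?_) hCB0
            gcongr
    refine (norm_sub_le _ _).trans ((add_le_add b1 b2).trans (le_of_eq ?_))
    rw [hM]; ring
  rw [← sub_eq_zero, ← norm_le_zero_iff]
  refine le_of_forall_pos_le_add fun δ hδ => ?_
  rw [zero_add]
  refine (main (δ / (M + 1)) (by positivity)).trans ?_
  rw [mul_div_assoc', div_le_iff₀ (by positivity)]
  nlinarith

/-! ### Variation of parameters -/

/-- A solution of `u'' = q u` that behaves like `r^(ℓ+1)` at the origin. -/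
structure IsRegularSolution (q : ℝ → ℂ) (ℓ : ℕ) (φ φ' : ℝ → ℂ) : Prop where
  isSolution : IsSolution q φ φ'
  bound : ∀ X, 0 < X → ∃ C, 0 ≤ C ∧ ∀ r ∈ Set.Ioc 0 X,
    ‖φ r‖ ≤ C * r ^ (ℓ + 1) ∧ ‖φ' r‖ ≤ C * r ^ ℓ
  tendsto : Tendsto (fun r : ℝ => φ r / (r : ℂ) ^ (ℓ + 1)) (𝓝[>] 0) (𝓝 1)

theorem IsRegularFamily.apply {K : Type*} [TopologicalSpace K] [CompactSpace K] {vt : ℝ → ℂ}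
    {ℓ : ℕ} {z : K → ℂ} {φ φ' : ℝ → C(K, ℂ)} (h : IsRegularFamily vt ℓ z φ φ') (x : K) :
    IsRegularSolution (radialCoeff vt ℓ (z x)) ℓ (fun r => φ r x) (fun r => φ' r x) where
  isSolution := h.isSolution x
  bound X hX := by
    obtain ⟨C, hC, hb⟩ := h.bound X hX
    exact ⟨C, hC, fun r hr => hb r hr x⟩
  tendsto := h.tendsto x

/-- The solution of `w'' = q w - W f`, `W = φ' ψ - φ ψ'`, given by variation of parameters, for a
source `f` supported in `[a, b]`. -/
def paramVariation (φ ψ f : ℝ → ℂ) (a b r : ℝ) : ℂ :=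
  φ r * (∫ t in r..b, ψ t * f t) + ψ r * ∫ t in a..r, φ t * f t

section

variable {q φ φ' ψ ψ' f : ℝ → ℂ} {a b : ℝ} {ℓ : ℕ}

theorem integral_mul_eq_zero_of_le (h0 : ∀ r, r ≤ a → f r = 0) {g : ℝ → ℂ} {r : ℝ} (hr : r ≤ a) :
    ∫ t in a..r, g t * f t = 0 := by
  rw [intervalIntegral.integral_congr (g := fun _ => (0 : ℂ)), intervalIntegral.integral_zero]
  intro s hs
  have : s ≤ a := by
    rw [Set.uIcc_of_ge hr] at hs
    exact hs.2
  simp [h0 s this]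

theorem integral_mul_eq_of_le (h0 : ∀ r, r ≤ a → f r = 0) {g : ℝ → ℂ} {r : ℝ} (hr : r ≤ a)
    (hi : IntervalIntegrable (fun t => g t * f t) volume a b) :
    ∫ t in r..b, g t * f t = ∫ t in a..b, g t * f t := by
  have hz : ∀ t ∈ Set.uIcc r a, g t * f t = 0 := fun t ht => by
    rw [Set.uIcc_of_le hr] at ht
    simp [h0 t ht.2]
  have h1 : IntervalIntegrable (fun t => g t * f t) volume r a :=
    (intervalIntegrable_const (c := (0 : ℂ))).congr fun t ht =>
      (hz t (Set.uIoc_subset_uIcc ht)).symm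
  rw [← intervalIntegral.integral_add_adjacent_intervals h1 hi, intervalIntegral.integral_symm,
    integral_mul_eq_zero_of_le h0 hr, neg_zero, zero_add]

/-- Only the values of `ψ` on the support of the source matter. -/
theorem paramVariation_congr (h0 : ∀ r, r ≤ a → f r = 0) {ψ₀ : ℝ → ℂ}
    (h : ∀ r, a ≤ r → ψ r = ψ₀ r) (r : ℝ) :
    paramVariation φ ψ f a b r = paramVariation φ ψ₀ f a b r := by
  have e1 : ∀ t, ψ t * f t = ψ₀ t * f t := by
    intro t
    rcases le_or_gt t a with ht | ht
    · simp [h0 t ht]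
    · rw [h t ht.le]
  simp only [paramVariation, e1]
  rcases le_or_gt r a with hr | hr
  · rw [integral_mul_eq_zero_of_le h0 hr, mul_zero, mul_zero]
  · rw [h r hr.le]

variable (hφ : IsSolution q φ φ') (hψ : IsSolution q ψ ψ') (hf : Continuous f)
include hφ hψ hf

theorem isPrimitive_paramVariation (ha : 0 < a) (hb : 0 < b) :
    IsPrimitive (fun r => φ' r * (∫ t in r..b, ψ t * f t) + ψ' r * ∫ t in a..r, φ t * f t)
      (paramVariation φ ψ f a b) ∧
    IsPrimitive (fun r => q r * paramVariation φ ψ f a b r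
        - (φ' a * ψ a - φ a * ψ' a) * f r)
      (fun r => φ' r * (∫ t in r..b, ψ t * f t) + ψ' r * ∫ t in a..r, φ t * f t) := by
  have cφ := hφ.fst.continuousOn.mul hf.continuousOn (s := Set.Ioi 0)
  have cψ := hψ.fst.continuousOn.mul hf.continuousOn (s := Set.Ioi 0)
  have iφ : ∀ c d, 0 < c → 0 < d → IntervalIntegrable (fun t => φ t * f t) volume c d :=
    fun c d hc hd => (cφ.mono (uIcc_subset_Ioi hc hd)).intervalIntegrable
  have iψ : ∀ c d, 0 < c → 0 < d → IntervalIntegrable (fun t => ψ t * f t) volume c d :=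
    fun c d hc hd => (cψ.mono (uIcc_subset_Ioi hc hd)).intervalIntegrable
  have hI : IsPrimitive (fun t => φ t * f t) (fun r => ∫ t in a..r, φ t * f t) :=
    ⟨iφ, fun c d hc hd => intervalIntegral.integral_interval_sub_left (iφ a d ha hd) (iφ a c ha hc)⟩
  have hJ : IsPrimitive (fun t => -1 * (ψ t * f t)) (fun r => ∫ t in r..b, ψ t * f t) := by
    refine ⟨fun c d hc hd => (iψ c d hc hd).const_mul _, fun c d hc hd => ?_⟩
    rw [intervalIntegral.integral_const_mul, ← intervalIntegral.integral_add_adjacent_intervals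
      (iψ c d hc hd) (iψ d b hd hb)]
    ring
  have hW : ∀ r, 0 < r → φ' r * ψ r - φ r * ψ' r = φ' a * ψ a - φ a * ψ' a := fun r hr =>
    hφ.wronskian_const hψ hr ha
  refine ⟨((hφ.fst.mul hJ).add (hψ.fst.mul hI)).congr (fun r hr => by ring) (fun r _ => rfl),
    ((hφ.snd.mul hJ).add (hψ.snd.mul hI)).congr (fun r hr => ?_) (fun r _ => rfl)⟩
  rw [← hW r hr, paramVariation]
  ring

end

/-- A primitive with a limit at the origin is an integral from the origin. -/
theorem IsPrimitive.eq_add_integral {f F : ℝ → ℂ} (h : IsPrimitive f F) {c : ℂ}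
    (hc : Tendsto F (𝓝[>] 0) (𝓝 c)) {r : ℝ} (hr : 0 < r) (hi : IntegrableOn f (Set.Ioc 0 r)) :
    F r = c + ∫ t in (0 : ℝ)..r, f t := by
  have hi' : IntervalIntegrable f volume 0 r :=
    (intervalIntegrable_iff_integrableOn_Ioc_of_le hr.le).mpr hi
  have h1 := intervalIntegral.continuousOn_primitive_interval' hi' Set.left_mem_uIcc
  rw [Set.uIcc_of_le hr.le] at h1
  have h2 := h1 0 (Set.left_mem_Icc.mpr hr.le)
  have h3 : Tendsto (fun e => ∫ t in (0 : ℝ)..e, f t) (𝓝[>] 0) (𝓝 0) := by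
    have := h2.mono_left (nhdsWithin_le_of_mem (mem_of_superset (Ioc_mem_nhdsGT hr)
        Set.Ioc_subset_Icc_self))
    simpa using this
  have h4 : Tendsto (fun e => F e + ∫ t in e..r, f t) (𝓝[>] 0)
      (𝓝 (c + ((∫ t in (0 : ℝ)..r, f t) - 0))) := by
    refine (hc.add (tendsto_const_nhds.sub h3)).congr' ?_
    have h5 : ∀ᶠ e in 𝓝[>] (0 : ℝ), e ∈ Set.Ioc 0 r := Ioc_mem_nhdsGT hr
    filter_upwards [h5] with e he
    have i1 : IntervalIntegrable f volume 0 e :=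
      (intervalIntegrable_iff_integrableOn_Ioc_of_le he.1.le).mpr
        (hi.mono_set (Set.Ioc_subset_Ioc_right he.2))
    rw [intervalIntegral.integral_interval_sub_left hi' i1]
  rw [sub_zero] at h4
  refine tendsto_nhds_unique (tendsto_const_nhds.congr' ?_) h4
  filter_upwards [self_mem_nhdsWithin] with e he
  rw [← h.sub_eq e r he hr]
  ring

section

variable {vt φ φ' ψ ψ' f : ℝ → ℂ} {a b B : ℝ} {ℓ : ℕ} {z : ℂ}

/-- Near the origin the variation-of-parameters solution is a multiple of the regular solution. -/
theorem paramVariation_of_le (h0 : ∀ r, r ≤ a → f r = 0)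
    (hi : IntervalIntegrable (fun t => ψ t * f t) volume a b) {r : ℝ} (hr : r ≤ a) :
    paramVariation φ ψ f a b r = φ r * ∫ t in a..b, ψ t * f t := by
  rw [paramVariation, integral_mul_eq_of_le h0 hr hi, integral_mul_eq_zero_of_le h0 hr, mul_zero,
    add_zero]

/-- The variation-of-parameters solution, divided by `r^(ℓ+1)`, in the form to which the
three-dimensional Green identity applies. -/
theorem paramVariation_div_eq (hm : AEStronglyMeasurable vt (volume.restrict (Set.Ioi 0)))
    (hB : ∀ᵐ r, 0 < r → ‖vt r‖ ≤ B) (hφ : IsRegularSolution (radialCoeff vt ℓ z) ℓ φ φ')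
    (hψ : IsSolution (radialCoeff vt ℓ z) ψ ψ') (hf : Continuous f)
    (h0 : ∀ r, r ≤ a → f r = 0) (ha : 0 < a) (hb : 0 < b) :
    let p : ℝ → ℂ := fun r => paramVariation φ ψ f a b r / (r : ℂ) ^ (ℓ + 1)
    let Q : ℝ → ℂ := fun r => (vt r - z) * p r
      - (φ' a * ψ a - φ a * ψ' a) * (f r / (r : ℂ) ^ (ℓ + 1))
    ContinuousOn p (Set.Ioi 0) ∧ (∀ X, 0 < X → ∃ C, ∀ r ∈ Set.Ioc 0 X, ‖p r‖ ≤ C) ∧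
    (∀ X, 0 < X → IntegrableOn Q (Set.Ioc 0 X)) ∧
      ∀ r, 0 < r → p r = (∫ t in a..b, ψ t * f t) + radialPrimitive (2 * ℓ + 2) Q r := by
  intro p Q
  set W := φ' a * ψ a - φ a * ψ' a with hW
  obtain ⟨hw, hw'⟩ := isPrimitive_paramVariation hφ.isSolution hψ hf ha hb
  set w := paramVariation φ ψ f a b with hw_def
  set w' : ℝ → ℂ := fun r => φ' r * (∫ t in r..b, ψ t * f t) + ψ' r * ∫ t in a..r, φ t * f t
    with hw'_def
  set J := ∫ t in a..b, ψ t * f t with hJ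
  have hr0 : ∀ {r : ℝ}, 0 < r → (r : ℂ) ≠ 0 := fun hr => by exact_mod_cast hr.ne'
  have hi : IntervalIntegrable (fun t => ψ t * f t) volume a b :=
    ((hψ.fst.continuousOn.mul hf.continuousOn (s := Set.Ioi 0)).mono
      (uIcc_subset_Ioi ha hb)).intervalIntegrable
  have wsmall : ∀ r, r ≤ a → w r = φ r * J := fun r hr => paramVariation_of_le h0 hi hr
  have w'small : ∀ r, r ≤ a → w' r = φ' r * J := fun r hr => by
    simp only [hw'_def]
    rw [integral_mul_eq_of_le h0 hr hi, integral_mul_eq_zero_of_le h0 hr, mul_zero, add_zero]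
  have cp : ContinuousOn p (Set.Ioi 0) := hw.continuousOn.div (by fun_prop)
    fun r hr => pow_ne_zero _ (hr0 hr)
  obtain ⟨C₀, hC₀, hbd⟩ := hφ.bound a ha
  have pa : ∀ r ∈ Set.Ioc 0 a, ‖p r‖ ≤ C₀ * ‖J‖ := by
    intro r hr
    have hrp : 0 < r ^ (ℓ + 1) := pow_pos hr.1 _
    simp only [p]
    rw [← hw_def, wsmall r hr.2, norm_div, norm_mul, norm_pow, Complex.norm_real, Real.norm_eq_abs,
      abs_of_pos hr.1, div_le_iff₀ hrp]
    nlinarith [mul_le_mul_of_nonneg_right (hbd r hr).1 (norm_nonneg J)]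
  have pb : ∀ X, 0 < X → ∃ C, ∀ r ∈ Set.Ioc 0 X, ‖p r‖ ≤ C := by
    intro X hX
    obtain ⟨C₁, hC₁⟩ := (isCompact_Icc (a := a) (b := X)).exists_bound_of_continuousOn
      (cp.mono fun r hr => lt_of_lt_of_le ha hr.1)
    refine ⟨max (C₀ * ‖J‖) C₁, fun r hr => ?_⟩
    rcases le_or_gt r a with h | h
    · exact (pa r ⟨hr.1, h⟩).trans (le_max_left _ _)
    · exact (hC₁ r ⟨h.le, hr.2⟩).trans (le_max_right _ _)
  have fc : Continuous fun r : ℝ => f r / (r : ℂ) ^ (ℓ + 1) := by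
    rw [continuous_iff_continuousAt]
    intro r
    rcases lt_or_ge r a with h | h
    · refine (continuousAt_const (y := (0 : ℂ))).congr ?_
      filter_upwards [gt_mem_nhds h] with s hs
      simp [h0 s hs.le]
    · exact ContinuousAt.div (by fun_prop) (by fun_prop) (pow_ne_zero _ (hr0 (ha.trans_le h)))
  have iQ : ∀ X, 0 < X → IntegrableOn Q (Set.Ioc 0 X) := by
    intro X hX
    obtain ⟨C, hC⟩ := pb X hX
    refine Integrable.sub ?_ (((continuous_const (y := W)).mul fc).integrableOn_Icc.mono_set
      Set.Ioc_subset_Icc_self)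
    refine IntegrableOn.of_bound (C := (B + ‖z‖) * C) (by simp) ?_ ?_
    · have hsub : Set.Ioc 0 X ⊆ Set.Ioi (0 : ℝ) := fun r hr => hr.1
      exact ((hm.mono_set hsub).sub aestronglyMeasurable_const).mul
        ((cp.mono hsub).aestronglyMeasurable measurableSet_Ioc)
    · filter_upwards [self_mem_ae_restrict measurableSet_Ioc, ae_restrict_of_ae hB] with r hr hBr
      have h1 := hBr hr.1
      rw [norm_mul]
      exact mul_le_mul ((norm_sub_le _ _).trans (by gcongr)) (hC r hr) (norm_nonneg _)
        (add_nonneg ((norm_nonneg _).trans h1) (norm_nonneg _))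
  -- the flux `r^(2ℓ+2) p'`
  set P₂ : ℝ → ℂ := fun r => (r : ℂ) ^ (ℓ + 1) * w' r - (ℓ + 1) * ((r : ℂ) ^ ℓ * w r) with hP₂
  have dP₂ : IsPrimitive (fun r => (r : ℂ) ^ (2 * ℓ + 2) * Q r) P₂ := by
    refine (((isPrimitive_pow (ℓ + 1)).mul hw').sub
      (((isPrimitive_pow ℓ).mul hw).const_mul (ℓ + 1))).congr (fun r hr => ?_) (fun r hr => rfl)
    have := hr0 hr
    simp only [Q, p, radialCoeff]
    push_cast
    field_simp
    ring
  have lP₂ : Tendsto P₂ (𝓝[>] 0) (𝓝 0) := by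
    have h1 : Tendsto (fun r : ℝ => (ℓ + 2) * (C₀ * ‖J‖) * r ^ (2 * ℓ + 1)) (𝓝[>] 0) (𝓝 0) := by
      have : Tendsto (fun r : ℝ => (ℓ + 2) * (C₀ * ‖J‖) * r ^ (2 * ℓ + 1)) (𝓝 0)
          (𝓝 ((ℓ + 2) * (C₀ * ‖J‖) * 0 ^ (2 * ℓ + 1))) := by
        exact Continuous.tendsto (by fun_prop) 0
      rw [zero_pow (by omega), mul_zero] at this
      exact this.mono_left nhdsWithin_le_nhds
    refine squeeze_zero_norm' ?_ h1
    have h5 : ∀ᶠ e in 𝓝[>] (0 : ℝ), e ∈ Set.Ioc 0 a := Ioc_mem_nhdsGT ha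
    filter_upwards [h5] with r hr
    obtain ⟨b1, b2⟩ := hbd r hr
    simp only [hP₂]
    rw [wsmall r hr.2, w'small r hr.2]
    refine (norm_sub_le _ _).trans ?_
    have e1 : ‖((ℓ : ℂ) + 1)‖ = ℓ + 1 := by
      rw [← Nat.cast_succ, Complex.norm_natCast, Nat.cast_succ]
    rw [norm_mul, norm_mul, norm_mul, norm_mul, norm_mul, norm_pow, norm_pow, Complex.norm_real,
      Real.norm_eq_abs, abs_of_pos hr.1, e1]
    have hrp := hr.1.le
    calc r ^ (ℓ + 1) * (‖φ' r‖ * ‖J‖) + (ℓ + 1) * (r ^ ℓ * (‖φ r‖ * ‖J‖))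
        ≤ r ^ (ℓ + 1) * (C₀ * r ^ ℓ * ‖J‖) + (ℓ + 1) * (r ^ ℓ * (C₀ * r ^ (ℓ + 1) * ‖J‖)) := by
          gcongr
      _ = _ := by ring
  have eP₂ : ∀ r, 0 < r → P₂ r = ∫ s in (0 : ℝ)..r, (s : ℂ) ^ (2 * ℓ + 2) * Q s := by
    intro r hr
    have := dP₂.eq_add_integral lP₂ hr ?_
    · rw [this, zero_add]
    · exact (intervalIntegrable_iff_integrableOn_Ioc_of_le hr.le).mp
        (((intervalIntegrable_iff_integrableOn_Ioc_of_le hr.le).mpr (iQ r hr)).continuousOn_mul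
          (by fun_prop))
  have dp : IsPrimitive (radialFlux (2 * ℓ + 2) Q) p := by
    refine ((isPrimitive_inv_pow (ℓ + 1)).mul hw).congr (fun r hr => ?_) (fun r hr => ?_)
    · have := hr0 hr
      rw [radialFlux, ← eP₂ r hr]
      simp only [hP₂]
      push_cast
      field_simp
      ring
    · simp only [p]
      rw [div_eq_inv_mul]
  have lp : Tendsto p (𝓝[>] 0) (𝓝 J) := by
    have := hφ.tendsto.mul_const J
    rw [one_mul] at this
    refine this.congr' ?_
    have h5 : ∀ᶠ e in 𝓝[>] (0 : ℝ), e ∈ Set.Ioc 0 a := Ioc_mem_nhdsGT ha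
    filter_upwards [h5] with r hr
    simp only [p]
    rw [← hw_def, wsmall r hr.2]
    ring
  refine ⟨cp, pb, iQ, fun r hr => ?_⟩
  exact dp.eq_add_integral lp hr (integrableOn_radialFlux (iQ r hr))

end

/-! ### From radial solutions to solutions of the Helmholtz equation -/

theorem norm_isotropicForm_le (x : Space) : ‖isotropicForm x‖ ≤ 2 * ‖x‖ := by
  have h : ∀ i, ‖x i‖ ≤ ‖x‖ := fun i => PiLp.norm_apply_le x i
  have e : isotropicForm x = x 0 + Complex.I * x 1 := by
    simp [isotropicForm, isotropic, Fin.sum_univ_three]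
  rw [e]
  refine (norm_add_le _ _).trans ?_
  rw [norm_mul, Complex.norm_I, one_mul, Complex.norm_real, Complex.norm_real]
  linarith [h 0, h 1]

theorem continuousOn_comp_norm {p : ℝ → ℂ} (hp : ContinuousOn p (Set.Ioi 0)) :
    ContinuousOn (fun x : Space => p ‖x‖) {0}ᶜ :=
  hp.comp (by fun_prop) fun _ hx => norm_pos_iff.mpr hx

theorem aestronglyMeasurable_comp_norm {p : ℝ → ℂ} (hp : ContinuousOn p (Set.Ioi 0)) :
    AEStronglyMeasurable (fun x : Space => p ‖x‖) volume := by
  have := (continuousOn_comp_norm hp).aestronglyMeasurable (μ := (volume : Measure Space))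
    (measurableSet_singleton _).compl
  rwa [restrict_compl_singleton] at this

/-- A degree-`n` solid harmonic times an exponentially decaying radial profile is square integrable,
even where the profile is only known to be bounded at the origin. -/
theorem memLp_solid_mul_radial {p : ℝ → ℂ} (hp : ContinuousOn p (Set.Ioi 0)) (n : ℕ) {C ε : ℝ}
    (hC : 0 ≤ C) (hε : 0 < ε) (hb : ∀ r, 0 < r → ‖p r‖ ≤ C * Real.exp (-(ε * r))) :
    MemLp (fun x : Space => isotropicForm x ^ n * p ‖x‖) 2 volume := by
  have cz := continuous_isotropicForm
  have hm : AEStronglyMeasurable (fun x : Space => isotropicForm x ^ n * p ‖x‖) volume :=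
    (cz.pow n).aestronglyMeasurable.mul (aestronglyMeasurable_comp_norm hp)
  rw [memLp_two_iff_integrable_sq_norm hm]
  obtain ⟨D, hD, hexp⟩ := exists_pow_le_exp 1 zero_le_one (n + 2) hε
  have hint : Integrable (fun x : Space => (2 ^ n * C * D) ^ 2 * (1 + ‖x‖) ^ (-4 : ℝ)) volume :=
    (integrable_one_add_norm (by simp; norm_num)).const_mul _
  refine hint.mono' (hm.norm.pow 2) ?_
  have hne : ∀ᵐ x : Space, x ≠ 0 := by simp [ae_iff]
  filter_upwards [hne] with x hx
  have hr : 0 < ‖x‖ := norm_pos_iff.mpr hx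
  set r := ‖x‖ with hr_def
  have h1 : ‖isotropicForm x ^ n * p r‖ ≤ 2 ^ n * C * D * ((1 + r) ^ 2)⁻¹ := by
    rw [norm_mul, norm_pow]
    calc ‖isotropicForm x‖ ^ n * ‖p r‖ ≤ (2 * r) ^ n * (C * Real.exp (-(ε * r))) := by
          gcongr
          · exact norm_isotropicForm_le x
          · exact hb r hr
      _ ≤ (2 * (r + 1)) ^ n * (C * Real.exp (-(ε * r))) := by gcongr; linarith
      _ = 2 ^ n * C * ((r + 1) ^ (n + 2) * Real.exp (-(ε * r))) * ((1 + r) ^ 2)⁻¹ := by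
          rw [mul_pow, add_comm 1 r, pow_add]
          field_simp
      _ ≤ 2 ^ n * C * (D * Real.exp (ε * r) * Real.exp (-(ε * r))) * ((1 + r) ^ 2)⁻¹ := by
          gcongr
          exact hexp r hr
      _ = _ := by rw [mul_assoc D, ← Real.exp_add, add_neg_cancel, Real.exp_zero, mul_one]
  rw [Real.norm_eq_abs, abs_of_nonneg (by positivity)]
  calc _ ≤ (2 ^ n * C * D * ((1 + r) ^ 2)⁻¹) ^ 2 := by gcongr
    _ = _ := by
      rw [mul_pow, Real.rpow_neg (by positivity), inv_pow, ← pow_mul]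
      norm_num

/-- A solution `p` of the radial equation, in integrated form, times the solid harmonic
`(x₀ + i x₁)^n`, solves the Helmholtz equation. -/
theorem solvesHelmholtz_of_radial {vt p F : ℝ → ℂ} {κ c : ℂ} {n : ℕ} (hF : Continuous F)
    (hp : ContinuousOn p (Set.Ioi 0)) (hpb : ∀ X, 0 < X → ∃ C, ∀ r ∈ Set.Ioc 0 X, ‖p r‖ ≤ C)
    (hQ : ∀ X, 0 < X → IntegrableOn (fun r => (vt r - κ ^ 2) * p r - F r) (Set.Ioc 0 X))
    (h : ∀ r, 0 < r → p r = c + radialPrimitive (2 * n + 2)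
      (fun r => (vt r - κ ^ 2) * p r - F r) r)
    {w f : L2Space} (hw : w =ᵐ[volume] fun x => isotropicForm x ^ n * p ‖x‖)
    (hf : f =ᵐ[volume] fun x => isotropicForm x ^ n * F ‖x‖) : SolvesHelmholtz vt κ w f := by
  intro η
  have hη : ContDiff ℝ 2 (η : Space → ℂ) := contDiff_infty.mp η.contDiff 2
  have hηc := η.continuous
  have cΔ := continuous_laplacian hη
  have cz := continuous_isotropicForm
  have kΔ : HasCompactSupport (Δ (η : Space → ℂ)) := η.hasCompactSupport.mono' fun x hx =>
    by_contra fun h => hx (laplacian_eq_zero_of_notMem_tsupport hη h)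
  have ip : ∀ X, 0 < X → IntegrableOn p (Set.Ioc 0 X) := by
    intro X hX
    obtain ⟨C, hC⟩ := hpb X hX
    have hsub : Set.Ioc 0 X ⊆ Set.Ioi (0 : ℝ) := fun r hr => hr.1
    refine IntegrableOn.of_bound (C := C) (by simp)
      ((hp.mono hsub).aestronglyMeasurable measurableSet_Ioc) ?_
    filter_upwards [self_mem_ae_restrict measurableSet_Ioc] with r hr using hC r hr
  have iF : ∀ X, 0 < X → IntegrableOn F (Set.Ioc 0 X) := fun X _ =>
    hF.integrableOn_Icc.mono_set Set.Ioc_subset_Icc_self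
  set Q : ℝ → ℂ := fun r => (vt r - κ ^ 2) * p r - F r with hQ_def
  have cL : Continuous fun x => isotropicForm x ^ n * (Δ (η : Space → ℂ)) x := by fun_prop
  have kL : HasCompactSupport fun x => isotropicForm x ^ n * (Δ (η : Space → ℂ)) x :=
    kΔ.mono fun x hx => right_ne_zero_of_mul hx
  have i1 := integrable_mul_radial cL kL ip
  have cA : Continuous fun x => isotropicForm x ^ n * (η : Space → ℂ) x := by fun_prop
  have kA : HasCompactSupport fun x => isotropicForm x ^ n * (η : Space → ℂ) x :=
    η.hasCompactSupport.mul_left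
  have i2 := integrable_mul_radial cA kA hQ
  have i3 := integrable_mul_radial cA kA iF
  have key := integral_solid_mul_laplacian hQ n c η
  have hne : ∀ᵐ x : Space, x ≠ 0 := by simp [ae_iff]
  have e1 : ∫ x : Space, isotropicForm x ^ n * (c + radialPrimitive (2 * n + 2) Q ‖x‖)
        * (Δ (η : Space → ℂ)) x
      = ∫ x : Space, isotropicForm x ^ n * (Δ (η : Space → ℂ)) x * p ‖x‖ := by
    refine integral_congr_ae ?_
    filter_upwards [hne] with x hx
    rw [h ‖x‖ (norm_pos_iff.mpr hx)]
    ring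
  have e2 : ∫ x : Space, w x * (-(Δ (η : Space → ℂ)) x + (vt ‖x‖ - κ ^ 2) * η x)
      = ∫ x : Space, -(isotropicForm x ^ n * (Δ (η : Space → ℂ)) x * p ‖x‖)
        + (isotropicForm x ^ n * η x * Q ‖x‖ + isotropicForm x ^ n * η x * F ‖x‖) := by
    refine integral_congr_ae ?_
    filter_upwards [hw] with x hx
    rw [hx]
    simp only [hQ_def]
    ring
  have e3 : ∫ x : Space, f x * η x = ∫ x : Space, isotropicForm x ^ n * η x * F ‖x‖ := by
    refine integral_congr_ae ?_
    filter_upwards [hf] with x hx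
    rw [hx]
    ring
  have e4 : ∫ x : Space, isotropicForm x ^ n * Q ‖x‖ * η x
      = ∫ x : Space, isotropicForm x ^ n * η x * Q ‖x‖ :=
    integral_congr_ae (Eventually.of_forall fun x => by simp only; ring)
  rw [e1, e4] at key
  have i1' : Integrable (fun x : Space =>
      -(isotropicForm x ^ n * (Δ (η : Space → ℂ)) x * p ‖x‖)) := i1.neg
  have i23 : Integrable (fun x : Space => isotropicForm x ^ n * η x * Q ‖x‖
      + isotropicForm x ^ n * η x * F ‖x‖) := i2.add i3
  rw [e2, e3, integral_add i1' i23, integral_add i2 i3, integral_neg, key]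
  ring

theorem contDiff_comp_norm {f : ℝ → ℝ} (hf : ContDiff ℝ (⊤ : ℕ∞) f) {a : ℝ} (ha : 0 < a)
    (h0 : ∀ r, r ≤ a → f r = 0) : ContDiff ℝ (⊤ : ℕ∞) fun x : Space => f ‖x‖ := by
  rw [contDiff_iff_contDiffAt]
  intro x
  rcases lt_or_ge ‖x‖ a with h | h
  · refine (contDiffAt_const (c := (0 : ℝ))).congr_of_eventuallyEq ?_
    filter_upwards [(continuous_norm.tendsto x).eventually (gt_mem_nhds h)] with y hy
    exact h0 _ hy.le
  · exact hf.contDiffAt.comp x (contDiffAt_norm ℝ (norm_pos_iff.mp (ha.trans_le h)))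

/-- The source `(x₀ + i x₁)^n f(|x|)` as a test function. -/
def solidTest (f : ℝ → ℝ) (hf : ContDiff ℝ (⊤ : ℕ∞) f) {a b : ℝ} (ha : 0 < a)
    (h0 : ∀ r, r ≤ a → f r = 0) (h1 : ∀ r, b ≤ r → f r = 0) (n : ℕ) : SpaceTest where
  toFun x := isotropicForm x ^ n * (f ‖x‖ : ℂ)
  contDiff' := (contDiff_isotropicForm.pow n).mul
    (Complex.ofRealCLM.contDiff.comp (contDiff_comp_norm hf ha h0))
  hasCompactSupport' := HasCompactSupport.intro (isCompact_closedBall (0 : Space) b) fun x hx => by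
    have : b ≤ ‖x‖ := by
      rw [mem_closedBall_zero_iff, not_le] at hx
      exact hx.le
    simp [h1 _ this]
  tsupport_subset' := fun _ _ => trivial

theorem solidTest_apply (f : ℝ → ℝ) (hf : ContDiff ℝ (⊤ : ℕ∞) f) {a b : ℝ} (ha : 0 < a)
    (h0 : ∀ r, r ≤ a → f r = 0) (h1 : ∀ r, b ≤ r → f r = 0) (n : ℕ) (x : Space) :
    solidTest f hf ha h0 h1 n x = isotropicForm x ^ n * (f ‖x‖ : ℂ) := rfl

theorem toL2_ae_eq (f : SpaceTest) : SpaceTest.toL2 f =ᵐ[volume] fun x => f x :=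
  (SpaceTest.memLp f).coeFn_toLp

/-- The essential bound of the potential as a real number. -/
theorem IsPotential.exists_bound {vt : ℝ → ℂ} {α Ra : ℝ} (hv : IsPotential vt α Ra) :
    ∃ B : ℝ, 0 ≤ B ∧ ∀ᵐ r : ℝ, 0 < r → ‖vt r‖ ≤ B := by
  have h := hv.memLp_top.2
  rw [eLpNorm_exponent_top] at h
  refine ⟨(eLpNormEssSup vt (volume.restrict (Set.Ioi (0 : ℝ)))).toReal, ENNReal.toReal_nonneg, ?_⟩
  have := ae_le_eLpNormEssSup (f := vt) (μ := volume.restrict (Set.Ioi (0 : ℝ)))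
  rw [ae_restrict_iff' measurableSet_Ioi] at this
  filter_upwards [this] with r hr hr0
  have := ENNReal.toReal_mono h.ne (hr hr0)
  simpa using this

/-- Away from the real axis the resolvent acts on `(x₀ + i x₁)^ℓ f(|x|)` by variation of
parameters, up to the Wronskian. -/
theorem wronskian_mul_kernelPairing {vt : ℝ → ℂ} {α Ra k : ℝ} (hv : IsPotential vt α Ra)
    (hk : 0 < k) {κ : ℂ} (hκ : IsAdmissible α k κ) (him : 0 < κ.im) {ℓ : ℕ} {φ φ' : ℝ → ℂ}
    (hφ : IsRegularSolution (radialCoeff vt ℓ (κ ^ 2)) ℓ φ φ')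
    {T : L2Space →L[ℂ] L2Space} (hT : IsResolvent vt κ T)
    (f : ℝ → ℝ) (hf : ContDiff ℝ (⊤ : ℕ∞) f) {b : ℝ} (hab : Ra ≤ b)
    (h0 : ∀ r, r ≤ Ra → f r = 0) (h1 : ∀ r, b ≤ r → f r = 0) (g : SpaceTest) :
    (φ' Ra * coulombWave α κ ℓ Ra - φ Ra * coulombWaveDeriv α κ ℓ Ra)
        * kernelPairing T g (solidTest f hf hv.radius_pos h0 h1 ℓ)
      = ∫ x : Space, g x * (isotropicForm x ^ ℓ *
          (paramVariation φ (coulombWave α κ ℓ) (fun r => (r : ℂ) ^ (ℓ + 1) * f r) Ra b ‖x‖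
            / (‖x‖ : ℂ) ^ (ℓ + 1))) := by
  have hRa := hv.radius_pos
  have hb : 0 < b := hRa.trans_le hab
  obtain ⟨B, hB0, hB⟩ := hv.exists_bound
  have hm := hv.memLp_top.1
  have hcw := isSolution_coulombWave hk hκ ℓ
  obtain ⟨ψ, ψ', hψ, hψeq⟩ := exists_isSolution_extension
    (q := radialCoeff vt ℓ (κ ^ 2)) hcw hRa
    (fun r hr => by simp only [radialCoeff, hv.tail r hr])
    ((Measurable.aestronglyMeasurable (by fun_prop)).add hm |>.sub aestronglyMeasurable_const)
    (fun ε hε => by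
      refine ⟨ℓ * (ℓ + 1) / ε ^ 2 + B + ‖κ ^ 2‖, ?_⟩
      filter_upwards [hB] with r hr hrε
      have hr0 : 0 < r := hε.trans hrε.1
      refine (norm_sub_le _ _).trans (add_le_add_left ((norm_add_le _ _).trans
        (add_le_add ?_ (hr hr0))) _)
      rw [Complex.norm_real, Real.norm_eq_abs, abs_of_nonneg (by positivity)]
      have := hrε.1.le
      gcongr)
  set F : ℝ → ℂ := fun r => (r : ℂ) ^ (ℓ + 1) * f r with hF
  have hfc := hf.continuous
  have cF : Continuous F := by rw [hF]; fun_prop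
  have F0 : ∀ r, r ≤ Ra → F r = 0 := fun r hr => by simp [hF, h0 r hr]
  have F1 : ∀ r, b ≤ r → F r = 0 := fun r hr => by simp [hF, h1 r hr]
  have epv : ∀ r, paramVariation φ (coulombWave α κ ℓ) F Ra b r = paramVariation φ ψ F Ra b r :=
    fun r => (paramVariation_congr F0 (fun r hr => (hψeq r hr).1) r).symm
  simp only [epv]
  set W := φ' Ra * coulombWave α κ ℓ Ra - φ Ra * coulombWaveDeriv α κ ℓ Ra with hW
  obtain ⟨cp, pb, iQ, hp⟩ := paramVariation_div_eq hm hB hφ hψ cF F0 hRa hb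
  rw [(hψeq Ra le_rfl).1, (hψeq Ra le_rfl).2, ← hW] at hp iQ
  set p : ℝ → ℂ := fun r => paramVariation φ ψ F Ra b r / (r : ℂ) ^ (ℓ + 1) with hp_def
  have eF : ∀ r : ℝ, F r / (r : ℂ) ^ (ℓ + 1) = f r := by
    intro r
    rcases le_or_gt r Ra with h | h
    · simp [hF, h0 r h]
    · have : (r : ℂ) ≠ 0 := by exact_mod_cast (hRa.trans h).ne'
      simp only [hF]
      field_simp
  simp only [eF] at hp iQ
  -- exponential decay of the solution
  obtain ⟨C, hC0, hC⟩ := exists_norm_coulombWave_le hk α ℓ hb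
  set I := ∫ t in Ra..b, φ t * F t with hI
  have decay : ∃ C, 0 ≤ C ∧ ∀ r, 0 < r → ‖p r‖ ≤ C * Real.exp (-(κ.im * r)) := by
    obtain ⟨C₁, hC₁⟩ := pb b hb
    have hC₁0 : 0 ≤ C₁ := (norm_nonneg _).trans (hC₁ b ⟨hb, le_rfl⟩)
    refine ⟨max (C₁ * Real.exp (κ.im * b)) (C * ‖I‖), le_max_of_le_left (by positivity),
      fun r hr => ?_⟩
    rcases le_or_gt r b with h | h
    · calc ‖p r‖ ≤ C₁ := hC₁ r ⟨hr, h⟩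
        _ ≤ C₁ * (Real.exp (κ.im * b) * Real.exp (-(κ.im * r))) := by
          rw [← Real.exp_add]
          exact le_mul_of_one_le_right hC₁0 (Real.one_le_exp (by nlinarith))
        _ ≤ _ := by
          rw [← mul_assoc]
          gcongr
          exact le_max_left _ _
    · have z1 : ∫ t in r..b, ψ t * F t = 0 := by
        rw [intervalIntegral.integral_congr (g := fun _ => (0 : ℂ)),
          intervalIntegral.integral_zero]
        intro s hs
        rw [Set.uIcc_of_ge h.le] at hs
        simp [F1 s hs.1]
      have z2 : ∫ t in Ra..r, φ t * F t = I := by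
        have i : ∀ c d, 0 < c → 0 < d → IntervalIntegrable (fun t => φ t * F t) volume c d :=
          fun c d hc hd => ((hφ.isSolution.fst.continuousOn.mul cF.continuousOn
            (s := Set.Ioi 0)).mono (uIcc_subset_Ioi hc hd)).intervalIntegrable
        rw [← intervalIntegral.integral_add_adjacent_intervals (i Ra b hRa hb) (i b r hb hr),
          intervalIntegral.integral_congr (a := b) (g := fun _ => (0 : ℂ)),
          intervalIntegral.integral_zero, add_zero]
        intro s hs
        rw [Set.uIcc_of_le h.le] at hs
        simp [F1 s hs.1]
      have hrp : 0 < r ^ (ℓ + 1) := pow_pos hr _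
      simp only [hp_def, paramVariation]
      rw [z1, z2, mul_zero, zero_add, (hψeq r (hab.trans h.le)).1, norm_div, norm_mul, norm_pow,
        Complex.norm_real, Real.norm_eq_abs, abs_of_pos hr, div_le_iff₀ hrp]
      calc _ ≤ C * (r ^ (ℓ + 1) * Real.exp (-(κ.im * r))) * ‖I‖ := by
            gcongr
            exact hC κ hκ r h.le
        _ = C * ‖I‖ * Real.exp (-(κ.im * r)) * r ^ (ℓ + 1) := by ring
        _ ≤ _ := by
            gcongr
            exact le_max_right _ _
  obtain ⟨C₂, hC₂0, hC₂⟩ := decay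
  have hu := memLp_solid_mul_radial cp ℓ hC₂0 him hC₂
  set ft := solidTest f hf hRa h0 h1 ℓ with hft
  have hsol : SolvesHelmholtz vt κ (hu.toLp _) (W • SpaceTest.toL2 ft) := by
    refine solvesHelmholtz_of_radial (F := fun r => W * f r) (by fun_prop) cp pb iQ hp
      hu.coeFn_toLp ?_
    filter_upwards [Lp.coeFn_smul W (SpaceTest.toL2 ft), toL2_ae_eq ft] with x hx1 hx2
    rw [hx1, Pi.smul_apply, hx2, hft, solidTest_apply, smul_eq_mul]
    ring
  have hTu := (hT _ _).mp hsol
  rw [map_smul] at hTu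
  rw [kernelPairing, ← integral_const_mul]
  refine integral_congr_ae ?_
  have e1 : (W • T (SpaceTest.toL2 ft) : L2Space) =ᵐ[volume]
      fun x => isotropicForm x ^ ℓ * p ‖x‖ := by
    rw [← hTu]
    exact hu.coeFn_toLp
  filter_upwards [e1, Lp.coeFn_smul W (T (SpaceTest.toL2 ft))] with x hx1 hx2
  rw [hx2, Pi.smul_apply, smul_eq_mul] at hx1
  rw [← hx1]
  ring

/-! ### The limiting absorption principle: the Wronskian does not vanish -/

/-- A vertical segment of momenta ending at `k`, so short that `|Im η| ≤ 1/2` along it. -/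
theorem exists_admissible_path (α : ℝ) {k : ℝ} (hk : 0 < k) :
    ∃ δ : ℝ, 0 < δ ∧ ∀ x : unitInterval, IsAdmissible α k (k + δ * (x : ℝ) * Complex.I) := by
  set δ := min 1 (k ^ 2 / (|α| + 1)) with hδ
  have hα := abs_nonneg α
  have hδ0 : 0 < δ := lt_min one_pos (by positivity)
  refine ⟨δ, hδ0, fun x => ?_⟩
  have hx0 : 0 ≤ (x : ℝ) := x.2.1
  have hx1 : (x : ℝ) ≤ 1 := x.2.2
  have hs0 : 0 ≤ δ * x := by positivity
  have hs1 : δ * x ≤ δ := mul_le_of_le_one_right hδ0.le hx1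
  have hδ1 : δ ≤ 1 := min_le_left _ _
  have hδ2 : δ * (|α| + 1) ≤ k ^ 2 := by
    rw [← le_div_iff₀ (by positivity)]
    exact min_le_right _ _
  set s := δ * (x : ℝ) with hs
  have e : (k : ℂ) + δ * (x : ℝ) * Complex.I = ⟨k, s⟩ := by
    apply Complex.ext <;> simp [hs]
  rw [e]
  refine ⟨rfl, hs0, hs1.trans hδ1, ?_⟩
  have e2 : ((α : ℂ) / (2 * (⟨k, s⟩ : ℂ))).im = -(α * s / (2 * (k ^ 2 + s ^ 2))) := by
    rw [Complex.div_im]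
    simp [Complex.normSq_apply]
    field_simp
  have hks : 0 < k ^ 2 + s ^ 2 := by positivity
  rw [e2, abs_neg, abs_div, abs_mul, abs_of_nonneg hs0, abs_of_pos (by positivity : 0 < 2 * (k ^ 2 + s ^ 2)),
    div_le_iff₀ (by positivity)]
  nlinarith [mul_le_mul_of_nonneg_left hs1 hα, sq_nonneg s]

/-- The variation-of-parameters solutions depend continuously on a parameter. -/
theorem continuous_paramVariation {K : Type*} [TopologicalSpace K] [FirstCountableTopology K]
    {φ ψ : K → ℝ → ℂ} {f : ℝ → ℂ} {a b : ℝ} (ha : 0 < a) (hb : 0 < b) (hf : Continuous f)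
    (h0 : ∀ r, r ≤ a → f r = 0) (hφ : ∀ x, ContinuousOn (φ x) (Set.Ioi 0))
    (hψ : ∀ x, ContinuousOn (ψ x) (Set.Ioi 0)) (hφc : ∀ r, 0 < r → Continuous fun x => φ x r)
    (hψc : ∀ r, 0 < r → Continuous fun x => ψ x r)
    (hC : ∀ X, ∃ C, ∀ x, ∀ r ∈ Set.Icc a X, ‖φ x r‖ ≤ C ∧ ‖ψ x r‖ ≤ C)
    {r : ℝ} (hr : 0 < r) : Continuous fun x => paramVariation (φ x) (ψ x) f a b r := by
  have main : ∀ (g : K → ℝ → ℂ), (∀ x, ContinuousOn (g x) (Set.Ioi 0)) →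
      (∀ r, 0 < r → Continuous fun x => g x r) →
      (∀ X, ∃ C, ∀ x, ∀ r ∈ Set.Icc a X, ‖g x r‖ ≤ C) → ∀ c d, 0 < c → 0 < d →
      Continuous fun x => ∫ t in c..d, g x t * f t := by
    intro g hg hgc hgb c d hc hd
    obtain ⟨C, hC⟩ := hgb (max c d)
    have hi : IntervalIntegrable (fun t => C * ‖f t‖) volume c d :=
      (continuous_const.mul hf.norm).intervalIntegrable _ _
    refine intervalIntegral.continuous_of_dominated_interval (bound := fun t => C * ‖f t‖)
      (fun x => ?_) (fun x => ?_) hi ?_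
    · refine (((hg x).mul hf.continuousOn).mono ?_).aestronglyMeasurable measurableSet_uIoc
      exact Set.uIoc_subset_uIcc.trans (uIcc_subset_Ioi hc hd)
    · refine Eventually.of_forall fun t ht => ?_
      rcases le_or_gt t a with h | h
      · simp [h0 t h]
      · rw [norm_mul]
        exact mul_le_mul_of_nonneg_right (hC x t ⟨h.le, (Set.uIoc_subset_uIcc ht).2⟩)
          (norm_nonneg _)
    · refine Eventually.of_forall fun t ht => ?_
      exact (hgc t (uIcc_subset_Ioi hc hd (Set.uIoc_subset_uIcc ht))).mul continuous_const
  have h1 := main ψ hψ hψc (fun X => by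
    obtain ⟨C, hC⟩ := hC X
    exact ⟨C, fun x r hr => (hC x r hr).2⟩) r b hr hb
  have h2 := main φ hφ hφc (fun X => by
    obtain ⟨C, hC⟩ := hC X
    exact ⟨C, fun x r hr => (hC x r hr).1⟩) a r ha hr
  exact ((hφc r hr).mul h1).add ((hψc r hr).mul h2)

theorem norm_integral_mul_le {g f : ℝ → ℂ} {a c d M N : ℝ} (h0 : ∀ r, r ≤ a → f r = 0)
    (hN : ∀ r, ‖f r‖ ≤ N) (hM0 : 0 ≤ M) (hM : ∀ r ∈ Set.Ioc a (max c d), ‖g r‖ ≤ M) :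
    ‖∫ t in c..d, g t * f t‖ ≤ M * N * |d - c| := by
  refine intervalIntegral.norm_integral_le_of_norm_le_const fun t ht => ?_
  have hN0 : 0 ≤ N := (norm_nonneg _).trans (hN 0)
  rcases le_or_gt t a with h | h
  · simp only [h0 t h, mul_zero, norm_zero]
    positivity
  · rw [norm_mul]
    exact mul_le_mul (hM t ⟨h, ht.2⟩) (hN t) (norm_nonneg _) hM0

/-- If the kernel of the resolvent of `-Δ + v` has no pole at `k`, then the regular and the
outgoing solution of the radial equation at `k` are linearly independent. -/
theorem exists_isRegularSolution_wronskian_ne_zero {vt : ℝ → ℂ} {α Ra k : ℝ}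
    (hv : IsPotential vt α Ra) (hk : 0 < k) (hreg : KernelRegularAt vt k) (ℓ : ℕ) :
    ∃ φ φ' : ℝ → ℂ, IsRegularSolution (radialCoeff vt ℓ ((k : ℂ) ^ 2)) ℓ φ φ' ∧
      φ' Ra * coulombWave α k ℓ Ra - φ Ra * coulombWaveDeriv α k ℓ Ra ≠ 0 := by
  have hRa := hv.radius_pos
  obtain ⟨B, hB0, hB⟩ := hv.exists_bound
  have hm := hv.memLp_top.1
  obtain ⟨δ, hδ, hadm⟩ := exists_admissible_path α hk
  set κ : unitInterval → ℂ := fun x => k + δ * (x : ℝ) * Complex.I with hκ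
  have cκ : Continuous κ := by rw [hκ]; fun_prop
  have κ0 : κ 0 = k := by simp [hκ]
  obtain ⟨φ, φ', hφ⟩ := exists_isRegularFamily hm hB ℓ (⟨fun x => κ x ^ 2, by fun_prop⟩ : C(unitInterval, ℂ))
  have hφx : ∀ x, IsRegularSolution (radialCoeff vt ℓ (κ x ^ 2)) ℓ (fun r => φ r x)
      (fun r => φ' r x) := fun x => hφ.apply x
  have hψx := fun x => isSolution_coulombWave hk (hadm x) ℓ
  set ψ : unitInterval → ℝ → ℂ := fun x => coulombWave α (κ x) ℓ with hψ
  refine ⟨fun r => φ r 0, fun r => φ' r 0, κ0 ▸ hφx 0, fun hW0 => ?_⟩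
  set W : unitInterval → ℂ := fun x => φ' Ra x * coulombWave α (κ x) ℓ Ra
    - φ Ra x * coulombWaveDeriv α (κ x) ℓ Ra with hW
  have cW : Continuous W := by
    obtain ⟨c1, c2⟩ := continuous_coulombWave (α := α) hk cκ hadm ℓ hRa
    exact ((φ' Ra).continuous.mul c1).sub ((φ Ra).continuous.mul c2)
  have hW0' : W 0 = 0 := by
    simp only [hW, κ0]
    exact hW0
  obtain ⟨Cψ, hCψ0, hCψ⟩ := exists_norm_coulombWave_le hk α ℓ hRa
  have hCψ' : ∀ x r, Ra ≤ r → ‖ψ x r‖ ≤ Cψ * r ^ (ℓ + 1) := by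
    intro x r hr
    refine (hCψ (κ x) (hadm x) r hr).trans ?_
    have hr0 : 0 < r := hRa.trans_le hr
    have := (hadm x).im_nonneg
    gcongr
    exact mul_le_of_le_one_right (by positivity) (Real.exp_le_one_iff.mpr (by
      have := mul_nonneg this hr0.le
      linarith))
  -- the solutions generated by an arbitrary radial source vanish
  have vanish : ∀ (f : ℝ → ℝ) (hf : ContDiff ℝ (⊤ : ℕ∞) f) (b : ℝ), Ra ≤ b →
      (∀ r, r ≤ Ra → f r = 0) → (∀ r, b ≤ r → f r = 0) →
      ∫ t in Ra..b, ψ 0 t * ((t : ℂ) ^ (ℓ + 1) * f t) = 0 := by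
    intro f hf b hab h0 h1
    have hb : 0 < b := hRa.trans_le hab
    set F : ℝ → ℂ := fun r => (r : ℂ) ^ (ℓ + 1) * f r with hF
    have hfc := hf.continuous
    have cF : Continuous F := by rw [hF]; fun_prop
    have F0 : ∀ r, r ≤ Ra → F r = 0 := fun r hr => by simp [hF, h0 r hr]
    have F1 : ∀ r, b ≤ r → F r = 0 := fun r hr => by simp [hF, h1 r hr]
    have kF : HasCompactSupport F := HasCompactSupport.intro (isCompact_Icc (a := Ra) (b := b))
      fun r hr => by
        rcases le_or_gt r Ra with h | h
        · exact F0 r h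
        · exact F1 r (by
            by_contra h'
            exact hr ⟨h.le, (not_le.mp h').le⟩)
    obtain ⟨N, hN⟩ := kF.exists_bound_of_continuous cF
    have hN0 : 0 ≤ N := (norm_nonneg _).trans (hN 0)
    set w : unitInterval → ℝ → ℂ := fun x =>
      paramVariation (fun r => φ r x) (ψ x) F Ra b with hw
    set p : unitInterval → ℝ → ℂ := fun x r => w x r / (r : ℂ) ^ (ℓ + 1) with hp
    have bsup : ∀ X, ∃ C, 0 ≤ C ∧ ∀ x, ∀ r ∈ Set.Icc Ra X, ‖φ r x‖ ≤ C ∧ ‖ψ x r‖ ≤ C := by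
      intro X
      rcases le_or_gt X 0 with hX | hX
      · exact ⟨0, le_rfl, fun x r hr => absurd (hRa.trans_le (hr.1.trans (hr.2.trans hX)))
          (lt_irrefl _)⟩
      obtain ⟨C, hC0, hC⟩ := hφ.bound X hX
      refine ⟨max C Cψ * X ^ (ℓ + 1), by positivity, fun x r hr => ?_⟩
      have hr0 : 0 < r := hRa.trans_le hr.1
      have hpow : r ^ (ℓ + 1) ≤ X ^ (ℓ + 1) := pow_le_pow_left₀ hr0.le hr.2 _
      constructor
      · refine ((hC r ⟨hr0, hr.2⟩ x).1).trans ?_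
        gcongr
        exact le_max_left _ _
      · refine (hCψ' x r hr.1).trans ?_
        gcongr
        exact le_max_right _ _
    have cw : ∀ r, 0 < r → Continuous fun x => w x r := by
      intro r hr
      refine continuous_paramVariation hRa hb cF F0 (fun x => (hφx x).isSolution.fst.continuousOn)
        (fun x => (hψx x).fst.continuousOn) (fun r _ => (φ r).continuous)
        (fun r hr => (continuous_coulombWave hk cκ hadm ℓ hr).1) (fun X => ?_) hr
      obtain ⟨C, -, hC⟩ := bsup X
      exact ⟨C, hC⟩
    have cp : ∀ r, 0 < r → Continuous fun x => p x r := fun r hr => (cw r hr).div_const _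
    -- continuity in the radius
    have cpr : ∀ x, ContinuousOn (p x) (Set.Ioi 0) := by
      intro x
      have c1 : ContinuousOn (w x) (Set.Ioi 0) := by
        have i : ∀ (g : ℝ → ℂ) (hg : ContinuousOn g (Set.Ioi 0)) c d, 0 < c → 0 < d →
            IntervalIntegrable (fun t => g t * F t) volume c d := fun g hg c d hc hd =>
          ((hg.mul cF.continuousOn).mono (uIcc_subset_Ioi hc hd)).intervalIntegrable
        have gφ := (hφx x).isSolution.fst.continuousOn
        have gψ := (hψx x).fst.continuousOn
        have hI : IsPrimitive (fun t => φ t x * F t) (fun r => ∫ t in Ra..r, φ t x * F t) :=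
          ⟨i _ gφ, fun c d hc hd => intervalIntegral.integral_interval_sub_left
            (i _ gφ Ra d hRa hd) (i _ gφ Ra c hRa hc)⟩
        have hJ : IsPrimitive (fun t => ψ x t * F t) (fun r => ∫ t in b..r, ψ x t * F t) :=
          ⟨i _ gψ, fun c d hc hd => intervalIntegral.integral_interval_sub_left
            (i _ gψ b d hb hd) (i _ gψ b c hb hc)⟩
        refine ((gφ.mul hJ.continuousOn.neg).add (gψ.mul hI.continuousOn)).congr fun r hr => ?_
        simp only [hw, paramVariation]
        rw [intervalIntegral.integral_symm b r]
        rfl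
      exact c1.div (by fun_prop) fun r hr => pow_ne_zero _ (by exact_mod_cast (ne_of_gt hr))
    have bp : ∀ X, 0 < X → ∃ C, 0 ≤ C ∧ ∀ x, ∀ r ∈ Set.Ioc 0 X, ‖p x r‖ ≤ C := by
      intro X hX
      obtain ⟨C, hC0, hC⟩ := hφ.bound X hX
      obtain ⟨M, hM0, hM⟩ := bsup (max X b)
      set D := M * N * (X + b + Ra) with hD
      have hD0 : 0 ≤ D := by positivity
      refine ⟨C * D + Cψ * D, by positivity, fun x r hr => ?_⟩
      have hr0 := hr.1
      have hrp : 0 < r ^ (ℓ + 1) := pow_pos hr.1 _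
      have hJ : ‖∫ t in r..b, ψ x t * F t‖ ≤ D := by
        refine (norm_integral_mul_le F0 hN hM0 (fun t ht => (hM x t ⟨ht.1.le, ht.2.trans
          (max_le_max_right _ hr.2)⟩).2)).trans ?_
        rw [hD]
        gcongr
        rw [abs_le]
        constructor <;> linarith [hr.2]
      have hI : ‖∫ t in Ra..r, φ t x * F t‖ ≤ D := by
        refine (norm_integral_mul_le F0 hN hM0 (fun t ht => (hM x t ⟨ht.1.le, ht.2.trans
          (max_le (hab.trans (le_max_right _ _)) (hr.2.trans (le_max_left _ _)))⟩).1)).trans ?_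
        rw [hD]
        gcongr
        rw [abs_le]
        constructor <;> linarith [hr.2]
      simp only [hp, hw, paramVariation]
      rw [norm_div, norm_pow, Complex.norm_real, Real.norm_eq_abs, abs_of_pos hr0,
        div_le_iff₀ hrp]
      refine (norm_add_le _ _).trans ?_
      rw [norm_mul, norm_mul]
      have t1 : ‖φ r x‖ * ‖∫ t in r..b, ψ x t * F t‖ ≤ C * r ^ (ℓ + 1) * D :=
        mul_le_mul ((hC r hr x).1) hJ (norm_nonneg _) (by positivity)
      have t2 : ‖ψ x r‖ * ‖∫ t in Ra..r, φ t x * F t‖ ≤ Cψ * r ^ (ℓ + 1) * D := by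
        rcases le_or_gt r Ra with h | h
        · rw [integral_mul_eq_zero_of_le F0 h, norm_zero, mul_zero]
          positivity
        · exact mul_le_mul (hCψ' x r h.le) hI (norm_nonneg _) (by positivity)
      linarith
    have cz := continuous_isotropicForm
    set u : unitInterval → Space → ℂ := fun x y => isotropicForm y ^ ℓ * p x ‖y‖ with hu
    have hne : ∀ᵐ y : Space, y ≠ 0 := by simp [ae_iff]
    -- pairing with test functions
    have pairing0 : ∀ g : SpaceTest, ∫ y : Space, g y * u 0 y = 0 := by
      intro g
      have hgc := g.continuous
      obtain ⟨X, hX, hgX⟩ := g.hasCompactSupport.isBounded.subset_ball_lt 0 0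
      obtain ⟨C, hC0, hC⟩ := bp X hX
      have cpair : Continuous fun x => ∫ y : Space, g y * u x y := by
        refine continuous_of_dominated (bound := fun y => C * ‖g y * isotropicForm y ^ ℓ‖)
          (fun x => ?_) (fun x => ?_) ?_ ?_
        · exact hgc.aestronglyMeasurable.mul ((cz.pow ℓ).aestronglyMeasurable.mul
            (aestronglyMeasurable_comp_norm (cpr x)))
        · filter_upwards [hne] with y hy
          by_cases hy' : y ∈ tsupport g
          · have hyX : ‖y‖ < X := by simpa using hgX hy'
            have := hC x ‖y‖ ⟨norm_pos_iff.mpr hy, hyX.le⟩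
            calc ‖g y * u x y‖ = ‖g y * isotropicForm y ^ ℓ‖ * ‖p x ‖y‖‖ := by
                  rw [← norm_mul]; simp only [hu]; ring_nf
              _ ≤ ‖g y * isotropicForm y ^ ℓ‖ * C := by gcongr
              _ = _ := mul_comm _ _
          · rw [image_eq_zero_of_notMem_tsupport hy']
            simp
        · have hgs : HasCompactSupport fun y => g y * isotropicForm y ^ ℓ :=
            g.hasCompactSupport.mul_right
          exact ((hgc.mul (cz.pow ℓ)).norm.integrable_of_hasCompactSupport hgs.norm).const_mul C
        · filter_upwards [hne] with y hy
          have := cp ‖y‖ (norm_pos_iff.mpr hy)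
          simp only [hu]
          fun_prop
      obtain ⟨Φ, hΦ, hΦe⟩ := hreg g (solidTest f hf hRa h0 h1 ℓ)
      set xs : ℕ → unitInterval := fun n => ⟨1 / ((n : ℝ) + 1), by positivity, by
        rw [div_le_one (by positivity)]
        have : (0 : ℝ) ≤ n := n.cast_nonneg
        linarith⟩ with hxs
      have hxs0 : Tendsto xs atTop (𝓝 0) := by
        rw [tendsto_subtype_rng]
        exact tendsto_one_div_add_atTop_nhds_zero_nat
      have hκs : Tendsto (fun n => κ (xs n)) atTop (𝓝 (k : ℂ)) := by
        have := (cκ.tendsto 0).comp hxs0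
        rwa [κ0] at this
      have him : ∀ n, 0 < (κ (xs n)).im := by
        intro n
        have h1 : (0 : ℝ) < (n : ℝ) + 1 := by positivity
        have e : κ (xs n) = ⟨k, δ * (1 / ((n : ℝ) + 1))⟩ := by
          apply Complex.ext <;> simp [hκ, hxs, -Complex.ofReal_div, -Complex.ofReal_add]
        rw [e]
        exact mul_pos hδ (one_div_pos.mpr h1)
      have hκs' : Tendsto (fun n => κ (xs n)) atTop (𝓝[{z : ℂ | 0 < z.im}] (k : ℂ)) :=
        tendsto_nhdsWithin_iff.mpr ⟨hκs, Eventually.of_forall him⟩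
      have lim1 : Tendsto (fun n => W (xs n) * Φ (κ (xs n))) atTop (𝓝 (0 * Φ k)) := by
        have hw1 := (cW.tendsto 0).comp hxs0
        rw [hW0'] at hw1
        exact hw1.mul ((hΦ.continuousAt.tendsto).comp hκs)
      have lim2 : Tendsto (fun n => ∫ y : Space, g y * u (xs n) y) atTop
          (𝓝 (∫ y : Space, g y * u 0 y)) := (cpair.tendsto 0).comp hxs0
      rw [zero_mul] at lim1
      refine tendsto_nhds_unique (lim2.congr' ?_) lim1
      filter_upwards [hκs'.eventually hΦe] with n hn
      obtain ⟨T, hT, hTΦ⟩ := hn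
      rw [← hTΦ]
      exact (wronskian_mul_kernelPairing hv hk (hadm (xs n)) (him n) (hφx (xs n)) hT f hf hab
        h0 h1 g).symm
    have cu : ContinuousOn (u 0) {0}ᶜ :=
      (cz.pow ℓ).continuousOn.mul (continuousOn_comp_norm (cpr 0))
    have hopen : IsOpen ({0}ᶜ : Set Space) := isOpen_compl_singleton
    have uae : ∀ᵐ y : Space, y ∈ ({0}ᶜ : Set Space) → u 0 y = 0 := by
      refine hopen.ae_eq_zero_of_integral_contDiff_smul_eq_zero
        (cu.locallyIntegrableOn hopen.measurableSet) fun g hg hgk _ => ?_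
      have := pairing0 ⟨fun y => (g y : ℂ), Complex.ofRealCLM.contDiff.comp hg,
        hgk.comp_left Complex.ofReal_zero, fun _ _ => trivial⟩
      exact (integral_congr_ae (Eventually.of_forall fun y => Complex.real_smul)).trans this
    have u0 : Set.EqOn (u 0) 0 ({0}ᶜ : Set Space) := by
      refine Measure.eqOn_open_of_ae_eq (μ := (volume : Measure Space)) ?_ hopen cu continuousOn_const
      rw [EventuallyEq, ae_restrict_iff' hopen.measurableSet]
      exact uae
    have p0 : ∀ r, 0 < r → p 0 r = 0 := by
      intro r hr
      have hy : EuclideanSpace.single (0 : Fin 3) r ∈ ({0}ᶜ : Set Space) := by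
        simp [hr.ne']
      have h2 := u0 hy
      have e1 : ‖(EuclideanSpace.single (0 : Fin 3) r : Space)‖ = r := by
        simp [abs_of_pos hr]
      have e2 : isotropicForm (EuclideanSpace.single (0 : Fin 3) r) = r := by
        simp [isotropicForm, isotropic, Fin.sum_univ_three]
      simp only [hu, e1, e2, Pi.zero_apply] at h2
      refine (mul_eq_zero.mp h2).resolve_left (pow_ne_zero _ ?_)
      exact_mod_cast hr.ne'
    -- near the origin the solution is a multiple of the regular one
    have hi : IntervalIntegrable (fun t => ψ 0 t * F t) volume Ra b :=
      (((hψx 0).fst.continuousOn.mul cF.continuousOn).mono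
        (uIcc_subset_Ioi hRa hb)).intervalIntegrable
    have h3 : ∀ᶠ r in 𝓝[>] (0 : ℝ), r ∈ Set.Ioc 0 Ra := Ioc_mem_nhdsGT hRa
    have h4 := (hφx 0).tendsto.eventually_ne one_ne_zero
    obtain ⟨r, hr, hrne⟩ := (h3.and h4).exists
    have h5 := p0 r hr.1
    simp only [hp, hw] at h5
    rw [paramVariation_of_le F0 hi hr.2, mul_div_right_comm] at h5
    exact (mul_eq_zero.mp h5).resolve_left hrne
  -- hence the outgoing wave vanishes beyond `Ra`
  have hψ0 : ∀ᵐ r : ℝ, r ∈ Set.Ioi Ra → ψ 0 r * (r : ℂ) ^ (ℓ + 1) = 0 := by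
    have c0 : ContinuousOn (fun r : ℝ => ψ 0 r * (r : ℂ) ^ (ℓ + 1)) (Set.Ioi Ra) :=
      ((hψx 0).fst.continuousOn.mono (Set.Ioi_subset_Ioi hRa.le)).mul (by fun_prop)
    refine isOpen_Ioi.ae_eq_zero_of_integral_contDiff_smul_eq_zero
      (c0.locallyIntegrableOn measurableSet_Ioi) fun g hg hgk hgs => ?_
    obtain ⟨X, hX⟩ := hgk.isBounded.subset_closedBall 0
    set b := max Ra (X + 1) with hb
    have g0 : ∀ r, r ≤ Ra → g r = 0 := fun r hr =>
      image_eq_zero_of_notMem_tsupport fun h => absurd (hgs h) (not_lt.mpr hr)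
    have g1 : ∀ r, b ≤ r → g r = 0 := fun r hr =>
      image_eq_zero_of_notMem_tsupport fun h => by
        have h1 := hX h
        rw [mem_closedBall_zero_iff, Real.norm_eq_abs] at h1
        linarith [le_abs_self r, le_max_right Ra (X + 1)]
    have h2 := vanish g hg b (le_max_left _ _) g0 g1
    rw [intervalIntegral.integral_of_le (le_max_left _ _)] at h2
    rw [← setIntegral_eq_integral_of_forall_compl_eq_zero (s := Set.Ioc Ra b), ← h2]
    · refine setIntegral_congr_fun measurableSet_Ioc fun r _ => ?_
      simp only [Complex.real_smul]
      ring
    · intro r hr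
      rcases le_or_gt r Ra with h | h
      · simp [g0 r h]
      · have : b ≤ r := by
          by_contra h'
          exact hr ⟨h, (not_le.mp h').le⟩
        simp [g1 r this]
  have hψe : Set.EqOn (fun r : ℝ => ψ 0 r * (r : ℂ) ^ (ℓ + 1)) 0 (Set.Ioi Ra) := by
    refine Measure.eqOn_open_of_ae_eq (μ := (volume : Measure ℝ)) ?_ isOpen_Ioi
      (((hψx 0).fst.continuousOn.mono (Set.Ioi_subset_Ioi hRa.le)).mul (by fun_prop))
      continuousOn_const
    rw [EventuallyEq, ae_restrict_iff' measurableSet_Ioi]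
    exact hψ0
  obtain ⟨c, hc0, hc⟩ := tendsto_norm_coulombWave hk α ℓ
  obtain ⟨r, hr, hrR⟩ := ((hc.eventually_ne hc0.ne').and (eventually_gt_atTop Ra)).exists
  have h6 := hψe hrR
  simp only [hψ, κ0, Pi.zero_apply] at h6
  have h7 : (r : ℂ) ≠ 0 := by exact_mod_cast (hRa.trans hrR).ne'
  exact hr (norm_eq_zero.mpr ((mul_eq_zero.mp h6).resolve_right (pow_ne_zero _ h7)))

/-! ### Weak solutions on the half-line -/

section Coefficient

variable {vt : ℝ → ℂ} {B : ℝ} {ℓ : ℕ} {z : ℂ}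

theorem norm_radialCoeff_le (hB : ∀ᵐ r, 0 < r → ‖vt r‖ ≤ B) :
    ∀ᵐ r, 0 < r → ‖radialCoeff vt ℓ z r‖ ≤ ℓ * (ℓ + 1) / r ^ 2 + (B + ‖z‖) := by
  filter_upwards [hB] with r hr hr0
  rw [radialCoeff]
  refine (norm_sub_le _ _).trans ?_
  rw [← add_assoc]
  refine add_le_add_left ((norm_add_le _ _).trans (add_le_add ?_ (hr hr0))) _
  rw [Complex.norm_real, Real.norm_eq_abs, abs_of_nonneg (by positivity)]

theorem aestronglyMeasurable_radialCoeff
    (hm : AEStronglyMeasurable vt (volume.restrict (Set.Ioi 0))) :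
    AEStronglyMeasurable (radialCoeff vt ℓ z) (volume.restrict (Set.Ioi 0)) :=
  ((Measurable.aestronglyMeasurable (by fun_prop)).add hm).sub aestronglyMeasurable_const

theorem intervalIntegrable_radialCoeff
    (hm : AEStronglyMeasurable vt (volume.restrict (Set.Ioi 0)))
    (hB : ∀ᵐ r, 0 < r → ‖vt r‖ ≤ B) {a b : ℝ} (ha : 0 < a) (hb : 0 < b) :
    IntervalIntegrable (radialCoeff vt ℓ z) volume a b := by
  have hsub : Set.uIoc a b ⊆ Set.Ioi 0 := Set.uIoc_subset_uIcc.trans (uIcc_subset_Ioi ha hb)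
  have hc : ContinuousOn (fun r : ℝ => (ℓ * (ℓ + 1) / r ^ 2 + (B + ‖z‖) : ℝ)) (Set.uIcc a b) := by
    refine ContinuousOn.add (continuousOn_const.div (by fun_prop) fun r hr => ?_)
      continuousOn_const
    exact pow_ne_zero _ (uIcc_subset_Ioi ha hb hr).ne'
  refine hc.intervalIntegrable.mono_fun' ((aestronglyMeasurable_radialCoeff hm).mono_set hsub) ?_
  filter_upwards [ae_restrict_of_ae (norm_radialCoeff_le (ℓ := ℓ) (z := z) hB),
    self_mem_ae_restrict measurableSet_uIoc] with r hr hr' using hr (hsub hr')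

end Coefficient

theorem RadialTest.hasDerivAt (η : RadialTest) (r : ℝ) :
    HasDerivAt (η : ℝ → ℂ) (deriv (η : ℝ → ℂ) r) r :=
  ((η.contDiff.differentiable (by simp)) r).hasDerivAt

theorem RadialTest.contDiff_deriv (η : RadialTest) :
    ContDiff ℝ (⊤ : ℕ∞) (deriv (η : ℝ → ℂ)) :=
  (contDiff_infty_iff_deriv.mp η.contDiff).2

theorem RadialTest.hasDerivAt_deriv (η : RadialTest) (r : ℝ) :
    HasDerivAt (deriv (η : ℝ → ℂ)) (deriv (deriv (η : ℝ → ℂ)) r) r :=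
  ((η.contDiff_deriv.differentiable (by simp)) r).hasDerivAt

theorem RadialTest.continuous_deriv_deriv (η : RadialTest) :
    Continuous (deriv (deriv (η : ℝ → ℂ))) :=
  (contDiff_infty_iff_deriv.mp η.contDiff_deriv).2.continuous

/-- A test function and its derivatives vanish off a compact interval, which may be taken to
contain any given point. -/
theorem RadialTest.exists_support (η : RadialTest) {r₀ : ℝ} (hr₀ : 0 < r₀) :
    ∃ a b, 0 < a ∧ a < r₀ ∧ r₀ < b ∧ ∀ r, r ∉ Set.Ioo a b →
      η r = 0 ∧ deriv (η : ℝ → ℂ) r = 0 ∧ deriv (deriv (η : ℝ → ℂ)) r = 0 := by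
  have hK : IsCompact (tsupport η ∪ {r₀}) := η.hasCompactSupport.isCompact.union isCompact_singleton
  have hne : (tsupport η ∪ {r₀}).Nonempty := ⟨r₀, Or.inr rfl⟩
  obtain ⟨m, hm, hml⟩ := hK.exists_isLeast hne
  obtain ⟨M, hM, hMl⟩ := hK.exists_isGreatest hne
  have hm0 : 0 < m := by
    rcases hm with h | h
    · exact η.tsupport_subset h
    · rw [h]; exact hr₀
  have h1 : m ≤ r₀ := hml (Or.inr rfl)
  have h2 : r₀ ≤ M := hMl (Or.inr rfl)
  refine ⟨m / 2, M + 1, by linarith, by linarith, by linarith, fun r hr => ?_⟩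
  have hn : r ∉ tsupport η := fun h => hr ⟨by linarith [hml (Or.inl h)], by linarith [hMl (Or.inl h)]⟩
  have h3 : (η : ℝ → ℂ) =ᶠ[𝓝 r] fun _ => 0 := notMem_tsupport_iff_eventuallyEq.mp hn
  have h4 : deriv (η : ℝ → ℂ) =ᶠ[𝓝 r] fun _ => 0 := by
    have := h3.deriv
    simpa using this
  refine ⟨h3.self_of_nhds, h4.self_of_nhds, ?_⟩
  rw [h4.deriv_eq]
  simp

/-- Integration by parts of a solution against a test function. -/
theorem IsSolution.integral_mul_test {q u u' : ℝ → ℂ} (h : IsSolution q u u') (η : RadialTest)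
    {a b : ℝ} (ha : 0 < a) (hb : 0 < b) :
    ∫ r in a..b, u r * (-deriv (deriv (η : ℝ → ℂ)) r + q r * η r)
      = (u' b * η b - u b * deriv (η : ℝ → ℂ) b) - (u' a * η a - u a * deriv (η : ℝ → ℂ) a) := by
  have h1 : IsPrimitive (deriv (η : ℝ → ℂ)) η :=
    isPrimitive_of_hasDerivAt (fun r _ => η.hasDerivAt r) η.contDiff_deriv.continuous.continuousOn
  have h2 : IsPrimitive (deriv (deriv (η : ℝ → ℂ))) (deriv (η : ℝ → ℂ)) :=
    isPrimitive_of_hasDerivAt (fun r _ => η.hasDerivAt_deriv r)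
      η.continuous_deriv_deriv.continuousOn
  have h3 : IsPrimitive (fun r => u r * (-deriv (deriv (η : ℝ → ℂ)) r + q r * η r))
      (fun r => u' r * η r - u r * deriv (η : ℝ → ℂ) r) :=
    ((h.snd.mul h1).sub (h.fst.mul h2)).congr (fun r _ => by ring) (fun r _ => rfl)
  exact (h3.sub_eq a b ha hb).symm

/-- The antiderivative of a function of compact support and mean zero. -/
theorem exists_antideriv_compact {ζ : ℝ → ℂ} (hζ : ContDiff ℝ (⊤ : ℕ∞) ζ) {a b : ℝ}
    (h0 : ∀ r, r ∉ Set.Ioo a b → ζ r = 0) (hint : ∫ r in a..b, ζ r = 0) :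
    ∃ θ : ℝ → ℂ, ContDiff ℝ (⊤ : ℕ∞) θ ∧ (∀ r, r ∉ Set.Ioo a b → θ r = 0) ∧
      ∀ r, HasDerivAt θ (ζ r) r := by
  have hd : ∀ r, HasDerivAt (fun r => ∫ t in a..r, ζ t) (ζ r) r := fun r =>
    (hζ.continuous.integral_hasStrictDerivAt a r).hasDerivAt
  refine ⟨fun r => ∫ t in a..r, ζ t, ?_, fun r hr => ?_, hd⟩
  · rw [contDiff_infty_iff_deriv]
    refine ⟨fun r => (hd r).differentiableAt, ?_⟩
    rwa [show deriv (fun r => ∫ t in a..r, ζ t) = ζ from funext fun r => (hd r).deriv]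
  · have hz : ∀ c, (∀ t ∈ Set.uIcc c r, ζ t = 0) → ∫ t in c..r, ζ t = 0 := fun c hc => by
      rw [intervalIntegral.integral_congr (g := fun _ => (0 : ℂ)) hc,
        intervalIntegral.integral_zero]
    rcases le_or_gt r a with h | h
    · refine hz a fun t ht => h0 t fun ht' => ?_
      rw [Set.uIcc_of_ge h] at ht
      exact absurd ht'.1 (not_lt.mpr ht.2)
    · have hbr : b ≤ r := by
        by_contra h'
        exact hr ⟨h, not_le.mp h'⟩
      change ∫ t in a..r, ζ t = 0
      rw [← intervalIntegral.integral_add_adjacent_intervals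
        (hζ.continuous.intervalIntegrable a b) (hζ.continuous.intervalIntegrable b r), hint,
        zero_add]
      refine hz b fun t ht => h0 t fun ht' => ?_
      rw [Set.uIcc_of_le hbr] at ht
      exact absurd ht'.2 (not_lt.mpr ht.1)

theorem tsupport_subset_of_notMem_Ioo {ζ : ℝ → ℂ} {a b : ℝ}
    (h0 : ∀ r, r ∉ Set.Ioo a b → ζ r = 0) : tsupport ζ ⊆ Set.Icc a b :=
  closure_minimal (fun _ hr => Set.Ioo_subset_Icc_self (by_contra fun h => hr (h0 _ h))) isClosed_Icc

/-- A smooth function vanishing off `(a, b)`, `0 < a`, as a test function on the half-line. -/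
def radialTestOf (ζ : ℝ → ℂ) (hζ : ContDiff ℝ (⊤ : ℕ∞) ζ) {a b : ℝ} (ha : 0 < a)
    (h0 : ∀ r, r ∉ Set.Ioo a b → ζ r = 0) : RadialTest where
  toFun := ζ
  contDiff' := hζ
  hasCompactSupport' := HasCompactSupport.of_support_subset_isCompact isCompact_Icc
    ((subset_tsupport ζ).trans (tsupport_subset_of_notMem_Ioo h0))
  tsupport_subset' := (tsupport_subset_of_notMem_Ioo h0).trans fun _ hr => ha.trans_le hr.1

theorem setIntegral_Ioi_eq_of_notMem_Ioo {g : ℝ → ℂ} {a b : ℝ} (ha : 0 < a) (hab : a ≤ b)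
    (h0 : ∀ r, r ∉ Set.Ioo a b → g r = 0) :
    ∫ r in Set.Ioi (0 : ℝ), g r = ∫ r in a..b, g r := by
  rw [intervalIntegral.integral_of_le hab]
  refine setIntegral_eq_of_subset_of_forall_sdiff_eq_zero measurableSet_Ioi
    (fun r hr => ha.trans hr.1) fun r hr => h0 r fun h => hr.2 ⟨h.1, h.2.le⟩

/-- The lemma of du Bois-Reymond of second order: a continuous function whose second distributional
derivative vanishes is affine. -/
theorem eq_affine_of_integral_mul_deriv_deriv {h : ℝ → ℂ} (hh : ContinuousOn h (Set.Ioi 0))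
    (hint : ∀ η : RadialTest,
      ∫ r in Set.Ioi (0 : ℝ), h r * deriv (deriv (η : ℝ → ℂ)) r = 0) :
    ∃ c₀ c₁ : ℂ, ∀ r, 0 < r → h r = c₀ + c₁ * r := by
  -- a normalised bump
  let ρb : ContDiffBump (2 : ℝ) := ⟨1 / 4, 1 / 2, by norm_num, by norm_num⟩
  set ρ : ℝ → ℂ := fun r => (ρb.normed volume r : ℂ) with hρ
  have sρ : ContDiff ℝ (⊤ : ℕ∞) ρ := Complex.ofRealCLM.contDiff.comp ρb.contDiff_normed
  have zρ : ∀ r, r ∉ Set.Ioo (1 : ℝ) 3 → ρ r = 0 := by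
    intro r hr
    have : r ∉ Function.support (ρb.normed volume) := by
      rw [ρb.support_normed_eq, Real.ball_eq_Ioo]
      intro h'
      have h1 : (2 : ℝ) - 1 / 2 < r := h'.1
      have h2 : r < (2 : ℝ) + 1 / 2 := h'.2
      exact hr ⟨by linarith, by linarith⟩
    simp [hρ, Function.notMem_support.mp this]
  have iρ : ∀ a b : ℝ, a ≤ 1 → 3 ≤ b → ∫ r in a..b, ρ r = 1 := by
    intro a b ha hb
    rw [intervalIntegral.integral_of_le (by linarith),
      setIntegral_eq_integral_of_forall_compl_eq_zero]
    · simp only [hρ]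
      exact (integral_ofReal (𝕜 := ℂ) (f := ρb.normed volume)).trans
        (by rw [ρb.integral_normed]; simp)
    · intro r hr
      exact zρ r fun h' => hr ⟨by linarith [h'.1], by linarith [h'.2]⟩
  have sρ' := (contDiff_infty_iff_deriv.mp sρ).2
  set A := ∫ r in (1 : ℝ)..3, h r * deriv ρ r with hA
  set B₀ := ∫ r in (1 : ℝ)..3, h r * ρ r with hB₀
  set m := ∫ r in (1 : ℝ)..3, (r : ℂ) * ρ r with hm
  have z'ρ : ∀ r, r ∉ Set.Icc (1 : ℝ) 3 → deriv ρ r = 0 := by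
    intro r hr
    have : ρ =ᶠ[𝓝 r] fun _ => 0 := by
      filter_upwards [isClosed_Icc.isOpen_compl.mem_nhds hr] with s hs
      exact zρ s fun h' => hs (Set.Ioo_subset_Icc_self h')
    rw [this.deriv_eq, deriv_const]
  have ext : ∀ (g : ℝ → ℂ) (a b : ℝ), a ≤ 1 → 3 ≤ b → (∀ r, r ∉ Set.Icc (1 : ℝ) 3 → g r = 0) →
      ∫ r in a..b, g r = ∫ r in (1 : ℝ)..3, g r := by
    intro g a b ha hb hg
    rw [intervalIntegral.integral_of_le (by linarith), intervalIntegral.integral_of_le (by norm_num),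
      ← integral_Icc_eq_integral_Ioc, ← integral_Icc_eq_integral_Ioc]
    exact setIntegral_eq_of_subset_of_forall_sdiff_eq_zero measurableSet_Icc
      (Set.Icc_subset_Icc ha hb) fun r hr => hg r hr.2
  -- every test function is a second derivative up to a combination of `ρ` and `ρ'`
  have main : ∀ (ζ : ℝ → ℂ), ContDiff ℝ (⊤ : ℕ∞) ζ → ∀ a b, 0 < a → a ≤ 1 → 3 ≤ b →
      (∀ r, r ∉ Set.Ioo a b → ζ r = 0) →
      ∫ r in a..b, (h r - (B₀ + A * m) + A * r) * ζ r = 0 := by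
    intro ζ hζ a b ha ha1 hb3 hζ0
    have hab : a ≤ b := by linarith
    have hb : 0 < b := by linarith
    have zρ' : ∀ r, r ∉ Set.Ioo a b → ρ r = 0 := fun r hr =>
      zρ r fun h' => hr ⟨by linarith [h'.1], by linarith [h'.2]⟩
    have ii : ∀ f g : ℝ → ℂ, ContinuousOn f (Set.Ioi 0) → Continuous g →
        IntervalIntegrable (fun r => f r * g r) volume a b := fun f g hf hg =>
      ((hf.mul hg.continuousOn).mono (uIcc_subset_Ioi ha hb)).intervalIntegrable
    have ic : ∀ f : ℝ → ℂ, Continuous f → IntervalIntegrable f volume a b := fun f hf =>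
      hf.intervalIntegrable _ _
    set Z := ∫ r in a..b, ζ r with hZ
    have cζ := hζ.continuous
    have cρ := sρ.continuous
    have cρ' := sρ'.continuous
    obtain ⟨θ, sθ, zθ, dθ⟩ := exists_antideriv_compact (ζ := fun r => ζ r - Z * ρ r)
      (hζ.sub (contDiff_const.mul sρ)) (fun r hr => by simp [hζ0 r hr, zρ' r hr]) (by
        rw [intervalIntegral.integral_sub (ic _ cζ) (ic _ (by fun_prop)),
          intervalIntegral.integral_const_mul, iρ a b ha1 hb3, mul_one, sub_self])
    have cθ := sθ.continuous
    set Y := ∫ r in a..b, θ r with hY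
    obtain ⟨η, sη, zη, dη⟩ := exists_antideriv_compact (ζ := fun r => θ r - Y * ρ r)
      (sθ.sub (contDiff_const.mul sρ)) (fun r hr => by simp [zθ r hr, zρ' r hr]) (by
        rw [intervalIntegral.integral_sub (ic _ cθ) (ic _ (by fun_prop)),
          intervalIntegral.integral_const_mul, iρ a b ha1 hb3, mul_one, sub_self])
    have d2 : deriv (deriv η) = fun r => ζ r - Z * ρ r - Y * deriv ρ r := by
      have : deriv η = fun r => θ r - Y * ρ r := funext fun r => (dη r).deriv
      rw [this]
      funext r
      exact ((dθ r).sub (((sρ.differentiable (by simp)) r).hasDerivAt.const_mul Y)).deriv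
    have k1 := hint (radialTestOf η sη ha zη)
    rw [show (radialTestOf η sη ha zη : ℝ → ℂ) = η from rfl, d2,
      setIntegral_Ioi_eq_of_notMem_Ioo (a := a / 2) (b := b + 1) (by linarith) (by linarith)
      (fun r hr => by
        have hr' : r ∉ Set.Ioo a b := fun h' => hr ⟨by linarith [h'.1], by linarith [h'.2]⟩
        have hr'' : r ∉ Set.Icc (1 : ℝ) 3 := fun h' => hr ⟨by linarith [h'.1], by linarith [h'.2]⟩
        simp [hζ0 r hr', zρ' r hr', z'ρ r hr''])] at k1
    have k3 : ∫ r in a..b, h r * (ζ r - Z * ρ r - Y * deriv ρ r) = 0 := by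
      rw [← k1, intervalIntegral.integral_of_le (by linarith),
        intervalIntegral.integral_of_le (by linarith), ← integral_Icc_eq_integral_Ioc,
        ← integral_Icc_eq_integral_Ioc]
      refine (setIntegral_eq_of_subset_of_forall_sdiff_eq_zero measurableSet_Icc
        (Set.Icc_subset_Icc (by linarith) (by linarith)) fun r hr => ?_).symm
      have hr' : r ∉ Set.Ioo a b := fun h' => hr.2 (Set.Ioo_subset_Icc_self h')
      have hr'' : r ∉ Set.Icc (1 : ℝ) 3 := fun h' => hr.2 ⟨by linarith [h'.1], by linarith [h'.2]⟩
      simp [hζ0 r hr', zρ' r hr', z'ρ r hr'']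
    -- the mean of `θ` is minus the first moment of its derivative
    have k4 : Y = -(∫ r in a..b, (r : ℂ) * ζ r) + Z * m := by
      have p1 : IsPrimitive (fun r => ζ r - Z * ρ r) θ :=
        isPrimitive_of_hasDerivAt (fun r _ => dθ r) (by fun_prop)
      have p2 : IsPrimitive (fun _ => 1) (fun r : ℝ => (r : ℂ)) :=
        isPrimitive_of_hasDerivAt (fun r _ => (hasDerivAt_id (r : ℂ)).comp_ofReal)
          continuousOn_const
      have p3 := (p2.mul p1).sub_eq a b ha hb
      have za : θ a = 0 := zθ a (by simp)
      have zb : θ b = 0 := zθ b (by simp)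
      simp only [za, zb, mul_zero, sub_zero, one_mul] at p3
      rw [intervalIntegral.integral_add (ic _ cθ) (ic _ (by fun_prop)), ← hY] at p3
      have p4 : ∫ r in a..b, (r : ℂ) * (ζ r - Z * ρ r)
          = (∫ r in a..b, (r : ℂ) * ζ r) - Z * m := by
        rw [hm, ← ext (fun r => (r : ℂ) * ρ r) a b ha1 hb3 (fun r hr => by
          simp [zρ r fun h' => hr (Set.Ioo_subset_Icc_self h')]),
          ← intervalIntegral.integral_const_mul, ← intervalIntegral.integral_sub
          (ic _ (by fun_prop)) (ic _ (by fun_prop))]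
        refine intervalIntegral.integral_congr fun r _ => ?_
        ring
      rw [p4] at p3
      linear_combination -p3
    have k5 : ∫ r in a..b, h r * (ζ r - Z * ρ r - Y * deriv ρ r)
        = (∫ r in a..b, h r * ζ r) - Z * B₀ - Y * A := by
      rw [hB₀, hA, ← ext (fun r => h r * ρ r) a b ha1 hb3 (fun r hr => by
          simp [zρ r fun h' => hr (Set.Ioo_subset_Icc_self h')]),
        ← ext (fun r => h r * deriv ρ r) a b ha1 hb3 (fun r hr => by simp [z'ρ r hr]),
        ← intervalIntegral.integral_const_mul, ← intervalIntegral.integral_const_mul,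
        ← intervalIntegral.integral_sub (ii _ _ hh cζ) ((ii _ _ hh cρ).const_mul _),
        ← intervalIntegral.integral_sub ((ii _ _ hh cζ).sub ((ii _ _ hh cρ).const_mul _))
          ((ii _ _ hh cρ').const_mul _)]
      refine intervalIntegral.integral_congr fun r _ => ?_
      ring
    have k6 : ∫ r in a..b, (h r - (B₀ + A * m) + A * r) * ζ r
        = (∫ r in a..b, h r * ζ r) - (B₀ + A * m) * Z + A * ∫ r in a..b, (r : ℂ) * ζ r := by
      have e : ∀ r : ℝ, (h r - (B₀ + A * m) + A * r) * ζ r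
          = h r * ζ r - (B₀ + A * m) * ζ r + A * (r * ζ r) := fun r => by ring
      simp only [e]
      have j1 := ii _ _ hh cζ
      have j2 := (ic _ cζ).const_mul (B₀ + A * m)
      have j3 : IntervalIntegrable (fun r : ℝ => (r : ℂ) * ζ r) volume a b := ic _ (by fun_prop)
      rw [intervalIntegral.integral_add (j1.sub j2) (j3.const_mul A),
        intervalIntegral.integral_sub j1 j2, intervalIntegral.integral_const_mul,
        intervalIntegral.integral_const_mul]
    rw [k5, k4] at k3
    rw [k6]
    linear_combination k3
  set D : ℝ → ℂ := fun r => h r - (B₀ + A * m) + A * r with hD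
  have cD : ContinuousOn D (Set.Ioi 0) := (hh.sub continuousOn_const).add (by fun_prop)
  have Dae : ∀ᵐ r : ℝ, r ∈ Set.Ioi (0 : ℝ) → D r = 0 := by
    refine isOpen_Ioi.ae_eq_zero_of_integral_contDiff_smul_eq_zero
      (cD.locallyIntegrableOn measurableSet_Ioi) fun g hg hgk hgs => ?_
    have sg : ContDiff ℝ (⊤ : ℕ∞) fun r => (g r : ℂ) := Complex.ofRealCLM.contDiff.comp hg
    obtain ⟨a, b, ha, ha2, hb2, hz⟩ := RadialTest.exists_support
      ⟨fun r => (g r : ℂ), sg, hgk.comp_left Complex.ofReal_zero, by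
        refine Set.Subset.trans (closure_mono fun r hr => ?_) hgs
        exact fun h0 => hr (by simp [h0])⟩ (r₀ := 2) two_pos
    have hz' : ∀ r, r ∉ Set.Ioo (min a 1) (max b 3) → (g r : ℂ) = 0 := fun r hr =>
      (hz r fun h' => hr ⟨(min_le_left _ _).trans_lt h'.1, h'.2.trans_le (le_max_left _ _)⟩).1
    have k := main _ sg (min a 1) (max b 3) (lt_min ha one_pos) (min_le_right _ _)
      (le_max_right _ _) hz'
    have hle : min a 1 ≤ max b 3 :=
      (min_le_right _ _).trans ((by norm_num : (1 : ℝ) ≤ 3).trans (le_max_right _ _))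
    rw [intervalIntegral.integral_of_le hle] at k
    rw [← setIntegral_eq_integral_of_forall_compl_eq_zero
      (s := Set.Ioc (min a 1) (max b 3)), ← k]
    · refine setIntegral_congr_fun measurableSet_Ioc fun r _ => ?_
      simp only [Complex.real_smul, hD]
      ring
    · intro r hr
      have := hz' r fun h' => hr (Set.Ioo_subset_Ioc_self h')
      rw [Complex.real_smul, this, zero_mul]
  have De : Set.EqOn D 0 (Set.Ioi 0) := by
    refine Measure.eqOn_open_of_ae_eq (μ := (volume : Measure ℝ)) ?_ isOpen_Ioi cD
      continuousOn_const
    rw [EventuallyEq, ae_restrict_iff' measurableSet_Ioi]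
    exact Dae
  refine ⟨B₀ + A * m, -A, fun r hr => ?_⟩
  have := De hr
  simp only [hD, Pi.zero_apply] at this
  linear_combination this

/-- Regularity of weak solutions: a continuous distributional solution of `u'' = q u` is a
solution. -/
theorem exists_isSolution_of_weak {q D : ℝ → ℂ} (hD : ContinuousOn D (Set.Ioi 0))
    (hq : ∀ a b, 0 < a → 0 < b → IntervalIntegrable q volume a b)
    (hw : ∀ η : RadialTest, ∫ r in Set.Ioi (0 : ℝ),
      D r * (-deriv (deriv (η : ℝ → ℂ)) r + q r * η r) = 0) :
    ∃ D' : ℝ → ℂ, IsSolution q D D' := by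
  have hqD : ∀ a b, 0 < a → 0 < b → IntervalIntegrable (fun r => q r * D r) volume a b :=
    fun a b ha hb => (hq a b ha hb).mul_continuousOn (hD.mono (uIcc_subset_Ioi ha hb))
  set E' : ℝ → ℂ := fun r => ∫ t in (1 : ℝ)..r, q t * D t with hE'
  have pE' : IsPrimitive (fun r => q r * D r) E' := ⟨hqD, fun a b ha hb =>
    intervalIntegral.integral_interval_sub_left (hqD 1 b one_pos hb) (hqD 1 a one_pos ha)⟩
  have iE' : ∀ a b, 0 < a → 0 < b → IntervalIntegrable E' volume a b := fun a b ha hb =>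
    (pE'.continuousOn.mono (uIcc_subset_Ioi ha hb)).intervalIntegrable
  set E : ℝ → ℂ := fun r => ∫ t in (1 : ℝ)..r, E' t with hE
  have pE : IsPrimitive E' E := ⟨iE', fun a b ha hb =>
    intervalIntegral.integral_interval_sub_left (iE' 1 b one_pos hb) (iE' 1 a one_pos ha)⟩
  obtain ⟨c₀, c₁, hc⟩ := eq_affine_of_integral_mul_deriv_deriv (h := fun r => D r - E r)
    (hD.sub pE.continuousOn) (fun η => by
      obtain ⟨a, b, ha, ha1, hb1, hz⟩ := η.exists_support one_pos
      have hb : 0 < b := by linarith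
      have hab : a ≤ b := by linarith
      have w := hw η
      rw [setIntegral_Ioi_eq_of_notMem_Ioo ha hab
        (fun r hr => by simp [hz r hr])] at w ⊢
      have h1 : IsPrimitive (deriv (η : ℝ → ℂ)) η := isPrimitive_of_hasDerivAt
        (fun r _ => η.hasDerivAt r) η.contDiff_deriv.continuous.continuousOn
      have h2 : IsPrimitive (deriv (deriv (η : ℝ → ℂ))) (deriv (η : ℝ → ℂ)) :=
        isPrimitive_of_hasDerivAt (fun r _ => η.hasDerivAt_deriv r)
          η.continuous_deriv_deriv.continuousOn
      have p3 := ((pE.mul h2).sub (pE'.mul h1)).sub_eq a b ha hb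
      have za := hz a (by simp)
      have zb := hz b (by simp)
      simp only [za.1, za.2.1, zb.1, zb.2.1, mul_zero, sub_zero] at p3
      have cc : ∀ {f g : ℝ → ℂ}, ContinuousOn f (Set.Ioi 0) → Continuous g →
          IntervalIntegrable (fun r => f r * g r) volume a b := fun hf hg =>
        ((hf.mul hg.continuousOn).mono (uIcc_subset_Ioi ha hb)).intervalIntegrable
      have cη2 := η.continuous_deriv_deriv
      have i1 := cc hD cη2
      have i2 := cc pE.continuousOn cη2
      have i3 : IntervalIntegrable (fun r => q r * D r * η r) volume a b :=
        (hqD a b ha hb).mul_continuousOn η.continuous.continuousOn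
      have e1 : ∫ r in a..b, (D r - E r) * deriv (deriv (η : ℝ → ℂ)) r
          = (∫ r in a..b, D r * deriv (deriv (η : ℝ → ℂ)) r)
            - ∫ r in a..b, E r * deriv (deriv (η : ℝ → ℂ)) r := by
        rw [← intervalIntegral.integral_sub i1 i2]
        simp only [sub_mul]
      have e2 : ∫ r in a..b, D r * (-deriv (deriv (η : ℝ → ℂ)) r + q r * η r)
          = (∫ r in a..b, q r * D r * η r) - ∫ r in a..b, D r * deriv (deriv (η : ℝ → ℂ)) r := by
        rw [← intervalIntegral.integral_sub i3 i1]
        refine intervalIntegral.integral_congr fun r _ => ?_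
        ring
      have e3 : (∫ r in a..b, E r * deriv (deriv (η : ℝ → ℂ)) r)
          - ∫ r in a..b, q r * D r * η r = 0 := by
        rw [← intervalIntegral.integral_sub i2 i3, p3]
        refine intervalIntegral.integral_congr fun r _ => ?_
        ring
      rw [e1]
      linear_combination -e3 - w + e2)
  have pr : IsPrimitive (fun _ => c₁) (fun r : ℝ => c₀ + c₁ * r) :=
    isPrimitive_of_hasDerivAt (fun r _ => by
      simpa using ((hasDerivAt_id (r : ℂ)).comp_ofReal.const_mul c₁).const_add c₀)
      continuousOn_const
  have pc : IsPrimitive (fun _ => 0) (fun _ : ℝ => c₁) :=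
    isPrimitive_of_hasDerivAt (fun r _ => hasDerivAt_const _ _) continuousOn_const
  refine ⟨fun r => E' r + c₁, (pE.add pr).congr (fun r _ => rfl) (fun r hr => ?_),
    (pE'.add pc).congr (fun r _ => by ring) (fun r _ => rfl)⟩
  rw [← hc r hr]
  ring

/-! ### The outgoing Green's function -/

/-- The Green's function `φ(r_<) ψ(r_>) / W` built from two solutions. -/
def greenOf (φ ψ : ℝ → ℂ) (W : ℂ) (r s : ℝ) : ℂ := φ (min r s) * ψ (max r s) / W

theorem greenOf_symm (φ ψ : ℝ → ℂ) (W : ℂ) (r s : ℝ) :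
    greenOf φ ψ W r s = greenOf φ ψ W s r := by
  rw [greenOf, greenOf, min_comm, max_comm]

theorem greenOf_of_le {φ ψ : ℝ → ℂ} {W : ℂ} {r s : ℝ} (h : r ≤ s) :
    greenOf φ ψ W r s = φ r * ψ s / W := by
  rw [greenOf, min_eq_left h, max_eq_right h]

theorem greenOf_of_ge {φ ψ : ℝ → ℂ} {W : ℂ} {r s : ℝ} (h : s ≤ r) :
    greenOf φ ψ W r s = φ s * ψ r / W := by
  rw [greenOf, min_eq_right h, max_eq_left h]

theorem continuousOn_greenOf {φ ψ : ℝ → ℂ} (hφ : ContinuousOn φ (Set.Ioi 0))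
    (hψ : ContinuousOn ψ (Set.Ioi 0)) (W : ℂ) {s : ℝ} (hs : 0 < s) :
    ContinuousOn (fun r => greenOf φ ψ W r s) (Set.Ioi 0) := by
  unfold greenOf
  refine ((hφ.comp (by fun_prop) fun r hr => ?_).mul (hψ.comp (by fun_prop) fun r hr => ?_)).div_const _
  · exact lt_min hr hs
  · exact (Set.mem_Ioi.mp hr).trans_le (le_max_left _ _)

/-- `-G'' + q G = δ_s`. -/
theorem integral_greenOf_mul {q φ φ' ψ ψ' : ℝ → ℂ} (hφ : IsSolution q φ φ')
    (hψ : IsSolution q ψ ψ') (hq : ∀ a b, 0 < a → 0 < b → IntervalIntegrable q volume a b)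
    {W : ℂ} (hW : ∀ r, 0 < r → φ' r * ψ r - φ r * ψ' r = W) (hW0 : W ≠ 0) {s : ℝ} (hs : 0 < s)
    (η : RadialTest) :
    ∫ r in Set.Ioi (0 : ℝ), greenOf φ ψ W r s
      * (-deriv (deriv (η : ℝ → ℂ)) r + q r * η r) = η s := by
  obtain ⟨a, b, ha, has, hsb, hz⟩ := η.exists_support hs
  have hb : 0 < b := hs.trans hsb
  rw [setIntegral_Ioi_eq_of_notMem_Ioo ha (has.trans hsb).le (fun r hr => by simp [hz r hr])]
  have cG := continuousOn_greenOf hφ.fst.continuousOn hψ.fst.continuousOn W hs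
  have cη := η.continuous_deriv_deriv
  have i : ∀ c d, 0 < c → 0 < d → IntervalIntegrable (fun r => greenOf φ ψ W r s
      * (-deriv (deriv (η : ℝ → ℂ)) r + q r * η r)) volume c d := fun c d hc hd =>
    ((cη.neg.intervalIntegrable c d).add ((hq c d hc hd).mul_continuousOn
      η.continuous.continuousOn)).continuousOn_mul (cG.mono (uIcc_subset_Ioi hc hd))
  rw [← intervalIntegral.integral_add_adjacent_intervals (i a s ha hs) (i s b hs hb)]
  have e1 : ∫ r in a..s, greenOf φ ψ W r s * (-deriv (deriv (η : ℝ → ℂ)) r + q r * η r)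
      = ψ s / W * ∫ r in a..s, φ r * (-deriv (deriv (η : ℝ → ℂ)) r + q r * η r) := by
    rw [← intervalIntegral.integral_const_mul]
    refine intervalIntegral.integral_congr fun r hr => ?_
    rw [Set.uIcc_of_le has.le] at hr
    simp only [greenOf_of_le hr.2]
    ring
  have e2 : ∫ r in s..b, greenOf φ ψ W r s * (-deriv (deriv (η : ℝ → ℂ)) r + q r * η r)
      = φ s / W * ∫ r in s..b, ψ r * (-deriv (deriv (η : ℝ → ℂ)) r + q r * η r) := by
    rw [← intervalIntegral.integral_const_mul]
    refine intervalIntegral.integral_congr fun r hr => ?_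
    rw [Set.uIcc_of_le hsb.le] at hr
    simp only [greenOf_of_ge hr.1]
    ring
  have za := hz a (by simp)
  have zb := hz b (by simp)
  rw [e1, e2, hφ.integral_mul_test η ha hs, hψ.integral_mul_test η hs hb, za.1, za.2.1, zb.1, zb.2.1]
  field_simp
  linear_combination (η s) * hW s hs

/-- A solution of order `O(r^(ℓ+1))` at the origin has vanishing Wronskian with the regular
solution. -/
theorem IsSolution.wronskian_eq_zero_of_isBigO {vt u u' φ φ' : ℝ → ℂ} {B : ℝ} {ℓ : ℕ} {z : ℂ}
    (hB : ∀ᵐ r, 0 < r → ‖vt r‖ ≤ B) (hu : IsSolution (radialCoeff vt ℓ z) u u')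
    (hφ : IsRegularSolution (radialCoeff vt ℓ z) ℓ φ φ')
    (hO : u =O[𝓝[>] (0 : ℝ)] (fun r : ℝ => r ^ (ℓ + 1))) {r : ℝ} (hr : 0 < r) :
    u' r * φ r - u r * φ' r = 0 := by
  obtain ⟨C, hC0, hC⟩ := hO.exists_pos
  rw [IsBigOWith, eventually_nhdsWithin_iff] at hC
  obtain ⟨δ₀, hδ₀, hδ⟩ := Metric.eventually_nhds_iff.mp hC
  set δ := min (δ₀ / 2) 1 with hδ_def
  have hδ0 : 0 < δ := lt_min (by positivity) one_pos
  have hδ1 : δ ≤ 1 := min_le_right _ _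
  have hub : ∀ s ∈ Set.Ioc 0 δ, ‖u s‖ ≤ C * s ^ (ℓ + 1) := by
    intro s hs
    have h1 : dist s 0 < δ₀ := by
      rw [Real.dist_0_eq_abs, abs_of_pos hs.1]
      have := hs.2.trans (min_le_left _ _)
      linarith
    have := hδ h1 hs.1
    rwa [Real.norm_eq_abs, abs_of_nonneg (pow_nonneg hs.1.le _)] at this
  obtain ⟨Cφ, hCφ0, hCφ⟩ := hφ.bound δ hδ0
  have hB' : ∀ᵐ r : ℝ, 0 < r → ‖vt r‖ ≤ max B 0 := by
    filter_upwards [hB] with s hs h0 using (hs h0).trans (le_max_left _ _)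
  set L : ℝ := ℓ * (ℓ + 1) + (max B 0 + ‖z‖) with hL
  have hL0 : 0 ≤ L := by positivity
  -- the derivative grows at most logarithmically
  have hu' : ∀ s ∈ Set.Ioc 0 δ, ‖u' s‖ ≤ ‖u' δ‖ + L * C * Real.log (δ / s) := by
    intro s hs
    have e : u' s = u' δ - ∫ t in s..δ, radialCoeff vt ℓ z t * u t := by
      rw [← hu.snd.sub_eq s δ hs.1 hδ0]
      ring
    have hi : IntervalIntegrable (fun t : ℝ => L * C * (1 / t)) volume s δ := by
      refine ContinuousOn.intervalIntegrable (continuousOn_const.mul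
        (continuousOn_const.div continuousOn_id fun t ht => ?_))
      exact (uIcc_subset_Ioi hs.1 hδ0 ht).ne'
    have h1 : ‖∫ t in s..δ, radialCoeff vt ℓ z t * u t‖ ≤ ∫ t in s..δ, L * C * (1 / t) := by
      refine intervalIntegral.norm_integral_le_of_norm_le hs.2 ?_ hi
      filter_upwards [norm_radialCoeff_le (ℓ := ℓ) (z := z) hB'] with t ht htm
      have ht0 : 0 < t := hs.1.trans htm.1
      have ht1 : t ≤ 1 := htm.2.trans hδ1
      have k1 : ‖radialCoeff vt ℓ z t‖ ≤ L / t ^ 2 := by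
        refine (ht ht0).trans ?_
        rw [hL, add_div]
        refine add_le_add_right ?_ _
        rw [le_div_iff₀ (by positivity)]
        exact mul_le_of_le_one_right (by positivity) (pow_le_one₀ ht0.le ht1)
      have k2 : ‖u t‖ ≤ C * t := by
        refine (hub t ⟨ht0, htm.2⟩).trans ?_
        gcongr
        rw [pow_succ]
        exact mul_le_of_le_one_left ht0.le (pow_le_one₀ ht0.le ht1)
      rw [norm_mul]
      calc _ ≤ L / t ^ 2 * (C * t) := mul_le_mul k1 k2 (norm_nonneg _) (by positivity)
        _ = _ := by field_simp
    rw [intervalIntegral.integral_const_mul, integral_one_div_of_pos hs.1 hδ0] at h1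
    rw [e]
    exact (norm_sub_le _ _).trans (add_le_add_right h1 _)
  have lim : Tendsto (fun s => u' s * φ s - u s * φ' s) (𝓝[>] 0) (𝓝 0) := by
    have l1 : Tendsto (fun s : ℝ => (‖u' δ‖ + L * C * Real.log δ) * Cφ * s
        - L * C * Cφ * (Real.log s * s ^ 1) + C * Cφ * s) (𝓝[>] 0) (𝓝 0) := by
      have t0 : Tendsto (fun s : ℝ => s) (𝓝[>] 0) (𝓝 0) :=
        tendsto_id.mono_left nhdsWithin_le_nhds
      have t1 : Tendsto (fun s : ℝ => Real.log s * s ^ 1) (𝓝[>] 0) (𝓝 0) := by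
        have := tendsto_log_mul_rpow_nhdsGT_zero (r := 1) one_pos
        simpa using this
      simpa using ((t0.const_mul ((‖u' δ‖ + L * C * Real.log δ) * Cφ)).sub
        (t1.const_mul (L * C * Cφ))).add (t0.const_mul (C * Cφ))
    refine squeeze_zero_norm' ?_ l1
    have h5 : ∀ᶠ e in 𝓝[>] (0 : ℝ), e ∈ Set.Ioc 0 δ := Ioc_mem_nhdsGT hδ0
    filter_upwards [h5] with s hs
    obtain ⟨b1, b2⟩ := hCφ s hs
    have hs1 : s ≤ 1 := hs.2.trans hδ1
    have hs0 := hs.1.le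
    have k1 : ‖φ s‖ ≤ Cφ * s := by
      refine b1.trans ?_
      gcongr
      rw [pow_succ]
      exact mul_le_of_le_one_left hs0 (pow_le_one₀ hs0 hs1)
    have k2 : ‖φ' s‖ ≤ Cφ := b2.trans (mul_le_of_le_one_right hCφ0 (pow_le_one₀ hs0 hs1))
    have k3 : ‖u s‖ ≤ C * s := by
      refine (hub s hs).trans ?_
      gcongr
      rw [pow_succ]
      exact mul_le_of_le_one_left hs0 (pow_le_one₀ hs0 hs1)
    have k4 := hu' s hs
    rw [Real.log_div hδ0.ne' hs.1.ne'] at k4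
    refine (norm_sub_le _ _).trans ?_
    rw [norm_mul, norm_mul]
    calc _ ≤ (‖u' δ‖ + L * C * (Real.log δ - Real.log s)) * (Cφ * s) + C * s * Cφ := by
          refine add_le_add (mul_le_mul k4 k1 (norm_nonneg _) ((norm_nonneg _).trans k4))
            (mul_le_mul k3 k2 (norm_nonneg _) (by positivity))
      _ = _ := by ring
  refine tendsto_nhds_unique (tendsto_const_nhds.congr' ?_) lim
  filter_upwards [self_mem_nhdsWithin] with s hs
  exact hu.wronskian_const hφ.isSolution hr hs

section

variable {vt : ℝ → ℂ} {α Ra k : ℝ} {ℓ : ℕ} {φ φ' ψ ψ' : ℝ → ℂ} {W : ℂ}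

/-- The outgoing solution on the half-line that continues the Coulomb wave. -/
theorem IsPotential.exists_outgoing (hv : IsPotential vt α Ra) (hk : 0 < k) (ℓ : ℕ) :
    ∃ ψ ψ' : ℝ → ℂ, IsSolution (radialCoeff vt ℓ ((k : ℂ) ^ 2)) ψ ψ' ∧
      ∀ r, Ra ≤ r → ψ r = coulombWave α k ℓ r ∧ ψ' r = coulombWaveDeriv α k ℓ r := by
  obtain ⟨B, hB0, hB⟩ := hv.exists_bound
  refine exists_isSolution_extension (isSolution_coulombWave hk (isAdmissible_ofReal α) ℓ)
    hv.radius_pos (fun r hr => by simp only [radialCoeff, hv.tail r hr])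
    (aestronglyMeasurable_radialCoeff hv.memLp_top.1) fun ε hε =>
      ⟨ℓ * (ℓ + 1) / ε ^ 2 + (B + ‖(k : ℂ) ^ 2‖), ?_⟩
  filter_upwards [norm_radialCoeff_le (ℓ := ℓ) (z := (k : ℂ) ^ 2) hB] with r hr hrε
  have hr0 : 0 < r := hε.trans hrε.1
  refine (hr hr0).trans ?_
  have := hrε.1.le
  gcongr

variable (hv : IsPotential vt α Ra) (hk : 0 < k)
  (hφ : IsRegularSolution (radialCoeff vt ℓ ((k : ℂ) ^ 2)) ℓ φ φ')
  (hψ : IsSolution (radialCoeff vt ℓ ((k : ℂ) ^ 2)) ψ ψ')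
  (hψe : ∀ r, Ra ≤ r → ψ r = coulombWave α k ℓ r ∧ ψ' r = coulombWaveDeriv α k ℓ r)
  (hW : ∀ r, 0 < r → φ' r * ψ r - φ r * ψ' r = W) (hW0 : W ≠ 0)
include hv hk hφ hψ hψe hW hW0

/-- Existence of the outgoing Green's function. -/
theorem isOutgoingGreen_greenOf : IsOutgoingGreen vt α k ℓ (greenOf φ ψ W) where
  continuousOn s hs :=
    continuousOn_greenOf hφ.isSolution.fst.continuousOn hψ.fst.continuousOn W hs
  equation s hs η := by
    obtain ⟨B, hB0, hB⟩ := hv.exists_bound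
    exact integral_greenOf_mul hφ.isSolution hψ
      (fun a b ha hb => intervalIntegrable_radialCoeff hv.memLp_top.1 hB ha hb) hW hW0 hs η
  origin s hs := by
    obtain ⟨C, hC0, hC⟩ := hφ.bound s hs
    refine IsBigO.of_bound (C * ‖ψ s / W‖) ?_
    have h5 : ∀ᶠ e in 𝓝[>] (0 : ℝ), e ∈ Set.Ioc 0 s := Ioc_mem_nhdsGT hs
    filter_upwards [h5] with r hr
    rw [greenOf_of_le hr.2, mul_div_assoc, norm_mul, Real.norm_eq_abs,
      abs_of_nonneg (pow_nonneg hr.1.le _)]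
    calc _ ≤ C * r ^ (ℓ + 1) * ‖ψ s / W‖ := by
          gcongr
          exact (hC r hr).1
      _ = _ := by ring
  infinity s hs := by
    obtain ⟨c, hc, hH⟩ := exists_isOutgoingCoulomb hk α ℓ
    refine ⟨_, hH, φ s / W / c, ?_⟩
    filter_upwards [eventually_ge_atTop (max s Ra)] with r hr
    rw [greenOf_of_ge ((le_max_left _ _).trans hr), (hψe r ((le_max_right _ _).trans hr)).1]
    field_simp

theorem IsOutgoingGreen.eq_greenOf {G : ℝ → ℝ → ℂ} (hG : IsOutgoingGreen vt α k ℓ G) {r s : ℝ}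
    (hr : 0 < r) (hs : 0 < s) : G r s = greenOf φ ψ W r s := by
  have hG₀ := isOutgoingGreen_greenOf hv hk hφ hψ hψe hW hW0
  obtain ⟨B, hB0, hB⟩ := hv.exists_bound
  have hq : ∀ a b, 0 < a → 0 < b →
      IntervalIntegrable (radialCoeff vt ℓ ((k : ℂ) ^ 2)) volume a b :=
    fun a b ha hb => intervalIntegrable_radialCoeff hv.memLp_top.1 hB ha hb
  set D : ℝ → ℂ := fun r => G r s - greenOf φ ψ W r s with hD
  have cD : ContinuousOn D (Set.Ioi 0) := (hG.continuousOn s hs).sub (hG₀.continuousOn s hs)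
  obtain ⟨D', hsol⟩ := exists_isSolution_of_weak cD hq fun η => by
    obtain ⟨a, b, ha, has, hsb, hz⟩ := η.exists_support hs
    have hab : a ≤ b := (has.trans hsb).le
    have hb : 0 < b := hs.trans hsb
    have e1 := hG.equation s hs η
    have e2 := hG₀.equation s hs η
    rw [setIntegral_Ioi_eq_of_notMem_Ioo ha hab (fun r hr => by simp [hz r hr])] at e1 e2 ⊢
    have i : ∀ g : ℝ → ℂ, ContinuousOn g (Set.Ioi 0) → IntervalIntegrable (fun r => g r
        * (-deriv (deriv (η : ℝ → ℂ)) r + radialCoeff vt ℓ ((k : ℂ) ^ 2) r * η r)) volume a b :=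
      fun g hg => ((η.continuous_deriv_deriv.neg.intervalIntegrable a b).add
        ((hq a b ha hb).mul_continuousOn η.continuous.continuousOn)).continuousOn_mul
        (hg.mono (uIcc_subset_Ioi ha hb))
    have e3 := intervalIntegral.integral_sub (i _ (hG.continuousOn s hs))
      (i _ (hG₀.continuousOn s hs))
    simp only [← sub_mul] at e3
    rw [e3]
    exact (congrArg₂ (· - ·) e1 e2).trans (sub_self _)
  -- at infinity both Green's functions are multiples of the outgoing wave
  obtain ⟨H, hH, c, hc⟩ := hG.infinity s hs
  obtain ⟨H₀, hH₀, c₀, hc₀⟩ := hG₀.infinity s hs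
  obtain ⟨d, hd⟩ := hH.eq_const_mul hk
  obtain ⟨d₀, hd₀⟩ := hH₀.eq_const_mul hk
  have hDψ : ∀ᶠ r in atTop, D r = (c * d - c₀ * d₀) * ψ r := by
    filter_upwards [hc, hc₀, eventually_gt_atTop 0, eventually_ge_atTop Ra] with t h1 h2 h3 h4
    simp only [hD]
    rw [h1, h2, hd t h3, hd₀ t h3, (hψe t h4).1]
    ring
  obtain ⟨R, hR⟩ := eventually_atTop.mp hDψ
  set t := max R 1 + 1 with ht
  have ht0 : 0 < t := by
    have := le_max_right R 1
    linarith
  have hRt : R < t := by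
    have := le_max_left R 1
    linarith
  have hD't : D' t = (c * d - c₀ * d₀) * ψ' t := by
    refine (hsol.hasDerivAt ht0).unique (((hψ.hasDerivAt ht0).const_mul _).congr_of_eventuallyEq ?_)
    filter_upwards [lt_mem_nhds hRt] with x hx using hR x hx.le
  have w1 : D' 1 * ψ 1 - D 1 * ψ' 1 = 0 := by
    rw [hsol.wronskian_const hψ one_pos ht0, hD't, hR t hRt.le]
    ring
  have w2 : ψ' 1 * φ 1 - ψ 1 * φ' 1 ≠ 0 := by
    have := hW 1 one_pos
    intro h
    apply hW0
    linear_combination -h - this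
  have w3 := hsol.wronskian_eq_zero_of_isBigO hB hφ ((hG.origin s hs).sub (hG₀.origin s hs)) one_pos
  have := hsol.eq_const_mul hψ hφ.isSolution w1 w2 hr
  rw [w3, zero_div, zero_mul] at this
  exact sub_eq_zero.mp this

end

/-! ### Pairing a source with the Green's function -/

/-- The covariance form of the source, for functions that need not be test functions. -/
def sourceForm (vt : ℝ → ℂ) (k R : ℝ) (w₁ w₂ : ℝ → ℂ) : ℂ :=
  (∫ r in Set.Ioi (0 : ℝ), ((-(vt r).im : ℝ) : ℂ) * (conj (w₁ r) * w₂ r))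
    + (k : ℂ) * (conj (w₁ R) * w₂ R)

theorem IsPotential.im_eq_zero {vt : ℝ → ℂ} {α Ra : ℝ} (hv : IsPotential vt α Ra) {r : ℝ}
    (hr : Ra ≤ r) : (vt r).im = 0 := by
  rw [hv.tail r hr, Complex.ofReal_im]

/-- The covariance form is continuous under bounded pointwise convergence. -/
theorem tendsto_sourceForm {vt : ℝ → ℂ} {α Ra k R : ℝ} (hv : IsPotential vt α Ra) (hR : Ra ≤ R)
    {ι : Type*} {l : Filter ι} [l.IsCountablyGenerated] {g h : ι → ℝ → ℂ} {w₁ w₂ : ℝ → ℂ} {M : ℝ}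
    (hg : ∀ i, Continuous (g i)) (hh : ∀ i, Continuous (h i))
    (hgM : ∀ i r, ‖g i r‖ ≤ M) (hhM : ∀ i r, ‖h i r‖ ≤ M)
    (hgw : ∀ r, 0 < r → Tendsto (fun i => g i r) l (𝓝 (w₁ r)))
    (hhw : ∀ r, 0 < r → Tendsto (fun i => h i r) l (𝓝 (w₂ r))) :
    Tendsto (fun i => sourceForm vt k R (g i) (h i)) l (𝓝 (sourceForm vt k R w₁ w₂)) := by
  obtain ⟨B, hB0, hB⟩ := hv.exists_bound
  have hR0 : 0 < R := hv.radius_pos.trans_le hR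
  have conjc : ∀ {f : ι → ℂ} {z : ℂ}, Tendsto f l (𝓝 z) →
      Tendsto (fun i => conj (f i)) l (𝓝 (conj z)) := fun hf =>
    (Complex.continuous_conj.tendsto _).comp hf
  refine Tendsto.add ?_ (((conjc (hgw R hR0)).mul (hhw R hR0)).const_mul _)
  refine tendsto_integral_filter_of_dominated_convergence
    (Set.indicator (Set.Ioc 0 Ra) fun _ => B * (M * M)) ?_ ?_ ?_ ?_
  · refine Eventually.of_forall fun i => ?_
    have h1 : AEStronglyMeasurable (fun r => ((-(vt r).im : ℝ) : ℂ))
        (volume.restrict (Set.Ioi 0)) :=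
      Complex.continuous_ofReal.comp_aestronglyMeasurable
        (Complex.continuous_im.comp_aestronglyMeasurable hv.memLp_top.1).neg
    exact h1.mul (((Complex.continuous_conj.comp (hg i)).mul (hh i)).aestronglyMeasurable)
  · refine Eventually.of_forall fun i => ?_
    filter_upwards [ae_restrict_of_ae hB, self_mem_ae_restrict measurableSet_Ioi] with r hr hr0
    rcases le_or_gt r Ra with h | h
    · have hmem : r ∈ Set.Ioc 0 Ra := ⟨hr0, h⟩
      rw [Set.indicator_of_mem hmem, norm_mul, norm_mul, RCLike.norm_conj,
        Complex.norm_real, norm_neg, Real.norm_eq_abs]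
      have hM := (norm_nonneg _).trans (hgM i r)
      have h1 := (Complex.abs_im_le_norm _).trans (hr hr0)
      exact mul_le_mul h1 (mul_le_mul (hgM i r) (hhM i r) (norm_nonneg _) hM) (by positivity) hB0
    · rw [Set.indicator_of_notMem (fun h' => absurd h'.2 (not_le.mpr h)), hv.im_eq_zero h.le]
      simp
  · exact (integrableOn_const (by simp)).integrable_indicator measurableSet_Ioc |>.restrict
  · filter_upwards [self_mem_ae_restrict measurableSet_Ioi] with r hr
    exact ((conjc (hgw r hr)).mul (hhw r hr)).const_mul _

/-- A bounded continuous function on the half-line is a locally uniform limit of uniformly bounded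
test functions. -/
theorem exists_radialTest_approx {w : ℝ → ℂ} (hw : ContinuousOn w (Set.Ioi 0)) {M : ℝ}
    (hM : ∀ r, 0 < r → ‖w r‖ ≤ M) :
    ∃ g : ℕ → RadialTest, (∃ B : ℝ, ∀ n r, ‖g n r‖ ≤ B) ∧
      TendstoLocallyUniformlyOn (fun n r => g n r) w atTop (Set.Ioi 0) := by
  have hM0 : 0 ≤ M := (norm_nonneg _).trans (hM 1 one_pos)
  -- continuous cutoffs, equal to `1` on `[2 / (n + 2), n + 1]`
  set χ : ℕ → ℝ → ℝ := fun n r => max 0 (min 1 (min ((n + 2) * r - 1) (n + 2 - r))) with hχ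
  have cχ : ∀ n, Continuous (χ n) := fun n => by rw [hχ]; fun_prop
  have χ0 : ∀ n r, 0 ≤ χ n r := fun n r => le_max_left _ _
  have χ1 : ∀ n r, χ n r ≤ 1 := fun n r => max_le zero_le_one (min_le_left _ _)
  have χs : ∀ (n : ℕ) (r : ℝ), r ∉ Set.Ioo (1 / ((n : ℝ) + 2)) (n + 2) → χ n r = 0 := by
    intro n r hr
    refine max_eq_left ((min_le_right _ _).trans ?_)
    rcases le_or_gt r (1 / ((n : ℝ) + 2)) with h | h
    · refine (min_le_left _ _).trans ?_
      rw [le_div_iff₀ (by positivity)] at h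
      linarith
    · refine (min_le_right _ _).trans ?_
      have : (n : ℝ) + 2 ≤ r := by
        by_contra h'
        exact hr ⟨h, not_le.mp h'⟩
      linarith
  have χw : ∀ n, Continuous fun r => (χ n r : ℂ) * w r := by
    intro n
    rw [continuous_iff_continuousAt]
    intro r
    rcases lt_or_ge r (1 / ((n : ℝ) + 2)) with h | h
    · refine (continuousAt_const (y := (0 : ℂ))).congr ?_
      filter_upwards [gt_mem_nhds h] with s hs
      rw [χs n s fun h' => absurd h'.1 (not_lt.mpr hs.le)]
      simp
    · have hr : 0 < r := lt_of_lt_of_le (by positivity) h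
      exact (Complex.continuous_ofReal.comp (cχ n)).continuousAt.mul
        (hw.continuousAt (Ioi_mem_nhds hr))
  have happ : ∀ n : ℕ, ∃ f : ℝ → ℂ, ContDiff ℝ (⊤ : ℕ∞) f ∧
      (∀ r, dist (f r) ((χ n r : ℂ) * w r) < 1 / ((n : ℝ) + 1)) ∧
      ∀ r, r ∉ Set.Ioo (1 / ((n : ℝ) + 2)) (n + 2) → f r = 0 := by
    intro n
    obtain ⟨f, hf, hfd, hfs⟩ := (χw n).exists_contDiff_approx (⊤ : ℕ∞)
      (ε := fun _ => 1 / ((n : ℝ) + 1)) continuous_const (fun _ => by positivity)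
    refine ⟨f, hf, fun r => hfd r, fun r hr => ?_⟩
    by_contra h
    have := hfs (Function.mem_support.mpr h)
    exact this (by simp [χs n r hr])
  choose f hf hfd hfs using happ
  refine ⟨fun n => radialTestOf (f n) (hf n) (by positivity) (hfs n), ⟨M + 1, fun n r => ?_⟩, ?_⟩
  · change ‖f n r‖ ≤ M + 1
    have h1 := hfd n r
    rw [dist_eq_norm] at h1
    have h2 : ‖(χ n r : ℂ) * w r‖ ≤ M := by
      rcases le_or_gt r 0 with h | h
      · rw [χs n r fun h' => absurd h'.1 (not_lt.mpr (h.trans (by positivity)))]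
        simpa using hM0
      · rw [norm_mul, Complex.norm_real, Real.norm_eq_abs, abs_of_nonneg (χ0 n r)]
        exact (mul_le_of_le_one_left (norm_nonneg _) (χ1 n r)).trans (hM r h)
    have h3 : 1 / ((n : ℝ) + 1) ≤ 1 := by
      rw [div_le_one (by positivity)]
      have : (0 : ℝ) ≤ n := n.cast_nonneg
      linarith
    calc ‖f n r‖ = ‖(χ n r : ℂ) * w r + (f n r - (χ n r : ℂ) * w r)‖ := by ring_nf
      _ ≤ _ := (norm_add_le _ _).trans (by linarith)
  · rw [Metric.tendstoLocallyUniformlyOn_iff]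
    intro ε hε r₀ hr₀
    have hr₀' : 0 < r₀ := hr₀
    refine ⟨Set.Ioo (r₀ / 2) (r₀ + 1), mem_nhdsWithin_of_mem_nhds
      (Ioo_mem_nhds (by linarith) (by linarith)), ?_⟩
    have e1 := (tendsto_one_div_add_atTop_nhds_zero_nat (𝕜 := ℝ)).eventually_lt_const hε
    have e2 : ∀ᶠ n : ℕ in atTop, r₀ + 4 / r₀ ≤ n := tendsto_natCast_atTop_atTop.eventually_ge_atTop _
    filter_upwards [e1, e2] with n hn1 hn2 r hr
    have hdiv : 0 < 4 / r₀ := by positivity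
    have hone : χ n r = 1 := by
      have k1 : 1 ≤ ((n : ℝ) + 2) * r - 1 := by
        have : 4 / r₀ * (r₀ / 2) = 2 := by field_simp; norm_num
        have h4 : 4 / r₀ * (r₀ / 2) ≤ ((n : ℝ) + 2) * r :=
          mul_le_mul (by linarith) hr.1.le (by positivity) (by positivity)
        linarith
      have k2 : 1 ≤ (n : ℝ) + 2 - r := by linarith [hr.2]
      rw [hχ]
      simp only
      rw [min_eq_left (le_min k1 k2), max_eq_right zero_le_one]
    change dist (w r) (f n r) < ε
    have := hfd n r
    rw [hone, Complex.ofReal_one, one_mul] at this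
    rw [dist_comm]
    exact this.trans hn1

section Random

variable {Ω : Type u} [MeasurableSpace Ω] {P : Measure Ω}

theorem correlation_eq_inner (X Y : Lp ℂ 2 P) : correlation P X Y = inner ℂ X Y := by
  rw [correlation, L2.inner_def]
  refine integral_congr_ae (Eventually.of_forall fun ω => ?_)
  simp [mul_comm]

variable {vt : ℝ → ℂ} {α Ra k Pi R : ℝ} {F : RadialTest →ₗ[ℂ] Lp ℂ 2 P}

/-- The covariance forces an uncorrelated source to be continuous from bounded pointwise convergence
of test functions to convergence in `L²`. -/
theorem tendsto_of_tendsto_zero (hv : IsPotential vt α Ra) (hR : Ra ≤ R)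
    (hF : IsUncorrelatedSource P vt k Pi R F) {ι : Type*} {l : Filter ι} [l.IsCountablyGenerated]
    {g : ι → RadialTest} {M : ℝ} (hM : ∀ i r, ‖g i r‖ ≤ M)
    (hg : ∀ r, 0 < r → Tendsto (fun i => g i r) l (𝓝 0)) :
    Tendsto (fun i => F (g i)) l (𝓝 0) := by
  have h1 := (tendsto_sourceForm (k := k) hv hR (fun i => (g i).continuous)
    (fun i => (g i).continuous) hM hM hg hg).const_mul (Pi : ℂ)
  have h2 : ∀ i, (Pi : ℂ) * sourceForm vt k R (g i) (g i) = ((‖F (g i)‖ ^ 2 : ℝ) : ℂ) := by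
    intro i
    rw [sourceForm, ← hF, correlation_eq_inner, inner_self_eq_norm_sq_to_K]
    simp
  simp only [h2] at h1
  have h3 : (Pi : ℂ) * sourceForm vt k R (fun _ => 0) (fun _ => 0) = ((0 : ℝ) : ℂ) := by
    simp [sourceForm]
  rw [h3] at h1
  have h4 : Tendsto (fun i => ‖F (g i)‖ ^ 2) l (𝓝 0) := by
    have := (Complex.continuous_re.tendsto _).comp h1
    simpa [Function.comp_def, ← Complex.ofReal_pow] using this
  rw [tendsto_zero_iff_norm_tendsto_zero]
  have := (Real.continuous_sqrt.tendsto 0).comp h4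
  simpa [Function.comp_def, Real.sqrt_sq (norm_nonneg _)] using this

/-- The pairing of a source with a bounded continuous function exists and is unique. -/
theorem existsUnique_isPairing (hv : IsPotential vt α Ra) (hR : Ra ≤ R)
    (hF : IsUncorrelatedSource P vt k Pi R F) {w : ℝ → ℂ} (hw : ContinuousOn w (Set.Ioi 0)) {M : ℝ}
    (hM : ∀ r, 0 < r → ‖w r‖ ≤ M) : ∃! X : Lp ℂ 2 P, IsPairing P F w X := by
  obtain ⟨g, ⟨B, hB⟩, hg⟩ := exists_radialTest_approx hw hM
  have hcau : CauchySeq fun n => F (g n) := by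
    rw [cauchySeq_iff_tendsto_dist_atTop_0]
    have := tendsto_of_tendsto_zero hv hR hF (ι := ℕ × ℕ) (l := atTop)
      (g := fun p => g p.1 - g p.2) (M := B + B)
      (fun p r => (norm_sub_le _ _).trans (add_le_add (hB _ _) (hB _ _))) (fun r hr => by
        have h1 := hg.tendsto_at hr
        have h2 := (h1.comp (tendsto_fst (f := atTop) (g := atTop))).sub
          (h1.comp (tendsto_snd (f := atTop) (g := atTop)))
        rw [sub_self, prod_atTop_atTop_eq] at h2
        exact h2)
    have := this.norm
    rw [norm_zero] at this
    refine this.congr fun p => ?_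
    rw [map_sub, dist_eq_norm]
  obtain ⟨X, hX⟩ := cauchySeq_tendsto_of_complete hcau
  refine ⟨X, fun g' hB' hg' => ?_, fun Y hY => tendsto_nhds_unique (hY g ⟨B, hB⟩ hg) hX⟩
  obtain ⟨B', hB'⟩ := hB'
  have := tendsto_of_tendsto_zero hv hR hF (l := atTop)
    (g := fun n => g' n - g n) (M := B' + B)
    (fun n r => (norm_sub_le _ _).trans (add_le_add (hB' _ _) (hB _ _))) (fun r hr => by
      have h2 := (hg'.tendsto_at hr).sub (hg.tendsto_at hr)
      rw [sub_self] at h2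
      exact h2)
  have h3 := this.add hX
  rw [zero_add] at h3
  refine h3.congr fun n => ?_
  rw [map_sub, sub_add_cancel]

/-- The cross correlation of two pairings is given by the covariance form. -/
theorem correlation_eq_of_isPairing (hv : IsPotential vt α Ra) (hR : Ra ≤ R)
    (hF : IsUncorrelatedSource P vt k Pi R F) {w₁ w₂ : ℝ → ℂ} (hw₁ : ContinuousOn w₁ (Set.Ioi 0))
    (hw₂ : ContinuousOn w₂ (Set.Ioi 0)) {M₁ M₂ : ℝ} (hM₁ : ∀ r, 0 < r → ‖w₁ r‖ ≤ M₁)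
    (hM₂ : ∀ r, 0 < r → ‖w₂ r‖ ≤ M₂) {X₁ X₂ : Lp ℂ 2 P} (h₁ : IsPairing P F w₁ X₁)
    (h₂ : IsPairing P F w₂ X₂) : correlation P X₁ X₂ = Pi * sourceForm vt k R w₁ w₂ := by
  obtain ⟨g, ⟨B, hB⟩, hg⟩ := exists_radialTest_approx hw₁ hM₁
  obtain ⟨h, ⟨B', hB'⟩, hh⟩ := exists_radialTest_approx hw₂ hM₂
  have t1 := (tendsto_sourceForm (k := k) hv hR (M := max B B') (fun i => (g i).continuous)
    (fun i => (h i).continuous) (fun i r => (hB i r).trans (le_max_left _ _))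
    (fun i r => (hB' i r).trans (le_max_right _ _)) (fun r hr => hg.tendsto_at hr)
    (fun r hr => hh.tendsto_at hr)).const_mul (Pi : ℂ)
  have t2 := (h₁ g ⟨B, hB⟩ hg).inner (𝕜 := ℂ) (h₂ h ⟨B', hB'⟩ hh)
  rw [correlation_eq_inner]
  refine tendsto_nhds_unique t2 (t1.congr fun n => ?_)
  rw [sourceForm, ← hF, correlation_eq_inner]

end Random

/-! ### The imaginary part of the Green's function -/

section

variable {vt : ℝ → ℂ} {α Ra k : ℝ} {ℓ : ℕ} {φ φ' ψ ψ' : ℝ → ℂ} {W : ℂ}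

theorem radialCoeff_conj_sub (vt : ℝ → ℂ) (ℓ : ℕ) (k r : ℝ) :
    conj (radialCoeff vt ℓ ((k : ℂ) ^ 2) r) - radialCoeff vt ℓ ((k : ℂ) ^ 2) r
      = 2 * Complex.I * ((-(vt r).im : ℝ) : ℂ) := by
  simp only [radialCoeff, map_sub, map_add, Complex.conj_ofReal, map_pow]
  apply Complex.ext <;> simp
  ring

/-- Lagrange's identity for a solution and the complex conjugate of another one. -/
theorem IsSolution.isPrimitive_flux {u u' v v' : ℝ → ℂ}
    (hu : IsSolution (radialCoeff vt ℓ ((k : ℂ) ^ 2)) u u')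
    (hv : IsSolution (radialCoeff vt ℓ ((k : ℂ) ^ 2)) v v') :
    IsPrimitive (fun r => 2 * Complex.I * (((-(vt r).im : ℝ) : ℂ) * (conj (u r) * v r)))
      (fun r => conj (u' r) * v r - conj (u r) * v' r) :=
  (hu.conj.wronskian hv).congr
    (fun r _ => by rw [radialCoeff_conj_sub]; ring) (fun _ _ => rfl)

/-- Boundedness is needed up to both ends: the regular solution is bounded near the origin, and the
outgoing wave is bounded at infinity, since `k` is real. -/
theorem exists_norm_greenOf_le (hk : 0 < k)
    (hφ : IsRegularSolution (radialCoeff vt ℓ ((k : ℂ) ^ 2)) ℓ φ φ')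
    (hψ : ContinuousOn ψ (Set.Ioi 0)) (hψe : ∀ r, Ra ≤ r → ψ r = coulombWave α k ℓ r)
    (W : ℂ) {r : ℝ} (hr : 0 < r) : ∃ M, ∀ s, 0 < s → ‖greenOf φ ψ W r s‖ ≤ M := by
  obtain ⟨C, hC0, hC⟩ := hφ.bound r hr
  obtain ⟨c, hc0, hc⟩ := tendsto_norm_coulombWave hk α ℓ
  obtain ⟨R, hR⟩ := eventually_atTop.mp (hc.eventually_le_const (lt_add_one c))
  obtain ⟨C₁, hC₁⟩ := (isCompact_Icc (a := r) (b := max R Ra)).exists_bound_of_continuousOn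
    (hψ.mono fun s hs => hr.trans_le hs.1)
  have hψb : ∀ s, r ≤ s → ‖ψ s‖ ≤ max C₁ (c + 1) := by
    intro s hs
    rcases le_or_gt s (max R Ra) with h | h
    · exact (hC₁ s ⟨hs, h⟩).trans (le_max_left _ _)
    · rw [hψe s ((le_max_right _ _).trans h.le)]
      exact (hR s ((le_max_left _ _).trans h.le)).trans (le_max_right _ _)
  refine ⟨C * r ^ (ℓ + 1) * max C₁ (c + 1) / ‖W‖, fun s hs => ?_⟩
  rw [greenOf, norm_div, norm_mul]
  have hmin : 0 < min r s := lt_min hr hs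
  gcongr
  · refine ((hC (min r s) ⟨hmin, min_le_left _ _⟩).1).trans ?_
    gcongr
    exact min_le_left _ _
  · exact hψb _ (le_max_left _ _)

/-- The exact energy balance: the imaginary part of the Green's function is the sum of a volume
term and of the flux through the sphere of radius `R`. -/
theorem green_energy_balance (hv : IsPotential vt α Ra)
    (hφ : IsRegularSolution (radialCoeff vt ℓ ((k : ℂ) ^ 2)) ℓ φ φ')
    (hψ : IsSolution (radialCoeff vt ℓ ((k : ℂ) ^ 2)) ψ ψ')
    (hW : ∀ r, 0 < r → φ' r * ψ r - φ r * ψ' r = W) (hW0 : W ≠ 0) {r₁ r₂ R : ℝ} (h₁ : 0 < r₁)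
    (h₁₂ : r₁ ≤ r₂) (h₂R : r₂ ≤ R) (hR : Ra ≤ R) :
    2 * Complex.I * ∫ s in Set.Ioi (0 : ℝ), ((-(vt s).im : ℝ) : ℂ)
        * (conj (greenOf φ ψ W r₁ s) * greenOf φ ψ W r₂ s)
      = greenOf φ ψ W r₁ r₂ - conj (greenOf φ ψ W r₁ r₂)
        + conj (φ r₁ / W) * (φ r₂ / W) * (conj (ψ' R) * ψ R - conj (ψ R) * ψ' R) := by
  have h₂ : 0 < r₂ := h₁.trans_le h₁₂
  have hR0 : 0 < R := h₂.trans_le h₂R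
  have hcW : conj W ≠ 0 := (map_ne_zero _).mpr hW0
  obtain ⟨B, hB0, hB⟩ := hv.exists_bound
  have Pφφ := hφ.isSolution.isPrimitive_flux hφ.isSolution
  have Pψφ := hψ.isPrimitive_flux hφ.isSolution
  have Pψψ := hψ.isPrimitive_flux hψ
  set f : ℝ → ℂ := fun s => ((-(vt s).im : ℝ) : ℂ)
        * (conj (greenOf φ ψ W r₁ s) * greenOf φ ψ W r₂ s) with hf
  -- the flux of the regular solution vanishes at the origin
  obtain ⟨C, hC0, hC⟩ := hφ.bound r₁ h₁
  have hIoc : ∀ᶠ e in 𝓝[>] (0 : ℝ), e ∈ Set.Ioc 0 r₁ := Ioc_mem_nhdsGT h₁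
  have lim0 : Tendsto (fun r => conj (φ' r) * φ r - conj (φ r) * φ' r) (𝓝[>] 0) (𝓝 0) := by
    have h1 : Tendsto (fun r : ℝ => 2 * (C * r ^ ℓ * (C * r ^ (ℓ + 1)))) (𝓝[>] 0) (𝓝 0) := by
      have : Tendsto (fun r : ℝ => 2 * (C * r ^ ℓ * (C * r ^ (ℓ + 1)))) (𝓝 0)
          (𝓝 (2 * (C * 0 ^ ℓ * (C * 0 ^ (ℓ + 1))))) := Continuous.tendsto (by fun_prop) 0
      rw [zero_pow (Nat.succ_ne_zero ℓ), mul_zero, mul_zero, mul_zero] at this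
      exact this.mono_left nhdsWithin_le_nhds
    refine squeeze_zero_norm' ?_ h1
    filter_upwards [hIoc] with r hr
    obtain ⟨b1, b2⟩ := hC r hr
    refine (norm_sub_le _ _).trans ?_
    rw [norm_mul, norm_mul, RCLike.norm_conj, RCLike.norm_conj]
    have := hr.1.le
    calc _ ≤ C * r ^ ℓ * (C * r ^ (ℓ + 1)) + C * r ^ (ℓ + 1) * (C * r ^ ℓ) := by gcongr
      _ = _ := by ring
  have iφφ : IntegrableOn (fun r => 2 * Complex.I * (((-(vt r).im : ℝ) : ℂ)
      * (conj (φ r) * φ r))) (Set.Ioc 0 r₁) := by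
    refine IntegrableOn.of_bound (C := 2 * (B * ((C * r₁ ^ (ℓ + 1)) * (C * r₁ ^ (ℓ + 1)))))
      (by simp) ?_ ?_
    · have hsub : Set.Ioc 0 r₁ ⊆ Set.Ioi (0 : ℝ) := fun r hr => hr.1
      have m1 : AEStronglyMeasurable (fun r => ((-(vt r).im : ℝ) : ℂ))
          (volume.restrict (Set.Ioc 0 r₁)) :=
        Complex.continuous_ofReal.comp_aestronglyMeasurable
          (Complex.continuous_im.comp_aestronglyMeasurable
            (hv.memLp_top.1.mono_set hsub)).neg
      have cφ := hφ.isSolution.fst.continuousOn.mono hsub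
      exact aestronglyMeasurable_const.mul (m1.mul
        (((Complex.continuous_conj.comp_continuousOn cφ).mul cφ).aestronglyMeasurable
          measurableSet_Ioc))
    · filter_upwards [ae_restrict_of_ae hB, self_mem_ae_restrict measurableSet_Ioc] with r hr hr0
      have h1 := (Complex.abs_im_le_norm _).trans (hr hr0.1)
      have h2 : ‖φ r‖ ≤ C * r₁ ^ (ℓ + 1) := by
        refine ((hC r hr0).1).trans ?_
        have := hr0.1.le
        have := hr0.2
        gcongr
      rw [norm_mul, norm_mul, norm_mul, norm_mul, RCLike.norm_conj, Complex.norm_I,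
        Complex.norm_real, norm_neg, Real.norm_eq_abs]
      simp only [Complex.norm_ofNat, mul_one]
      gcongr
  have e1 : ∫ s in (0 : ℝ)..r₁, 2 * Complex.I * f s
      = conj (ψ r₁ / W) * (ψ r₂ / W) * (conj (φ' r₁) * φ r₁ - conj (φ r₁) * φ' r₁) := by
    have := Pφφ.eq_add_integral lim0 h₁ iφφ
    rw [zero_add] at this
    rw [this, ← intervalIntegral.integral_const_mul]
    refine intervalIntegral.integral_congr fun s hs => ?_
    rw [Set.uIcc_of_le h₁.le] at hs
    simp only [hf, greenOf_of_ge hs.2, greenOf_of_ge (hs.2.trans h₁₂), map_div₀, map_mul]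
    ring
  have c2 : ∀ s ∈ Set.uIcc r₁ r₂, 2 * Complex.I * f s = conj (φ r₁ / W) * (ψ r₂ / W)
      * (2 * Complex.I * (((-(vt s).im : ℝ) : ℂ) * (conj (ψ s) * φ s))) := by
    intro s hs
    rw [Set.uIcc_of_le h₁₂] at hs
    simp only [hf, greenOf_of_le hs.1, greenOf_of_ge hs.2, map_div₀, map_mul]
    ring
  have c3 : ∀ s ∈ Set.uIcc r₂ R, 2 * Complex.I * f s = conj (φ r₁ / W) * (φ r₂ / W)
      * (2 * Complex.I * (((-(vt s).im : ℝ) : ℂ) * (conj (ψ s) * ψ s))) := by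
    intro s hs
    rw [Set.uIcc_of_le h₂R] at hs
    simp only [hf, greenOf_of_le hs.1, greenOf_of_le (h₁₂.trans hs.1), map_div₀, map_mul]
    ring
  have e2 : ∫ s in r₁..r₂, 2 * Complex.I * f s = conj (φ r₁ / W) * (ψ r₂ / W)
      * ((conj (ψ' r₂) * φ r₂ - conj (ψ r₂) * φ' r₂)
        - (conj (ψ' r₁) * φ r₁ - conj (ψ r₁) * φ' r₁)) := by
    rw [Pψφ.sub_eq r₁ r₂ h₁ h₂, ← intervalIntegral.integral_const_mul]
    exact intervalIntegral.integral_congr c2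
  have e3 : ∫ s in r₂..R, 2 * Complex.I * f s = conj (φ r₁ / W) * (φ r₂ / W)
      * ((conj (ψ' R) * ψ R - conj (ψ R) * ψ' R)
        - (conj (ψ' r₂) * ψ r₂ - conj (ψ r₂) * ψ' r₂)) := by
    rw [Pψψ.sub_eq r₂ R h₂ hR0, ← intervalIntegral.integral_const_mul]
    exact intervalIntegral.integral_congr c3
  have i1 : IntervalIntegrable (fun s => 2 * Complex.I * f s) volume 0 r₁ := by
    refine IntervalIntegrable.congr (f := fun s => conj (ψ r₁ / W) * (ψ r₂ / W) *
      (2 * Complex.I * (((-(vt s).im : ℝ) : ℂ) * (conj (φ s) * φ s)))) ?_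
      (((intervalIntegrable_iff_integrableOn_Ioc_of_le h₁.le).mpr iφφ).const_mul _)
    intro s hs
    rw [Set.uIoc_of_le h₁.le] at hs
    simp only [hf, greenOf_of_ge hs.2, greenOf_of_ge (hs.2.trans h₁₂), map_div₀, map_mul]
    ring
  have i2 : IntervalIntegrable (fun s => 2 * Complex.I * f s) volume r₁ r₂ :=
    ((Pψφ.integrable r₁ r₂ h₁ h₂).const_mul _).congr fun s hs =>
      (c2 s (Set.uIoc_subset_uIcc hs)).symm
  have i3 : IntervalIntegrable (fun s => 2 * Complex.I * f s) volume r₂ R :=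
    ((Pψψ.integrable r₂ R h₂ hR0).const_mul _).congr fun s hs =>
      (c3 s (Set.uIoc_subset_uIcc hs)).symm
  have e0 : 2 * Complex.I * ∫ s in Set.Ioi (0 : ℝ), f s = ∫ s in (0 : ℝ)..R, 2 * Complex.I * f s := by
    rw [intervalIntegral.integral_const_mul, intervalIntegral.integral_of_le hR0.le]
    congr 1
    refine setIntegral_eq_of_subset_of_forall_sdiff_eq_zero measurableSet_Ioi
      (fun s hs => hs.1) fun s hs => ?_
    have : R ≤ s := by
      by_contra h
      exact hs.2 ⟨hs.1, (not_le.mp h).le⟩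
    simp [hf, hv.im_eq_zero (hR.trans this)]
  have w1 := congrArg (starRingEnd ℂ) (hW r₁ h₁)
  have w2 := hW r₂ h₂
  simp only [map_sub, map_mul] at w1
  rw [e0, ← intervalIntegral.integral_add_adjacent_intervals (i1.trans i2) i3,
    ← intervalIntegral.integral_add_adjacent_intervals i1 i2, e1, e2, e3, greenOf_of_le h₁₂]
  simp only [map_div₀, map_mul]
  field_simp
  linear_combination (φ r₁ * ψ r₂) * w1 - (conj (φ r₁) * conj (ψ r₂)) * w2

theorem sourceForm_conj_symm (vt : ℝ → ℂ) (k R : ℝ) (w₁ w₂ : ℝ → ℂ) :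
    sourceForm vt k R w₂ w₁ = conj (sourceForm vt k R w₁ w₂) := by
  simp only [sourceForm, map_add, map_mul, Complex.conj_conj, Complex.conj_ofReal]
  rw [← integral_conj]
  congr 1
  · refine integral_congr_ae (Eventually.of_forall fun s => ?_)
    simp only [map_mul, Complex.conj_conj, Complex.conj_ofReal]
    ring
  · ring

/-- The energy balance with its flux term replaced, by the radiation condition, by the surface part
`k · conj (G r₁ R) · G r₂ R` of the covariance form, at the cost of an error of order `1/R`. -/
theorem exists_norm_im_greenOf_sub_sourceForm_le (hv : IsPotential vt α Ra) (hk : 0 < k)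
    (hφ : IsRegularSolution (radialCoeff vt ℓ ((k : ℂ) ^ 2)) ℓ φ φ')
    (hψ : IsSolution (radialCoeff vt ℓ ((k : ℂ) ^ 2)) ψ ψ')
    (hψe : ∀ r, Ra ≤ r → ψ r = coulombWave α k ℓ r ∧ ψ' r = coulombWaveDeriv α k ℓ r)
    (hW : ∀ r, 0 < r → φ' r * ψ r - φ r * ψ' r = W) (hW0 : W ≠ 0) {r₁ r₂ : ℝ} (h₁ : 0 < r₁)
    (h₂ : 0 < r₂) :
    ∃ C R₀ : ℝ, ∀ R, Ra ≤ R → R₀ ≤ R →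
      ‖(((greenOf φ ψ W r₁ r₂).im : ℝ) : ℂ)
        - sourceForm vt k R (greenOf φ ψ W r₁) (greenOf φ ψ W r₂)‖ ≤ C / R := by
  wlog h₁₂ : r₁ ≤ r₂ generalizing r₁ r₂
  · obtain ⟨C, R₀, h⟩ := this h₂ h₁ (le_of_not_ge h₁₂)
    refine ⟨C, R₀, fun R hR hR₀ => ?_⟩
    have := h R hR hR₀
    rwa [sourceForm_conj_symm, greenOf_symm, ← Complex.conj_ofReal, ← map_sub,
      RCLike.norm_conj] at this
  obtain ⟨K, hK0, hK⟩ := (coulombWave_flux hk α ℓ).exists_pos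
  rw [IsBigOWith] at hK
  obtain ⟨R₁, hR₁⟩ := eventually_atTop.mp hK
  set A := conj (φ r₁ / W) * (φ r₂ / W) with hA
  refine ⟨‖A‖ * K, max (max R₁ r₂) 1, fun R hR hR₀ => ?_⟩
  have hRR₁ : R₁ ≤ R := (le_max_left _ _).trans ((le_max_left _ _).trans hR₀)
  have hRr₂ : r₂ ≤ R := (le_max_right _ _).trans ((le_max_left _ _).trans hR₀)
  have hR0 : 0 < R := h₂.trans_le hRr₂
  have bal := green_energy_balance hv hφ hψ hW hW0 h₁ h₁₂ hRr₂ hR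
  have flux := hR₁ R hRR₁
  rw [← (hψe R hR).1, ← (hψe R hR).2, norm_div, norm_one, Real.norm_eq_abs, abs_of_pos hR0] at flux
  set G := greenOf φ ψ W r₁ r₂ with hG
  set J := ∫ s in Set.Ioi (0 : ℝ), ((-(vt s).im : ℝ) : ℂ)
        * (conj (greenOf φ ψ W r₁ s) * greenOf φ ψ W r₂ s) with hJ
  have hGim : G - conj G = 2 * Complex.I * (G.im : ℂ) := by
    rw [Complex.sub_conj]
    push_cast
    ring
  set E := conj (ψ' R) * ψ R - conj (ψ R) * ψ' R + 2 * Complex.I * k * (conj (ψ R) * ψ R) with hE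
  have hform : sourceForm vt k R (greenOf φ ψ W r₁) (greenOf φ ψ W r₂)
      = J + k * (A * (conj (ψ R) * ψ R)) := by
    rw [sourceForm, greenOf_of_le (h₁₂.trans hRr₂), greenOf_of_le hRr₂, hA]
    simp only [map_div₀, map_mul]
    ring
  have key : (2 * Complex.I) * ((G.im : ℂ) - (J + k * (A * (conj (ψ R) * ψ R)))) = -(A * E) := by
    rw [hE]
    linear_combination -bal - hGim
  have hnorm := congrArg norm key
  rw [norm_mul, norm_neg, norm_mul, norm_mul, Complex.norm_I, Complex.norm_ofNat] at hnorm
  rw [hform]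
  have h3 : ‖A‖ * ‖E‖ ≤ ‖A‖ * (K * (1 / R)) := by gcongr
  have h4 : 0 ≤ ‖A‖ * (K * (1 / R)) := by positivity
  have h5 : ‖A‖ * (K * (1 / R)) = ‖A‖ * K / R := by ring
  rw [← h5]
  linarith

end

end PassiveSources

end

theorem proposition2p1 (vt : ℝ → ℂ) (α Ra : ℝ) (hv : PassiveSources.IsPotential vt α Ra)
    (k : ℝ) (hk : 0 < k) (hk_reg : k ∉ PassiveSources.singularSet vt) (ℓ : ℕ) :
    -- the radial radiation Green's function exists and is unique
    ∃ G : ℝ → ℝ → ℂ, PassiveSources.IsOutgoingGreen vt α k ℓ G ∧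
      (∀ G' : ℝ → ℝ → ℂ, PassiveSources.IsOutgoingGreen vt α k ℓ G' →
        ∀ r r' : ℝ, 0 < r → 0 < r' → G' r r' = G r r') ∧
      ∀ Pi : ℝ, 0 < Pi →
        -- the radiated field `∫ G(r, r') f(r') dr'` is a well-defined random variable
        (∀ R : ℝ, Ra ≤ R →
          ∀ (Ω : Type u) [MeasurableSpace Ω] (P : Measure Ω) [IsProbabilityMeasure P]
            (F : PassiveSources.RadialTest →ₗ[ℂ] Lp ℂ 2 P),
            PassiveSources.IsUncorrelatedSource P vt k Pi R F →
            ∀ r : ℝ, 0 < r → ∃! X : Lp ℂ 2 P, PassiveSources.IsPairing P F (G r) X) ∧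
        -- cross correlations of the field give the imaginary part of `G` up to `O(1/R)`
        ∀ r₁ r₂ : ℝ, 0 < r₁ → 0 < r₂ →
          ∃ C R₀ : ℝ, ∀ R : ℝ, Ra ≤ R → R₀ ≤ R →
            ∀ (Ω : Type u) [MeasurableSpace Ω] (P : Measure Ω) [IsProbabilityMeasure P]
              (F : PassiveSources.RadialTest →ₗ[ℂ] Lp ℂ 2 P),
              PassiveSources.IsUncorrelatedSource P vt k Pi R F →
              ∀ φ₁ φ₂ : Lp ℂ 2 P,
                PassiveSources.IsPairing P F (G r₁) φ₁ →
                PassiveSources.IsPairing P F (G r₂) φ₂ →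
                ‖((Pi * (G r₁ r₂).im : ℝ) : ℂ) - PassiveSources.correlation P φ₁ φ₂‖
                  ≤ C / R := by
  have hreg : PassiveSources.KernelRegularAt vt k := by
    by_contra h
    exact hk_reg ⟨hk, fun h' => h h'.1⟩
  obtain ⟨φ, φ', hφ, hne⟩ :=
    PassiveSources.exists_isRegularSolution_wronskian_ne_zero hv hk hreg ℓ
  obtain ⟨ψ, ψ', hψ, hψe⟩ := hv.exists_outgoing hk ℓ
  set W := φ' Ra * PassiveSources.coulombWave α k ℓ Ra
    - φ Ra * PassiveSources.coulombWaveDeriv α k ℓ Ra with hW_def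
  have hW : ∀ r, 0 < r → φ' r * ψ r - φ r * ψ' r = W := fun r hr => by
    rw [hφ.isSolution.wronskian_const hψ hr hv.radius_pos, (hψe Ra le_rfl).1, (hψe Ra le_rfl).2]
  have cG : ∀ r, 0 < r → ContinuousOn (PassiveSources.greenOf φ ψ W r) (Set.Ioi 0) :=
    fun r hr => (PassiveSources.continuousOn_greenOf hφ.isSolution.fst.continuousOn
      hψ.fst.continuousOn W hr).congr fun s _ => PassiveSources.greenOf_symm _ _ _ _ _
  have bG : ∀ r, 0 < r → ∃ M, ∀ s, 0 < s → ‖PassiveSources.greenOf φ ψ W r s‖ ≤ M := fun r hr =>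
    PassiveSources.exists_norm_greenOf_le hk hφ hψ.fst.continuousOn (fun s hs => (hψe s hs).1) W hr
  refine ⟨PassiveSources.greenOf φ ψ W,
    PassiveSources.isOutgoingGreen_greenOf hv hk hφ hψ hψe hW hne,
    fun G' hG' r r' hr hr' => hG'.eq_greenOf hv hk hφ hψ hψe hW hne hr hr',
    fun Pi hPi => ⟨fun R hR Ω _ P _ F hF r hr => ?_, fun r₁ r₂ h₁ h₂ => ?_⟩⟩
  · obtain ⟨M, hM⟩ := bG r hr
    exact PassiveSources.existsUnique_isPairing hv hR hF (cG r hr) hM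
  · obtain ⟨M₁, hM₁⟩ := bG r₁ h₁
    obtain ⟨M₂, hM₂⟩ := bG r₂ h₂
    obtain ⟨C, R₀, hC⟩ := PassiveSources.exists_norm_im_greenOf_sub_sourceForm_le hv hk hφ hψ hψe
      hW hne h₁ h₂
    refine ⟨Pi * C, R₀, fun R hR hR₀ Ω _ P _ F hF φ₁ φ₂ hφ₁ hφ₂ => ?_⟩
    rw [PassiveSources.correlation_eq_of_isPairing hv hR hF (cG r₁ h₁) (cG r₂ h₂) hM₁ hM₂ hφ₁ hφ₂,
      Complex.ofReal_mul, ← mul_sub, norm_mul, Complex.norm_real, Real.norm_eq_abs,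
      abs_of_pos hPi, mul_div_assoc]
    exact mul_le_mul_of_nonneg_left (hC R hR hR₀) hPi.le
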